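/- Equip $\mathbb{Z}^N$ with the standard negative definite form, $e_i\cdot e_j=-\delta_{ij}$. Let $S=\{v_1,\dots,v_N\}\subset\mathbb{Z}^N$ be a set of $N$ vectors such that $v_i\cdot v_i\le -2$ for all $i$ and $v_i\cdot v_j\in\{0,1\}$ for $i\ne j$. Its intersection graph $\Gamma_S$ has vertices $v_1,\dots,v_N$ and an edge between $v_i$ and $v_j$ ($i\neq j$) whenever $v_i\cdot v_j=1$. Call $S$ \emph{good} if $\Gamma_S$ is linear (a disjoint union of paths, isolated vertices being allowed) and $S$ is irreducible: any two $v,w\in S$ can be joined by a sequence $v=u_0,u_1,\dots,u_n=w$ in $S$ such that for each $i<n$ some basis vector $e_k$ satisfies $e_k\cdot u_i\ne0$ and $e_k\cdot u_{i+1}\neq 0$. Write $I(S)=\sum_{i=1}^N(-3-v_i\cdot v_i)$ and let $c(S)$ be the number of connected components of $\Gamma_S$. Let $S\subset\mathbb{Z}^N$ be a good subset with $I(S)+c(S)\le 0$. Suppose that there is a vector $v\in\mathbb{Z}^N$ such that every connected component of $\Gamma_S$ contains a vector $w$ with $v\cdot w=1$, and $v$ is orthogonal to all other vectors of that component. Then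 $c(S)\le 2$. -/

import Mathlib

namespace LinearSubset

/-- The standard negative definite form on the lattice of integer vectors indexed by `κ`,
i.e. the bilinear form with `e_i · e_j = -δ_ij`. -/
def form {κ : Type*} [Fintype κ] (x y : κ → ℤ) : ℤ := -(∑ k, x k * y k)

/-- The intersection graph of a family of vectors: `i` and `j` are joined by an edge iff `i ≠ j`
and `S i · S j = 1`. -/
def intersectionGraph {ι κ : Type*} [Fintype κ] (S : ι → κ → ℤ) : SimpleGraph ι where
  Adj i j := i ≠ j ∧ form (S i) (S j) = 1
  symm := ⟨fun i j h => ⟨h.1.symm, by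
    have h2 := h.2
    simp only [form, mul_comm] at h2 ⊢
    exact h2⟩⟩
  loopless := ⟨fun _ h => h.1 rfl⟩

/-- A (finite) graph is linear if it is a disjoint union of paths (an isolated vertex being a path
with one vertex): it has no cycles, and every vertex has at most two neighbours. -/
def IsLinearGraph {ι : Type*} (G : SimpleGraph ι) : Prop :=
  G.IsAcyclic ∧ ∀ i, (G.neighborSet i).ncard ≤ 2

/-- A linear subset: as many vectors as the rank of the lattice, each of square at most `-2`,
two different ones having product `0` or `1`, and with linear intersection graph.
(The vectors of such a family are automatically distinct, see `IsLinear.injective`, so such a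
family is the same thing as an enumerated subset of the lattice.) -/
structure IsLinear {ι κ : Type*} [Fintype ι] [Fintype κ] (S : ι → κ → ℤ) : Prop where
  card_eq : Fintype.card ι = Fintype.card κ
  self_le : ∀ i, form (S i) (S i) ≤ -2
  form_mem : ∀ i j, i ≠ j → form (S i) (S j) = 0 ∨ form (S i) (S j) = 1
  linear : IsLinearGraph (intersectionGraph S)

theorem IsLinear.injective {ι κ : Type*} [Fintype ι] [Fintype κ] {S : ι → κ → ℤ}
    (h : IsLinear S) : Function.Injective S := by
  intro i j hij
  by_contra hne
  have h1 := h.form_mem i j hne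
  have h2 := h.self_le j
  rw [hij] at h1
  omega

/-- Two vectors are linked if some basis vector `e_k` hits both of them, that is, if
`e_k · v ≠ 0` and `e_k · w ≠ 0` for some `k`. -/
def Linked {κ : Type*} [Fintype κ] [DecidableEq κ] (v w : κ → ℤ) : Prop :=
  ∃ k, form (Pi.single k 1) v ≠ 0 ∧ form (Pi.single k 1) w ≠ 0

/-- A family is irreducible if any two of its members are joined by a sequence of members in which
consecutive ones are linked. -/
def IsIrreducible {ι κ : Type*} [Fintype κ] [DecidableEq κ] (S : ι → κ → ℤ) : Prop :=
  ∀ i j, Relation.ReflTransGen (fun a b => Linked (S a) (S b)) i j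

/-- A good subset is an irreducible linear subset. -/
structure IsGood {ι κ : Type*} [Fintype ι] [Fintype κ] [DecidableEq κ] (S : ι → κ → ℤ) :
    Prop where
  isLinear : IsLinear S
  irreducible : IsIrreducible S

/-- `I(S) = ∑ i, (-3 - v_i · v_i)`. -/
def I {ι κ : Type*} [Fintype ι] [Fintype κ] (S : ι → κ → ℤ) : ℤ :=
  ∑ i, (-3 - form (S i) (S i))

/-- `c(S)`: the number of connected components of the intersection graph. -/
noncomputable def c {ι κ : Type*} [Fintype κ] (S : ι → κ → ℤ) : ℕ :=
  Nat.card (intersectionGraph S).ConnectedComponent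

/-- In every connected component of the intersection graph there is one vector with which `v` has
product `1`, and `v` is orthogonal to all the other vectors of that component. -/
def LinkedOnceToEachComponent {ι κ : Type*} [Fintype κ] (S : ι → κ → ℤ) (v : κ → ℤ) : Prop :=
  ∀ C : (intersectionGraph S).ConnectedComponent,
    ∃ i ∈ C.supp, form v (S i) = 1 ∧ ∀ j ∈ C.supp, j ≠ i → form v (S j) = 0

end LinearSubset

namespace LinearSubset

set_option linter.unusedSectionVars false

open Finset
open scoped Classical

variable {ι κ : Type*} [Fintype κ]

/-! After reversing the sign of the form, the Gram matrix of the family is the Laplacian of a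
disjoint union of paths plus the nonnegative diagonal "norm minus degree". Expanding a vector of the
span in the family is then a discrete Dirichlet problem: the coefficients form a potential whose
source is the list of products with the family. Sources are integral, so for `r ≥ 0` every nonempty
superlevel set `{φ > r}` has flux at least `1`, and summing over levels bounds the energy of a
potential below by its oscillation around `0` (`Fam.osc_le_energy`). For a basis vector in the span
the energy is exactly `1`.

The `N` vectors are independent, so all basis vectors are in the span. Let `t = -v` be the linking
vector. By reciprocity `t q` is a sum of values of the potential of `e_q`, hence at most the energy
`1`; equality holds throughout and yields `Fam.link_structure`: `t` is a sum of signed basis vectors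
(the labels), each component has exactly one label, and a label hits only linked vertices, all with
the same sign. So the linked vertices fall into blocks, one for each label, and any other basis
vector has coordinate sum `0` on each block (`Sys.sum_block`).

The hypothesis `I + c ≤ 0` says that the sum of the norms plus the number of components is at most
`3N`: the columns of the coordinate matrix are small. In a minimal counterexample with at least
three components, `MinSys.pair_cases` shows that a basis vector hitting just two vectors, each with
coordinate `±1`, either comes with another one whose column has square sum `4`, or belongs to a
component of three vectors with both ends of norm `2`. The tools are `EndLinked.closed` (two chains
linked at their ends by such a basis vector meet nothing else), `Fam.exists_twin`, and contraction
of a leaf of norm `2` (`Sys.contr`). Counting (`MinSys.tight`) makes all components of the second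
kind and all blocks of size three. The three centres of a block then have the same norm, and either
three signs would add up to `0` or a label would have energy `3` (`MinSys.false`). -/

/-- A family of integer vectors indexed by a finite set `s`, of norms at least `2` for the standard
positive definite form, with mutual products `0` or `-1`, and whose intersection graph is laid out
on the integer line: vectors with product `-1` have neighbouring positions. -/
structure Fam (s : Finset ι) (v : ι → κ → ℤ) (pos : ι → ℤ) : Prop where
  inj : Function.Injective pos
  diag : ∀ i ∈ s, 2 ≤ v i ⬝ᵥ v i
  off : ∀ i ∈ s, ∀ j ∈ s, i ≠ j → v i ⬝ᵥ v j = 0 ∨ v i ⬝ᵥ v j = -1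
  near : ∀ i ∈ s, ∀ j ∈ s, v i ⬝ᵥ v j = -1 → pos j = pos i + 1 ∨ pos j = pos i - 1

/-- The neighbours of `y` in the intersection graph of the family `v` on `s`. -/
noncomputable def nb (s : Finset ι) (v : ι → κ → ℤ) (y : ι) : Finset ι :=
  s.filter fun z => v y ⬝ᵥ v z = -1

/-- `φ` is a potential on `s` with source `h`: the Gram matrix of the family maps `φ` to `h`. -/
def IsPot (s : Finset ι) (v : ι → κ → ℤ) (h : ι → ℤ) (φ : ι → ℚ) : Prop :=
  ∀ y ∈ s, ∑ z ∈ s, φ z * ((v y ⬝ᵥ v z : ℤ) : ℚ) = h y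

/-! ### Potentials on linear graphs and their flux. -/

section

variable {s A Z D : Finset ι} {v : ι → κ → ℤ} {pos : ι → ℤ} {h : ι → ℤ} {φ : ι → ℚ} {x y z : ι}

theorem mem_nb : z ∈ nb s v y ↔ z ∈ s ∧ v y ⬝ᵥ v z = -1 := by
  simp [nb]

theorem nb_subset : nb s v y ⊆ s := filter_subset _ _

theorem mem_nb_comm (hy : y ∈ s) (hz : z ∈ nb s v y) : y ∈ nb s v z := by
  rw [mem_nb] at hz ⊢
  exact ⟨hy, by rw [dotProduct_comm]; exact hz.2⟩

theorem Fam.mono {s' : Finset ι} (F : Fam s v pos) (hs : s' ⊆ s) : Fam s' v pos :=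
  ⟨F.inj, fun i hi => F.diag i (hs hi), fun i hi j hj => F.off i (hs hi) j (hs hj),
    fun i hi j hj => F.near i (hs hi) j (hs hj)⟩

theorem Fam.ne_of_mem_nb (F : Fam s v pos) (hy : y ∈ s) (hz : z ∈ nb s v y) : z ≠ y := by
  rintro rfl
  have h1 := F.diag _ hy
  have h2 := (mem_nb.1 hz).2
  omega

theorem Fam.dot_eq_zero (F : Fam s v pos) (hy : y ∈ s) (hz : z ∈ s) (hne : z ≠ y)
    (h : z ∉ nb s v y) : v y ⬝ᵥ v z = 0 := by
  rcases F.off y hy z hz hne.symm with h1 | h1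
  · exact h1
  · exact absurd (mem_nb.2 ⟨hz, h1⟩) h

theorem Fam.pos_nb (F : Fam s v pos) (hy : y ∈ s) (hz : z ∈ nb s v y) :
    pos z = pos y + 1 ∨ pos z = pos y - 1 :=
  F.near y hy z (nb_subset hz) (mem_nb.1 hz).2

theorem Fam.card_nb_le (F : Fam s v pos) (hy : y ∈ s) : (nb s v y).card ≤ 2 := by
  have h1 : (nb s v y).image pos ⊆ {pos y + 1, pos y - 1} := by
    intro p hp
    obtain ⟨z, hz, rfl⟩ := mem_image.1 hp
    have := F.pos_nb hy hz
    simpa using this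
  calc (nb s v y).card = ((nb s v y).image pos).card := (card_image_of_injective _ F.inj).symm
    _ ≤ _ := card_le_card h1
    _ ≤ 2 := card_le_two

/-- Every nonempty set of vertices contains a vertex with at most one neighbour in the set
enlarged by a further point. -/
theorem Fam.exists_card_nb_inter_le_one (F : Fam s v pos) (hA : A ⊆ s) (hne : A.Nonempty)
    (hZ : Z.card ≤ 1) : ∃ y ∈ A, (nb s v y ∩ (A ∪ Z)).card ≤ 1 := by
  obtain ⟨a, ha, hamax⟩ := exists_max_image A pos hne
  obtain ⟨b, hb, hbmin⟩ := exists_min_image A pos hne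
  by_contra! hcon
  have key : ∀ y ∈ A, ∃ p ∈ A ∪ Z, ∃ q ∈ A ∪ Z, pos p = pos y + 1 ∧ pos q = pos y - 1 := by
    intro y hy
    obtain ⟨p, hp, q, hq, hpq⟩ := one_lt_card.1 (hcon y hy)
    rw [mem_inter] at hp hq
    have h1 := F.pos_nb (hA hy) hp.1
    have h2 := F.pos_nb (hA hy) hq.1
    have h3 : pos p ≠ pos q := fun h => hpq (F.inj h)
    rcases h1 with h1 | h1 <;> rcases h2 with h2 | h2
    · omega
    · exact ⟨p, hp.2, q, hq.2, h1, h2⟩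
    · exact ⟨q, hq.2, p, hp.2, h2, h1⟩
    · omega
  -- The successor of the last vertex of `A` and the predecessor of the first one lie outside `A`,
  -- so both are the single point of `Z`, which cannot be on both sides.
  obtain ⟨p, hp, -, -, hp1, -⟩ := key a ha
  obtain ⟨-, -, q, hq, -, hq1⟩ := key b hb
  have hpZ : p ∈ Z := by
    rcases mem_union.1 hp with h | h
    · have := hamax p h; omega
    · exact h
  have hqZ : q ∈ Z := by
    rcases mem_union.1 hq with h | h
    · have := hbmin q h; omega
    · exact h
  have hpq := card_le_one.1 hZ p hpZ q hqZ
  have := hbmin a ha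
  subst hpq
  omega

theorem Fam.pot_eq (F : Fam s v pos) (hφ : IsPot s v h φ) (hy : y ∈ s) :
    ((v y ⬝ᵥ v y : ℤ) : ℚ) * φ y = h y + ∑ z ∈ nb s v y, φ z := by
  have h1 := hφ y hy
  rw [← add_sum_erase s _ hy] at h1
  have h2 : ∑ z ∈ s.erase y, φ z * ((v y ⬝ᵥ v z : ℤ) : ℚ) = -∑ z ∈ nb s v y, φ z := by
    have h3 : nb s v y ⊆ s.erase y := fun z hz =>
      mem_erase.2 ⟨F.ne_of_mem_nb hy hz, nb_subset hz⟩
    rw [← sum_subset h3, ← sum_neg_distrib]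
    · refine sum_congr rfl fun z hz => ?_
      rw [(mem_nb.1 hz).2]; push_cast; ring
    · intro z hz hz'
      rw [F.dot_eq_zero hy (mem_of_mem_erase hz) (ne_of_mem_erase hz) hz']
      simp
  rw [h2] at h1
  linarith

/-- The flux of a potential out of a set on which it is larger than on the neighbouring vertices:
it is at least what passes to a single vertex outside, and the inequality is strict. -/
theorem Fam.flux (F : Fam s v pos) (hφ : IsPot s v h φ) (hA : A ⊆ s) (hne : A.Nonempty)
    (hZ : Z.card ≤ 1) (hd : Disjoint A Z) (hpos : ∀ y ∈ A, 0 < φ y)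
    (hout : ∀ y ∈ A, ∀ x ∈ nb s v y, x ∉ A → x ∉ Z → φ x < φ y) :
    ∑ y ∈ A, ∑ x ∈ nb s v y ∩ Z, (φ y - φ x) < ∑ y ∈ A, (h y : ℚ) := by
  set a : ι → ℚ := fun y => ((v y ⬝ᵥ v y : ℤ) : ℚ) with ha
  have ha2 : ∀ y ∈ A, 2 ≤ a y := fun y hy => by
    have := F.diag y (hA hy)
    simp only [ha]
    exact_mod_cast this
  have hdeg : ∀ y ∈ A, ((nb s v y).card : ℚ) ≤ 2 := fun y hy => by
    exact_mod_cast F.card_nb_le (hA hy)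
  -- Row `y` of the Gram matrix as Laplacian plus the excess of norm over degree, with the edges at
  -- `y` sorted by whether they stay in `A`, go to `Z`, or go elsewhere.
  have h1 : ∀ y ∈ A, (h y : ℚ) = (a y - (nb s v y).card) * φ y +
      (∑ x ∈ nb s v y ∩ A, (φ y - φ x) + ∑ x ∈ nb s v y ∩ Z, (φ y - φ x)
        + ∑ x ∈ nb s v y \ (A ∪ Z), (φ y - φ x)) := by
    intro y hy
    have e1 := F.pot_eq hφ (hA hy)
    have e2 : ∑ x ∈ nb s v y ∩ A, (φ y - φ x) + ∑ x ∈ nb s v y ∩ Z, (φ y - φ x)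
        + ∑ x ∈ nb s v y \ (A ∪ Z), (φ y - φ x) = ∑ x ∈ nb s v y, (φ y - φ x) := by
      rw [← sum_union (hd.mono inter_subset_right inter_subset_right), ← inter_union_distrib_left,
        sum_inter_add_sum_sdiff]
    rw [e2, sum_sub_distrib, sum_const, nsmul_eq_mul]
    simp only [ha]
    linarith
  -- Edges inside `A` are counted once in each direction and cancel.
  have h2 : ∑ y ∈ A, ∑ x ∈ nb s v y ∩ A, (φ y - φ x) = 0 := by
    have e1 : ∀ g : ι → ι → ℚ, ∑ y ∈ A, ∑ x ∈ nb s v y ∩ A, g y x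
        = ∑ y ∈ A, ∑ x ∈ A, if v y ⬝ᵥ v x = -1 then g y x else 0 := by
      intro g
      refine sum_congr rfl fun y hy => ?_
      rw [← sum_filter]
      refine sum_congr ?_ fun _ _ => rfl
      ext x
      simp only [mem_inter, mem_nb, mem_filter]
      exact ⟨fun h => ⟨h.2, h.1.2⟩, fun h => ⟨⟨hA h.1, h.2⟩, h.1⟩⟩
    have e2 : ∑ y ∈ A, ∑ x ∈ nb s v y ∩ A, φ y = ∑ y ∈ A, ∑ x ∈ nb s v y ∩ A, φ x := by
      rw [e1 (fun y _ => φ y), e1 (fun _ x => φ x), sum_comm]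
      refine sum_congr rfl fun y _ => sum_congr rfl fun x _ => ?_
      rw [dotProduct_comm]
    simp only [sum_sub_distrib]
    rw [e2, sub_self]
  rw [sum_congr rfl h1]
  simp only [sum_add_distrib]
  rw [h2]
  have hn1 : ∀ y ∈ A, 0 ≤ (a y - (nb s v y).card) * φ y := fun y hy =>
    mul_nonneg (by linarith [ha2 y hy, hdeg y hy]) (hpos y hy).le
  have hn2 : ∀ y ∈ A, ∀ x ∈ nb s v y \ (A ∪ Z), 0 < φ y - φ x := fun y hy x hx => by
    simp only [mem_sdiff, mem_union, not_or] at hx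
    linarith [hout y hy x hx.1 hx.2.1 hx.2.2]
  have hn3 : ∀ y ∈ A, 0 ≤ ∑ x ∈ nb s v y \ (A ∪ Z), (φ y - φ x) := fun y hy =>
    sum_nonneg fun x hx => (hn2 y hy x hx).le
  -- Strictness comes from one vertex with at most one neighbour in `A ∪ Z`: either it has an edge
  -- leaving `A ∪ Z`, along which the potential drops, or its degree is at most `1` and its norm at
  -- least `2`.
  obtain ⟨y, hy, hy1⟩ := F.exists_card_nb_inter_le_one hA hne hZ
  have hstrict : 0 < (a y - (nb s v y).card) * φ y + ∑ x ∈ nb s v y \ (A ∪ Z), (φ y - φ x) := by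
    by_cases hE : (nb s v y \ (A ∪ Z)).Nonempty
    · exact add_pos_of_nonneg_of_pos (hn1 y hy) (sum_pos (hn2 y hy) hE)
    · rw [not_nonempty_iff_eq_empty, sdiff_eq_empty_iff_subset] at hE
      rw [inter_eq_left.2 hE] at hy1
      have : ((nb s v y).card : ℚ) ≤ 1 := by exact_mod_cast hy1
      refine add_pos_of_pos_of_nonneg (mul_pos ?_ (hpos y hy)) (hn3 y hy)
      linarith [ha2 y hy]
  have hfin : 0 < ∑ y ∈ A, ((a y - (nb s v y).card) * φ y
      + ∑ x ∈ nb s v y \ (A ∪ Z), (φ y - φ x)) :=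
    sum_pos' (fun y hy => add_nonneg (hn1 y hy) (hn3 y hy)) ⟨y, hy, hstrict⟩
  rw [sum_add_distrib] at hfin
  linarith

/-- The flux out of a set on which a potential is positive and larger than on the neighbouring
vertices is positive. -/
theorem Fam.flux_pos (F : Fam s v pos) (hφ : IsPot s v h φ) (hA : A ⊆ s) (hne : A.Nonempty)
    (hpos : ∀ y ∈ A, 0 < φ y) (hout : ∀ y ∈ A, ∀ x ∈ nb s v y, x ∉ A → φ x < φ y) :
    1 ≤ ∑ y ∈ A, h y := by
  have := F.flux (Z := ∅) hφ hA hne (by simp) (by simp) hpos (fun y hy x hx h _ => hout y hy x hx h)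
  simp only [inter_empty, sum_empty, sum_const_zero] at this
  -- Integrality of the source turns positive flux into flux at least `1`; all lower bounds for
  -- energies rest on this.
  have h1 : (0 : ℚ) < ((∑ y ∈ A, h y : ℤ) : ℚ) := by push_cast; exact this
  have h2 : 0 < ∑ y ∈ A, h y := by exact_mod_cast h1
  omega

/-- The flux out of a set to a vertex outside. -/
theorem Fam.flux_to (F : Fam s v pos) (hφ : IsPot s v h φ) (hA : A ⊆ s) (hne : A.Nonempty)
    (hz : z ∉ A) (hpos : ∀ y ∈ A, 0 < φ y)
    (hout : ∀ y ∈ A, ∀ x ∈ nb s v y, x ∉ A → x ≠ z → φ x < φ y) :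
    ∑ y ∈ A.filter (fun y => z ∈ nb s v y), (φ y - φ z) < ∑ y ∈ A, (h y : ℚ) := by
  have := F.flux (Z := {z}) hφ hA hne (by simp) (by simpa using hz) hpos
    (fun y hy x hx h h' => hout y hy x hx h (by simpa using h'))
  convert this using 1
  rw [sum_filter]
  refine sum_congr rfl fun y _ => ?_
  by_cases hzy : z ∈ nb s v y
  · rw [inter_singleton_of_mem hzy]; simp [hzy]
  · rw [inter_singleton_of_notMem hzy]; simp [hzy]

theorem IsPot.neg (hφ : IsPot s v h φ) : IsPot s v (-h) (-φ) := by
  intro y hy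
  have := hφ y hy
  simp only [Pi.neg_apply, neg_mul, sum_neg_distrib, Int.cast_neg, this]

end

/-! ### Energy of a potential and its oscillation. -/

/-- A layer-cake principle: a weighted sum of nonnegative numbers is nonnegative as soon as the
weights have nonnegative sums over all superlevel sets; if it vanishes, then so does the sum of the
weights over the support. -/
theorem layer_sum (D : Finset ι) (c : ι → ℚ) : ∀ (x : ι → ℚ), (∀ y ∈ D, 0 ≤ x y) →
    (∀ r : ℚ, 0 ≤ r → 0 ≤ ∑ y ∈ D.filter (fun y => r < x y), c y) →
    0 ≤ ∑ y ∈ D, c y * x y ∧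
      (∑ y ∈ D, c y * x y = 0 → ∑ y ∈ D.filter (fun y => 0 < x y), c y = 0) := by
  intro x hx hc
  induction hn : (D.filter (fun y => 0 < x y)).card using Nat.strong_induction_on generalizing x with
  | _ n ih =>
  by_cases hE : (D.filter (fun y => 0 < x y)).Nonempty
  · obtain ⟨m, hm, hmin⟩ := exists_min_image _ x hE
    have hm' := mem_filter.1 hm
    -- Lowering the support by its least positive value removes `m` from it, and the superlevel sets
    -- of `x'` are those of `x` at a shifted height.
    set x' : ι → ℚ := fun y => if 0 < x y then x y - x m else 0 with hx'
    have hlev : ∀ r : ℚ, 0 ≤ r →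
        D.filter (fun y => r < x' y) = D.filter (fun y => r + x m < x y) := by
      intro r hr
      refine filter_congr fun y hy => ?_
      simp only [hx']
      split_ifs with h
      · constructor <;> intro h <;> linarith
      · constructor <;> intro h' <;> linarith [hm'.2]
    have hnn : ∀ y ∈ D, 0 ≤ x' y := by
      intro y hy
      simp only [hx']
      split_ifs with h
      · linarith [hmin y (mem_filter.2 ⟨hy, h⟩)]
      · exact le_rfl
    have hlt : (D.filter (fun y => 0 < x' y)).card < n := by
      rw [← hn]
      refine card_lt_card ⟨?_, fun hsub => ?_⟩
      · intro y hy
        rw [hlev 0 le_rfl, mem_filter] at hy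
        exact mem_filter.2 ⟨hy.1, by linarith [hm'.2]⟩
      · have := hsub hm
        simp [hx', hm'.2] at this
    obtain ⟨h1, -⟩ := ih _ hlt x' hnn (fun r hr => by
      rw [hlev r hr]; exact hc _ (by linarith [hm'.2])) rfl
    have h2 : ∑ y ∈ D, c y * x y = ∑ y ∈ D, c y * x' y
        + x m * ∑ y ∈ D.filter (fun y => 0 < x y), c y := by
      rw [mul_sum, sum_filter, ← sum_add_distrib]
      refine sum_congr rfl fun y hy => ?_
      simp only [hx']
      split_ifs with h
      · ring
      · rw [le_antisymm (not_lt.1 h) (hx y hy)]; ring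
    have h3 := hc 0 le_rfl
    have h4 := mul_nonneg hm'.2.le h3
    refine ⟨by linarith, fun h0 => ?_⟩
    have h5 : x m * ∑ y ∈ D.filter (fun y => 0 < x y), c y = 0 := by linarith
    rcases mul_eq_zero.1 h5 with h | h
    · linarith [hm'.2]
    · exact h
  · rw [not_nonempty_iff_eq_empty] at hE
    have h0 : ∀ y ∈ D, x y = 0 := fun y hy => by
      by_contra hne
      have : y ∈ D.filter (fun y => 0 < x y) :=
        mem_filter.2 ⟨hy, lt_of_le_of_ne (hx y hy) (Ne.symm hne)⟩
      simp [hE] at this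
    rw [hE, sum_eq_zero fun y hy => by rw [h0 y hy, mul_zero]]
    simp

/-- Two vertices of `s` are joined by a path in the intersection graph of the family on `s`. -/
def Conn (s : Finset ι) (v : ι → κ → ℤ) (x y : ι) : Prop :=
  Relation.ReflTransGen (fun a b => b ∈ nb s v a) x y

/-- The connected component of `x` in the intersection graph of the family on `s`. -/
noncomputable def comp (s : Finset ι) (v : ι → κ → ℤ) (x : ι) : Finset ι :=
  s.filter fun y => Conn s v x y

section

variable {s A D T : Finset ι} {v : ι → κ → ℤ} {pos : ι → ℤ} {h g : ι → ℤ} {φ ψ : ι → ℚ}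
  {w x y z : ι}

theorem Conn.mem (hx : x ∈ s) (hc : Conn s v x y) : y ∈ s := by
  induction hc with
  | refl => exact hx
  | tail _ hb _ => exact nb_subset hb

theorem Conn.symm (hx : x ∈ s) (hc : Conn s v x y) : Conn s v y x := by
  induction hc with
  | refl => exact Relation.ReflTransGen.refl
  | tail hab hb ih => exact Relation.ReflTransGen.head (mem_nb_comm (Conn.mem hx hab) hb) ih

theorem Conn.trans (h1 : Conn s v x y) (h2 : Conn s v y z) : Conn s v x z :=
  Relation.ReflTransGen.trans h1 h2

theorem Conn.of_mem_nb (hy : y ∈ nb s v x) : Conn s v x y := Relation.ReflTransGen.single hy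

theorem Conn.refl : Conn s v x x := Relation.ReflTransGen.refl

theorem Conn.mem_of_closed (hD : ∀ x ∈ D, nb s v x ⊆ D) (hx : x ∈ D) (hc : Conn s v x y) :
    y ∈ D := by
  induction hc with
  | refl => exact hx
  | tail _ hb ih => exact hD _ ih hb

theorem mem_comp : y ∈ comp s v x ↔ y ∈ s ∧ Conn s v x y := by simp [comp]

theorem comp_subset : comp s v x ⊆ s := filter_subset _ _

theorem mem_comp_self (hx : x ∈ s) : x ∈ comp s v x := mem_comp.2 ⟨hx, Conn.refl⟩

theorem comp_closed : ∀ y ∈ comp s v x, nb s v y ⊆ comp s v x := fun _ hy _ hz =>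
  mem_comp.2 ⟨nb_subset hz, (mem_comp.1 hy).2.trans (Conn.of_mem_nb hz)⟩

theorem comp_conn (hx : x ∈ s) (hy : y ∈ comp s v x) (hz : z ∈ comp s v x) : Conn s v y z :=
  ((mem_comp.1 hy).2.symm hx).trans (mem_comp.1 hz).2

/-- A path from a point with a property to a point without it has an edge where it is lost. -/
theorem Conn.exists_step {P : ι → Prop} (hD : ∀ x ∈ D, nb s v x ⊆ D) (hc : Conn s v x y)
    (hxD : x ∈ D) (hx : P x) (hy : ¬ P y) : ∃ a ∈ D, ∃ b ∈ nb s v a, P a ∧ ¬ P b := by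
  induction hc with
  | refl => exact absurd hx hy
  | @tail b c hab hb ih =>
    by_cases hPb : P b
    · exact ⟨b, Conn.mem_of_closed hD hxD hab, c, hb, hPb, hy⟩
    · exact ih hPb

/-- The flux out of a superlevel set of a potential inside a closed set of vertices. -/
theorem Fam.flux_level (F : Fam s v pos) (hφ : IsPot s v h φ) (hDs : D ⊆ s)
    (hD : ∀ x ∈ D, nb s v x ⊆ D) {r : ℚ} (hr : 0 ≤ r)
    (hne : (D.filter fun y => r < φ y).Nonempty) : 1 ≤ ∑ y ∈ D.filter (fun y => r < φ y), h y := by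
  refine F.flux_pos hφ ((filter_subset _ _).trans hDs) hne ?_ ?_
  · intro y hy
    linarith [(mem_filter.1 hy).2]
  · intro y hy x hx hxA
    have h1 := mem_filter.1 hy
    have : ¬ r < φ x := fun h => hxA (mem_filter.2 ⟨hD y h1.1 hx, h⟩)
    linarith [h1.2]

/-- Maximum principle: a nonempty set `{φ > 0}` would have flux at least `1` without any source. For
`D = s` this is the nonsingularity of the Gram matrix. -/
theorem Fam.eq_zero_of_source_eq_zero (F : Fam s v pos) (hφ : IsPot s v h φ) (hDs : D ⊆ s)
    (hD : ∀ x ∈ D, nb s v x ⊆ D) (h0 : ∀ y ∈ D, h y = 0) : ∀ y ∈ D, φ y = 0 := by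
  have key : ∀ (h : ι → ℤ) (φ : ι → ℚ), IsPot s v h φ → (∀ y ∈ D, h y = 0) → ∀ y ∈ D, φ y ≤ 0 := by
    intro h φ hφ h0 y hy
    by_contra hcon
    have := F.flux_level hφ hDs hD le_rfl ⟨y, mem_filter.2 ⟨hy, not_le.1 hcon⟩⟩
    rw [sum_eq_zero fun y hy => h0 y (mem_filter.1 hy).1] at this
    omega
  intro y hy
  have h1 := key h φ hφ h0 y hy
  have h2 := key _ _ hφ.neg (fun y hy => by simp [h0 y hy]) y hy
  simp only [Pi.neg_apply] at h2
  linarith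

theorem Fam.source_eq_zero_of_eq_zero (F : Fam s v pos) (hφ : IsPot s v h φ) (hDs : D ⊆ s)
    (hD : ∀ x ∈ D, nb s v x ⊆ D) (h0 : ∀ y ∈ D, φ y = 0) : ∀ y ∈ D, h y = 0 := by
  intro y hy
  have := F.pot_eq hφ (hDs hy)
  rw [h0 y hy, sum_eq_zero fun z hz => h0 z (hD y hy hz)] at this
  simpa using this.symm

/-- The energy of the positive part of a potential is at least each of its values, with a
description of the case of equality. -/
theorem Fam.energy_pos_part (F : Fam s v pos) (hφ : IsPot s v h φ) (hDs : D ⊆ s)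
    (hD : ∀ x ∈ D, nb s v x ⊆ D) (hw : w ∈ D) :
    max (φ w) 0 ≤ ∑ y ∈ D, (h y : ℚ) * max (φ y) 0 ∧
      (∑ y ∈ D, (h y : ℚ) * max (φ y) 0 = max (φ w) 0 →
        ∑ y ∈ D.filter (fun y => 0 < φ y), h y = if 0 < φ w then 1 else 0) := by
  have hsum : ∀ r : ℚ, ∑ y ∈ D.filter (fun y => r < φ y), ((h y : ℚ) - if y = w then 1 else 0)
      = ((∑ y ∈ D.filter (fun y => r < φ y), h y : ℤ) : ℚ) - if r < φ w then 1 else 0 := by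
    intro r
    rw [sum_sub_distrib, sum_ite_eq']
    simp [hw]
  have hflt : ∀ r : ℚ, 0 ≤ r →
      D.filter (fun y => r < max (φ y) 0) = D.filter (fun y => r < φ y) := by
    intro r hr
    refine filter_congr fun y _ => ?_
    rw [lt_max_iff]
    exact ⟨fun h => h.resolve_right (not_lt.2 hr), Or.inl⟩
  have hmul : ∑ y ∈ D, ((h y : ℚ) - if y = w then 1 else 0) * max (φ y) 0
      = ∑ y ∈ D, (h y : ℚ) * max (φ y) 0 - max (φ w) 0 := by
    simp only [sub_mul, sum_sub_distrib, ite_mul, one_mul, zero_mul, sum_ite_eq', if_pos hw]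
  -- The weights are the source minus a unit mass at `w`: a nonempty superlevel set has flux at
  -- least `1`, and the mass takes away at most `1`.
  obtain ⟨h1, h2⟩ := layer_sum D (fun y => (h y : ℚ) - if y = w then 1 else 0)
    (fun y => max (φ y) 0) (fun y _ => le_max_right _ _) (by
      intro r hr
      rw [hflt r hr, hsum r]
      by_cases hne : (D.filter fun y => r < φ y).Nonempty
      · have : (1 : ℚ) ≤ ((∑ y ∈ D.filter (fun y => r < φ y), h y : ℤ) : ℚ) := by
          exact_mod_cast F.flux_level hφ hDs hD hr hne
        split_ifs <;> linarith
      · rw [not_nonempty_iff_eq_empty] at hne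
        have : ¬ r < φ w := fun h => by
          have : w ∈ D.filter (fun y => r < φ y) := mem_filter.2 ⟨hw, h⟩
          simp [hne] at this
        simp [hne, this])
  rw [hmul] at h1 h2
  refine ⟨by linarith, fun heq => ?_⟩
  have h3 := h2 (by linarith)
  rw [hflt 0 le_rfl, hsum 0, sub_eq_zero] at h3
  split_ifs with hpos
  · rw [if_pos hpos] at h3; exact_mod_cast h3
  · rw [if_neg hpos] at h3; exact_mod_cast h3

theorem energy_split (D : Finset ι) (h : ι → ℤ) (φ : ι → ℚ) :
    ∑ y ∈ D, (h y : ℚ) * φ y = ∑ y ∈ D, (h y : ℚ) * max (φ y) 0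
      + ∑ y ∈ D, (((-h) y : ℤ) : ℚ) * max ((-φ) y) 0 := by
  rw [← sum_add_distrib]
  refine sum_congr rfl fun y _ => ?_
  simp only [Pi.neg_apply, Int.cast_neg]
  rcases le_total (φ y) 0 with h | h
  · rw [max_eq_right h, max_eq_left (by linarith)]; ring
  · rw [max_eq_left h, max_eq_right (by linarith)]; ring

/-- The energy of a potential is at least its oscillation around `0`. -/
theorem Fam.osc_le_energy (F : Fam s v pos) (hφ : IsPot s v h φ) (hDs : D ⊆ s)
    (hD : ∀ x ∈ D, nb s v x ⊆ D) (hw : w ∈ D) (hz : z ∈ D) :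
    max (φ w) 0 + max (-φ z) 0 ≤ ∑ y ∈ D, (h y : ℚ) * φ y := by
  rw [energy_split]
  exact add_le_add (F.energy_pos_part hφ hDs hD hw).1 (F.energy_pos_part hφ.neg hDs hD hz).1

theorem Fam.energy_nonneg (F : Fam s v pos) (hφ : IsPot s v h φ) (hDs : D ⊆ s)
    (hD : ∀ x ∈ D, nb s v x ⊆ D) : 0 ≤ ∑ y ∈ D, (h y : ℚ) * φ y := by
  rcases D.eq_empty_or_nonempty with rfl | ⟨w, hw⟩
  · simp
  · have := F.osc_le_energy hφ hDs hD hw hw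
    linarith [le_max_right (φ w) 0, le_max_right (-φ w) 0]

theorem Fam.eq_zero_of_energy_eq_zero (F : Fam s v pos) (hφ : IsPot s v h φ) (hDs : D ⊆ s)
    (hD : ∀ x ∈ D, nb s v x ⊆ D) (h0 : ∑ y ∈ D, (h y : ℚ) * φ y = 0) : ∀ y ∈ D, φ y = 0 := by
  intro y hy
  have := F.osc_le_energy hφ hDs hD hy hy
  have h1 := le_max_right (φ y) 0
  have h2 := le_max_right (-φ y) 0
  have h3 := le_max_left (φ y) 0
  have h4 := le_max_left (-φ y) 0
  linarith

/-- A nonnegative potential whose support has flux at most `1` vanishes nowhere or everywhere on a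
connected closed set. -/
theorem Fam.eq_zero_or_pos (F : Fam s v pos) (hφ : IsPot s v h φ) (hDs : D ⊆ s)
    (hD : ∀ x ∈ D, nb s v x ⊆ D) (hconn : ∀ x ∈ D, ∀ y ∈ D, Conn s v x y)
    (hnn : ∀ y ∈ D, 0 ≤ φ y) (hle : ∑ y ∈ D.filter (fun y => 0 < φ y), h y ≤ 1) :
    (∀ y ∈ D, φ y = 0) ∨ ∀ y ∈ D, 0 < φ y := by
  by_contra! hcon
  obtain ⟨⟨w, hw, hw0⟩, z, hz, hz0⟩ := hcon
  have hwpos : 0 < φ w := lt_of_le_of_ne (hnn w hw) (Ne.symm hw0)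
  obtain ⟨a, ha, b, hb, hPa, hPb⟩ :=
    Conn.exists_step (P := fun y => 0 < φ y) hD (hconn w hw z hz) hw hwpos (not_lt.2 hz0)
  have hbD := hD a ha hb
  have hb0 : φ b = 0 := le_antisymm (not_lt.1 hPb) (hnn b hbD)
  have hflux := F.flux_to (z := b) hφ (A := D.filter fun y => 0 < φ y)
    ((filter_subset _ _).trans hDs) ⟨w, mem_filter.2 ⟨hw, hwpos⟩⟩
    (fun h => hPb (mem_filter.1 h).2) (fun y hy => (mem_filter.1 hy).2)
    (by
      intro y hy x hx hxA _
      have h1 := mem_filter.1 hy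
      have : ¬ 0 < φ x := fun h => hxA (mem_filter.2 ⟨hD y h1.1 hx, h⟩)
      linarith [h1.2])
  have hlt : ∑ y ∈ D.filter (fun y => 0 < φ y), (h y : ℚ) ≤ 1 := by exact_mod_cast hle
  have e1 : ∑ y ∈ (D.filter fun y => 0 < φ y).filter (fun y => b ∈ nb s v y), (φ y - φ b)
      = ∑ y ∈ nb s v b, φ y := by
    have : (D.filter fun y => 0 < φ y).filter (fun y => b ∈ nb s v y)
        = (nb s v b).filter fun y => 0 < φ y := by
      ext y
      simp only [mem_filter]
      refine ⟨fun h => ⟨mem_nb_comm (hDs h.1.1) h.2, h.1.2⟩,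
        fun h => ⟨⟨hD b hbD h.1, h.2⟩, mem_nb_comm (hDs hbD) h.1⟩⟩
    rw [this, hb0]
    simp only [sub_zero]
    refine sum_filter_of_ne fun y hy hne => ?_
    exact lt_of_le_of_ne (hnn y (hD b hbD hy)) (Ne.symm hne)
  have e2 := F.pot_eq hφ (hDs hbD)
  have e3 : φ a ≤ ∑ y ∈ nb s v b, φ y :=
    single_le_sum (fun y hy => hnn y (hD b hbD hy)) (mem_nb_comm (hDs ha) hb)
  rw [hb0, mul_zero] at e2
  rw [e1] at hflux
  -- The flux into the zero `b` is the integer `-h b`. It is positive because `a` is a neighbour,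
  -- and less than `1` because the support has flux at most `1`, a bound that `flux_to` makes
  -- strict.
  have h1 : (-1 : ℚ) < h b := by linarith
  have h2 : (h b : ℚ) < 0 := by linarith
  have h1' : -1 < h b := by exact_mod_cast h1
  have h2' : h b < 0 := by exact_mod_cast h2
  omega

/-- On a connected closed set where the energy equals the value at a vertex, the potential is zero
or positive, and in the latter case the total source is `1`. -/
theorem Fam.of_energy_eq (F : Fam s v pos) (hφ : IsPot s v h φ) (hDs : D ⊆ s)
    (hD : ∀ x ∈ D, nb s v x ⊆ D) (hconn : ∀ x ∈ D, ∀ y ∈ D, Conn s v x y) (hw : w ∈ D)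
    (hE : ∑ y ∈ D, (h y : ℚ) * φ y = φ w) :
    (∀ y ∈ D, φ y = 0) ∨ ∑ y ∈ D, h y = 1 := by
  have hnn : ∀ z ∈ D, 0 ≤ φ z := by
    intro z hz
    have := F.osc_le_energy hφ hDs hD hw hz
    linarith [le_max_left (φ w) 0, le_max_left (-φ z) 0]
  have hE' : ∑ y ∈ D, (h y : ℚ) * max (φ y) 0 = max (φ w) 0 := by
    rw [max_eq_left (hnn w hw), ← hE]
    exact sum_congr rfl fun y hy => by rw [max_eq_left (hnn y hy)]
  have h1 := (F.energy_pos_part hφ hDs hD hw).2 hE'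
  rcases F.eq_zero_or_pos hφ hDs hD hconn hnn (by rw [h1]; split_ifs <;> simp) with h2 | h2
  · exact Or.inl h2
  · right
    rw [filter_true_of_mem h2, if_pos (h2 w hw)] at h1
    exact h1

/-- A potential with nonnegative nonzero source on a connected closed set is positive there. -/
theorem Fam.pos_of_source_nonneg (F : Fam s v pos) (hφ : IsPot s v h φ) (hDs : D ⊆ s)
    (hD : ∀ x ∈ D, nb s v x ⊆ D) (hconn : ∀ x ∈ D, ∀ y ∈ D, Conn s v x y)
    (hh : ∀ y ∈ D, 0 ≤ h y) (hx : x ∈ D) (hx0 : h x ≠ 0) : ∀ y ∈ D, 0 < φ y := by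
  have hnn : ∀ y ∈ D, 0 ≤ φ y := by
    intro y hy
    by_contra hcon
    have := F.flux_level hφ.neg hDs hD le_rfl
      ⟨y, mem_filter.2 ⟨hy, by simpa using not_le.1 hcon⟩⟩
    have h2 : ∑ y ∈ D.filter (fun y => 0 < (-φ) y), (-h) y ≤ 0 :=
      sum_nonpos fun y hy => by simpa using hh y (mem_filter.1 hy).1
    omega
  intro y hy
  by_contra hcon
  have hxpos : 0 < φ x := by
    have h1 := F.pot_eq hφ (hDs hx)
    have h2 : 0 ≤ ∑ z ∈ nb s v x, φ z := sum_nonneg fun z hz => hnn z (hD x hx hz)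
    have h3 : (0 : ℚ) < h x := by exact_mod_cast lt_of_le_of_ne (hh x hx) (Ne.symm hx0)
    by_contra h4
    rw [le_antisymm (not_lt.1 h4) (hnn x hx)] at h1
    linarith
  obtain ⟨a, ha, b, hb, hPa, hPb⟩ :=
    Conn.exists_step (P := fun y => 0 < φ y) hD (hconn x hx y hy) hx hxpos hcon
  have hbD := hD a ha hb
  have hb0 : φ b = 0 := le_antisymm (not_lt.1 hPb) (hnn b hbD)
  have e2 := F.pot_eq hφ (hDs hbD)
  have e3 : φ a ≤ ∑ y ∈ nb s v b, φ y :=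
    single_le_sum (fun y hy => hnn y (hD b hbD hy)) (mem_nb_comm (hDs ha) hb)
  have e4 : (0 : ℚ) ≤ h b := by exact_mod_cast hh b hbD
  rw [hb0, mul_zero] at e2
  linarith

/-- The potential of a unit source has its strict maximum at the source. -/
theorem Fam.lt_source (F : Fam s v pos) (hφ : IsPot s v h φ) (hDs : D ⊆ s)
    (hD : ∀ x ∈ D, nb s v x ⊆ D) (hxpos : 0 < φ x)
    (hh : ∀ y ∈ D, y ≠ x → h y ≤ 0) : ∀ y ∈ D, y ≠ x → φ y < φ x := by
  intro y hy hyx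
  by_contra hcon
  -- The other vertices with value at least `φ x` would send a nonnegative flux to `x`, while their
  -- total source is nonpositive.
  have h1 := F.flux_to (z := x) hφ (A := D.filter fun y => y ≠ x ∧ φ x ≤ φ y)
    ((filter_subset _ _).trans hDs) ⟨y, mem_filter.2 ⟨hy, hyx, not_lt.1 hcon⟩⟩
    (by simp) (fun y hy => by linarith [(mem_filter.1 hy).2.2])
    (by
      intro y hy z hz hzA hzx
      have h1 := mem_filter.1 hy
      have : ¬ φ x ≤ φ z := fun h => hzA (mem_filter.2 ⟨hD y h1.1 hz, hzx, h⟩)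
      linarith [h1.2.2])
  have h2 : 0 ≤ ∑ y ∈ (D.filter fun y => y ≠ x ∧ φ x ≤ φ y).filter (fun y => x ∈ nb s v y),
      (φ y - φ x) := sum_nonneg fun y hy => by
    linarith [(mem_filter.1 (mem_filter.1 hy).1).2.2]
  have h3 : ∑ y ∈ D.filter (fun y => y ≠ x ∧ φ x ≤ φ y), (h y : ℚ) ≤ 0 :=
    sum_nonpos fun y hy => by
      have := mem_filter.1 hy
      exact_mod_cast hh y this.1 this.2.1
  linarith

/-- Potentials exist for all sources. -/
theorem Fam.exists_pot (F : Fam s v pos) (h : ι → ℤ) : ∃ φ, IsPot s v h φ := by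
  let M : Matrix s s ℚ := fun y z => ((v y ⬝ᵥ v z : ℤ) : ℚ)
  have hM : ∀ (f : s → ℚ) (y : s), (M.mulVecLin f) y
      = ∑ z ∈ s, (fun z => if hz : z ∈ s then f ⟨z, hz⟩ else 0) z * ((v y ⬝ᵥ v z : ℤ) : ℚ) := by
    intro f y
    rw [← sum_coe_sort s, Matrix.mulVecLin_apply, Matrix.mulVec, dotProduct]
    refine sum_congr rfl fun z _ => ?_
    simp only [M, coe_mem, dif_pos]
    exact mul_comm _ _
  have hinj : Function.Injective M.mulVecLin := by
    rw [← LinearMap.ker_eq_bot, LinearMap.ker_eq_bot']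
    intro f hf
    have hp : IsPot s v (fun _ => 0) (fun z => if hz : z ∈ s then f ⟨z, hz⟩ else 0) := by
      intro y hy
      rw [← hM f ⟨y, hy⟩, hf]; simp
    have := F.eq_zero_of_source_eq_zero hp subset_rfl (fun x _ => nb_subset) (fun _ _ => rfl)
    ext ⟨y, hy⟩
    have := this y hy
    simpa [hy] using this
  obtain ⟨f, hf⟩ := (LinearMap.injective_iff_surjective.1 hinj) (fun y => (h y : ℚ))
  refine ⟨fun z => if hz : z ∈ s then f ⟨z, hz⟩ else 0, fun y hy => ?_⟩
  rw [← hM f ⟨y, hy⟩, hf]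

/-- Reciprocity of potentials. -/
theorem IsPot.reciprocity (hφ : IsPot s v h φ) (hψ : IsPot s v g ψ) :
    ∑ y ∈ s, (h y : ℚ) * ψ y = ∑ y ∈ s, (g y : ℚ) * φ y := by
  have h1 : ∑ y ∈ s, (h y : ℚ) * ψ y
      = ∑ y ∈ s, ∑ z ∈ s, φ z * ((v y ⬝ᵥ v z : ℤ) : ℚ) * ψ y :=
    sum_congr rfl fun y hy => by rw [← hφ y hy, sum_mul]
  have h2 : ∑ y ∈ s, (g y : ℚ) * φ y
      = ∑ y ∈ s, ∑ z ∈ s, ψ z * ((v y ⬝ᵥ v z : ℤ) : ℚ) * φ y :=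
    sum_congr rfl fun y hy => by rw [← hψ y hy, sum_mul]
  rw [h1, h2, sum_comm]
  refine sum_congr rfl fun y _ => sum_congr rfl fun z _ => ?_
  rw [dotProduct_comm]; ring

end

/-! ### Basis vectors in the span, and vectors linked once to each component. -/

/-- The basis vector `e_q` is the rational combination of the family with coefficients `φ`. -/
def InSpan (s : Finset ι) (v : ι → κ → ℤ) (q : κ) (φ : ι → ℚ) : Prop :=
  ∀ p, ∑ y ∈ s, φ y * (v y p : ℚ) = if p = q then 1 else 0

section

variable {s A D T : Finset ι} {v : ι → κ → ℤ} {pos : ι → ℤ} {h g : ι → ℤ} {φ ψ : ι → ℚ}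
  {w x y z : ι} {q : κ}

theorem sum_comb_mul (φ : ι → ℚ) (x : κ → ℚ) :
    ∑ p, x p * ∑ z ∈ s, φ z * (v z p : ℚ) = ∑ z ∈ s, φ z * ∑ p, x p * (v z p : ℚ) := by
  simp only [mul_sum]
  rw [sum_comm]
  exact sum_congr rfl fun z _ => sum_congr rfl fun p _ => by ring

theorem cast_dot (x y : κ → ℤ) : ((x ⬝ᵥ y : ℤ) : ℚ) = ∑ p, (x p : ℚ) * (y p : ℚ) := by
  simp [dotProduct]

/-- The coefficients of a vector in the span are the potential of its products. -/
theorem isPot_of_comb {t : κ → ℤ} (ht : ∀ p, ∑ y ∈ s, φ y * (v y p : ℚ) = t p) :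
    IsPot s v (fun y => t ⬝ᵥ v y) φ := by
  intro y _
  simp only [cast_dot]
  rw [← sum_comb_mul]
  exact sum_congr rfl fun p _ => by rw [ht p]; ring

theorem InSpan.isPot (hq : InSpan s v q φ) : IsPot s v (fun y => v y q) φ := by
  have := isPot_of_comb (t := Pi.single q 1) (s := s) (v := v) (φ := φ) (fun p => by
    rw [hq p, Pi.single_apply]; split_ifs <;> simp)
  simpa using this

theorem InSpan.energy (hq : InSpan s v q φ) : ∑ y ∈ s, (v y q : ℚ) * φ y = 1 := by
  have := hq q
  rw [if_pos rfl] at this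
  rw [← this]
  exact sum_congr rfl fun y _ => mul_comm _ _

theorem InSpan.orth (hq : InSpan s v q φ) {p : κ} (hp : p ≠ q) :
    ∑ y ∈ s, (v y p : ℚ) * φ y = 0 := by
  have := hq p
  rw [if_neg hp] at this
  rw [← this]
  exact sum_congr rfl fun y _ => mul_comm _ _

/-- The combination with coefficients `φ` is the orthogonal projection of `e_q` to the span and its
squared length is the energy, so this is Pythagoras. Hence the energy is at most `1`, with equality
only if `e_q` is in the span. -/
theorem IsPot.column_energy (hφ : IsPot s v (fun y => v y q) φ) :
    ∑ p, ((if p = q then 1 else 0) - ∑ y ∈ s, φ y * (v y p : ℚ)) ^ 2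
      = 1 - ∑ y ∈ s, (v y q : ℚ) * φ y := by
  have h1 : ∑ p, (∑ y ∈ s, φ y * (v y p : ℚ)) * ∑ z ∈ s, φ z * (v z p : ℚ)
      = ∑ y ∈ s, (v y q : ℚ) * φ y := by
    rw [sum_comb_mul φ fun p => ∑ y ∈ s, φ y * (v y p : ℚ)]
    refine sum_congr rfl fun z hz => ?_
    have := hφ z hz
    simp only [cast_dot] at this
    rw [← sum_comb_mul] at this
    rw [← this, mul_comm]
    congr 1
    exact sum_congr rfl fun p _ => mul_comm _ _
  have h2 : ∑ p, (if p = q then (1 : ℚ) else 0) * ∑ y ∈ s, φ y * (v y p : ℚ)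
      = ∑ y ∈ s, (v y q : ℚ) * φ y := by
    simp only [ite_mul, one_mul, zero_mul, sum_ite_eq', mem_univ, if_true]
    exact sum_congr rfl fun y _ => mul_comm _ _
  have h3 : ∀ p, ((if p = q then (1 : ℚ) else 0) - ∑ y ∈ s, φ y * (v y p : ℚ)) ^ 2
      = (if p = q then 1 else 0) - 2 * ((if p = q then (1 : ℚ) else 0)
        * ∑ y ∈ s, φ y * (v y p : ℚ)) + (∑ y ∈ s, φ y * (v y p : ℚ))
          * ∑ z ∈ s, φ z * (v z p : ℚ) := by
    intro p
    split_ifs <;> ring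
  simp only [h3, sum_add_distrib, sum_sub_distrib, ← mul_sum, h1, h2, sum_ite_eq', mem_univ,
    if_true]
  ring

theorem IsPot.column_energy_le (hφ : IsPot s v (fun y => v y q) φ) :
    ∑ y ∈ s, (v y q : ℚ) * φ y ≤ 1 := by
  have := hφ.column_energy
  have h1 := sum_nonneg (s := univ) fun p (_ : p ∈ univ) =>
    sq_nonneg ((if p = q then (1 : ℚ) else 0) - ∑ y ∈ s, φ y * (v y p : ℚ))
  linarith

theorem IsPot.inSpan (hφ : IsPot s v (fun y => v y q) φ)
    (h1 : ∑ y ∈ s, (v y q : ℚ) * φ y = 1) : InSpan s v q φ := by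
  have := hφ.column_energy
  rw [h1, sub_self, sum_eq_zero_iff_of_nonneg fun p _ => sq_nonneg _] at this
  intro p
  have h2 := pow_eq_zero_iff (two_ne_zero) |>.1 (this p (mem_univ p))
  linarith

/-- A vector in the span that is linked with sign `σ` to one vertex in some components and
orthogonal to everything else has coordinates of size at most one, and where its coordinate
`t q` is positive, `e_q` is in the span and its column is `0` or of sum `σ` on each component. -/
theorem Fam.link_coord (F : Fam s v pos) (hT : T ⊆ s)
    (hsep : ∀ w ∈ T, ∀ w' ∈ T, Conn s v w w' → w = w') {t : κ → ℤ}
    (hψ : ∀ p, ∑ y ∈ s, ψ y * (v y p : ℚ) = t p) {σ : ι → ℤ} (hσ : ∀ w ∈ T, σ w = 1 ∨ σ w = -1)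
    (h1 : ∀ w ∈ T, t ⬝ᵥ v w = σ w) (h0 : ∀ y ∈ s, y ∉ T → t ⬝ᵥ v y = 0) (hq : 0 < t q) :
    t q = 1 ∧ (∃ φ, InSpan s v q φ) ∧ (∀ y ∈ s, (∀ w ∈ T, ¬ Conn s v w y) → v y q = 0) ∧
      ∀ w ∈ T, (∀ y ∈ comp s v w, v y q = 0) ∨ ∑ y ∈ comp s v w, v y q = σ w := by
  obtain ⟨φ, hφ⟩ := F.exists_pot fun y => v y q
  have hE := hφ.column_energy_le
  -- Reciprocity between the potential of `t`, with source `σ` on `T`, and the potential of column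
  -- `q`.
  have htq : (t q : ℚ) = ∑ w ∈ T, (σ w : ℚ) * φ w := by
    have e1 := (isPot_of_comb hψ).reciprocity hφ
    have e2 : ∑ y ∈ s, (v y q : ℚ) * ψ y = t q := by
      rw [← hψ q]; exact sum_congr rfl fun y _ => mul_comm _ _
    rw [e2] at e1
    rw [← e1]
    rw [← sum_subset hT fun y hy hyT => by rw [h0 y hy hyT]; simp]
    exact sum_congr rfl fun w hw => by rw [h1 w hw]
  set U := T.biUnion (comp s v) with hU
  have hUs : U ⊆ s := biUnion_subset.2 fun _ _ => comp_subset
  have hdisj : (T : Set ι).PairwiseDisjoint (comp s v) := by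
    intro w hw w' hw' hne
    refine disjoint_left.2 fun y hy hy' => hne (hsep w hw w' hw' ?_)
    exact (mem_comp.1 hy).2.trans ((mem_comp.1 hy').2.symm (hT hw'))
  have hcl : ∀ x ∈ s \ U, nb s v x ⊆ s \ U := by
    intro x hx y hy
    rw [mem_sdiff] at hx ⊢
    refine ⟨nb_subset hy, fun hyU => hx.2 ?_⟩
    obtain ⟨w, hw, hyw⟩ := mem_biUnion.1 hyU
    exact mem_biUnion.2 ⟨w, hw, comp_closed y hyw (mem_nb_comm hx.1 hy)⟩
  have hsplit : ∑ y ∈ s, (v y q : ℚ) * φ y = ∑ y ∈ s \ U, (v y q : ℚ) * φ y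
      + ∑ w ∈ T, ∑ y ∈ comp s v w, (v y q : ℚ) * φ y := by
    rw [← sum_biUnion hdisj, sum_sdiff hUs]
  have hrest := F.energy_nonneg hφ sdiff_subset hcl
  have hcomp : ∀ w ∈ T, (σ w : ℚ) * φ w ≤ ∑ y ∈ comp s v w, (v y q : ℚ) * φ y := by
    intro w hw
    have hw' := mem_comp_self (v := v) (hT hw)
    have := F.osc_le_energy hφ comp_subset comp_closed hw' hw'
    have e1 := le_max_left (φ w) 0
    have e2 := le_max_right (φ w) 0
    have e3 := le_max_left (-φ w) 0
    have e4 := le_max_right (-φ w) 0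
    rcases hσ w hw with h | h <;> rw [h] <;> push_cast <;> linarith
  have hle : ∑ w ∈ T, (σ w : ℚ) * φ w ≤ ∑ w ∈ T, ∑ y ∈ comp s v w, (v y q : ℚ) * φ y :=
    sum_le_sum hcomp
  -- Now `1 ≤ t q`, `t q` is at most the energy on the linked components, and the total energy is at
  -- most `1`: all these inequalities are equalities.
  have htq1 : (1 : ℚ) ≤ t q := by exact_mod_cast hq
  have heq : ∑ w ∈ T, (σ w : ℚ) * φ w = ∑ w ∈ T, ∑ y ∈ comp s v w, (v y q : ℚ) * φ y := by
    linarith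
  have heach := (sum_eq_sum_iff_of_le hcomp).1 heq
  refine ⟨?_, ⟨φ, hφ.inSpan (by linarith)⟩, ?_, ?_⟩
  · have : (t q : ℚ) = 1 := by linarith
    exact_mod_cast this
  · intro y hy hyT
    have hz := F.eq_zero_of_energy_eq_zero hφ sdiff_subset hcl (by linarith)
    refine F.source_eq_zero_of_eq_zero hφ sdiff_subset hcl hz y (mem_sdiff.2 ⟨hy, fun hyU => ?_⟩)
    obtain ⟨w, hw, hyw⟩ := mem_biUnion.1 hyU
    exact hyT w hw (mem_comp.1 hyw).2
  · intro w hw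
    have hws := hT hw
    have hw' := mem_comp_self (v := v) hws
    have hconn : ∀ x ∈ comp s v w, ∀ y ∈ comp s v w, Conn s v x y :=
      fun x hx y hy => comp_conn hws hx hy
    have e := heach w hw
    rcases hσ w hw with h | h <;> rw [h] at e ⊢
    · rcases F.of_energy_eq hφ comp_subset comp_closed hconn hw' (by rw [← e]; simp) with h2 | h2
      · exact Or.inl (F.source_eq_zero_of_eq_zero hφ comp_subset comp_closed h2)
      · exact Or.inr h2
    · rcases F.of_energy_eq hφ.neg comp_subset comp_closed hconn hw' (by
        simp only [Pi.neg_apply, Int.cast_neg, neg_mul_neg]; rw [← e]; simp) with h2 | h2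
      · left
        refine F.source_eq_zero_of_eq_zero hφ comp_subset comp_closed fun y hy => ?_
        simpa using h2 y hy
      · right
        simp only [Pi.neg_apply, sum_neg_distrib] at h2
        linarith

/-- The structure of a vector in the span that is linked with sign `σ` to one vertex in some
components and orthogonal to everything else: it is a sum of signed basis vectors of the span,
whose columns are supported on disjoint sets of the linked vertices. -/
theorem Fam.link_structure (F : Fam s v pos) (hT : T ⊆ s)
    (hsep : ∀ w ∈ T, ∀ w' ∈ T, Conn s v w w' → w = w') {t : κ → ℤ}
    (hψ : ∀ p, ∑ y ∈ s, ψ y * (v y p : ℚ) = t p) {σ : ι → ℤ} (hσ : ∀ w ∈ T, σ w = 1 ∨ σ w = -1)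
    (h1 : ∀ w ∈ T, t ⬝ᵥ v w = σ w) (h0 : ∀ y ∈ s, y ∉ T → t ⬝ᵥ v y = 0) :
    (∀ q, t q ≠ 0 → (t q = 1 ∨ t q = -1) ∧ (∃ φ, InSpan s v q φ) ∧
      ∀ y ∈ s, v y q ≠ 0 → y ∈ T ∧ v y q = σ y * t q) ∧
    ∀ w ∈ T, ∃ q, t q ≠ 0 ∧ v w q ≠ 0 ∧ ∀ q', t q' ≠ 0 → v w q' ≠ 0 → q' = q := by
  have hcoord : ∀ q, t q ≠ 0 → (t q = 1 ∨ t q = -1) ∧ (∃ φ, InSpan s v q φ) ∧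
      (∀ y ∈ s, (∀ w ∈ T, ¬ Conn s v w y) → v y q = 0) ∧
      ∀ w ∈ T, (∀ y ∈ comp s v w, v y q = 0) ∨ t q * ∑ y ∈ comp s v w, v y q = σ w := by
    intro q hq
    rcases lt_or_gt_of_ne hq with hneg | hpos
    · have := F.link_coord (q := q) (t := -t) (ψ := -ψ) (σ := -σ) hT hsep
        (fun p => by simp only [Pi.neg_apply, neg_mul, sum_neg_distrib, hψ p]; push_cast; rfl)
        (fun w hw => by
          rcases hσ w hw with h | h <;> simp [h])
        (fun w hw => by simp [h1 w hw]) (fun y hy hyT => by simp [h0 y hy hyT])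
        (by simpa using hneg)
      obtain ⟨e1, e2, e3, e4⟩ := this
      have e1' : t q = -1 := by simp only [Pi.neg_apply] at e1; omega
      refine ⟨Or.inr e1', e2, e3, fun w hw => (e4 w hw).imp_right fun h => ?_⟩
      rw [h, e1']; simp
    · obtain ⟨e1, e2, e3, e4⟩ := F.link_coord hT hsep hψ hσ h1 h0 hpos
      refine ⟨Or.inl e1, e2, e3, fun w hw => (e4 w hw).imp_right fun h => ?_⟩
      rw [h, e1]; simp
  have huniq : ∀ w ∈ T, ∃ q, t q ≠ 0 ∧ (∃ y ∈ comp s v w, v y q ≠ 0) ∧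
      ∀ q', t q' ≠ 0 → (∃ y ∈ comp s v w, v y q' ≠ 0) → q' = q := by
    intro w hw
    have hws := hT hw
    have e1 : ∑ q, t q * ∑ y ∈ comp s v w, v y q = σ w := by
      simp only [mul_sum]
      rw [sum_comm]
      rw [sum_eq_single_of_mem w (mem_comp_self hws)]
      · rw [← h1 w hw]; rfl
      · intro y hy hyw
        have := mem_comp.1 hy
        exact h0 y this.1 fun hyT => hyw (hsep w hw y hyT this.2).symm
    -- Each coordinate of `t` visible on the component contributes exactly `σ w` to a total that is
    -- itself `σ w`, so only one is visible.
    set Q := univ.filter fun q => t q ≠ 0 ∧ ∃ y ∈ comp s v w, v y q ≠ 0 with hQ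
    have e2 : ∑ q, t q * ∑ y ∈ comp s v w, v y q = ∑ q ∈ Q, σ w := by
      rw [hQ, sum_filter]
      refine sum_congr rfl fun q _ => ?_
      split_ifs with h
      · rcases (hcoord q h.1).2.2.2 w hw with h2 | h2
        · obtain ⟨y, hy, hy'⟩ := h.2
          exact absurd (h2 y hy) hy'
        · exact h2
      · by_cases htq : t q = 0
        · rw [htq, zero_mul]
        · rw [sum_eq_zero, mul_zero]
          intro y hy
          by_contra hne
          exact h ⟨htq, y, hy, hne⟩
    rw [e1, sum_const, nsmul_eq_mul] at e2
    have hcard : Q.card = 1 := by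
      rcases hσ w hw with h | h <;> rw [h] at e2 <;> omega
    obtain ⟨q, hq⟩ := card_eq_one.1 hcard
    have hq' : q ∈ Q := by rw [hq]; exact mem_singleton_self q
    refine ⟨q, (mem_filter.1 hq').2.1, (mem_filter.1 hq').2.2, fun q' h1 h2 => ?_⟩
    have : q' ∈ Q := mem_filter.2 ⟨mem_univ _, h1, h2⟩
    rw [hq] at this
    exact mem_singleton.1 this
  have hval : ∀ w ∈ T, ∀ q, t q ≠ 0 → (∃ y ∈ comp s v w, v y q ≠ 0) → ∀ y ∈ comp s v w,
      v y q = if y = w then σ w * t q else 0 := by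
    intro w hw q hq hqw y hy
    obtain ⟨q0, h00, h01, h02⟩ := huniq w hw
    have hqq := h02 q hq hqw
    have e1 : t ⬝ᵥ v y = t q * v y q := by
      rw [dotProduct, sum_eq_single_of_mem q (mem_univ q)]
      intro q' _ hne
      by_cases ht : t q' = 0
      · rw [ht, zero_mul]
      · by_contra hmul
        exact hne ((h02 q' ht ⟨y, hy, right_ne_zero_of_mul hmul⟩).trans hqq.symm)
    have hys := (mem_comp.1 hy)
    split_ifs with hyw
    · subst hyw
      rw [h1 y hw] at e1
      rcases (hcoord q hq).1 with h | h <;> rw [h] at e1 ⊢ <;> linarith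
    · rw [h0 y hys.1 fun hyT => hyw (hsep w hw y hyT hys.2).symm] at e1
      rcases mul_eq_zero.1 e1.symm with h | h
      · exact absurd h hq
      · exact h
  refine ⟨fun q hq => ⟨(hcoord q hq).1, (hcoord q hq).2.1, fun y hy hne => ?_⟩, fun w hw => ?_⟩
  · have : ∃ w ∈ T, Conn s v w y := by
      by_contra! hcon
      exact hne ((hcoord q hq).2.2.1 y hy hcon)
    obtain ⟨w, hw, hwy⟩ := this
    have hyc : y ∈ comp s v w := mem_comp.2 ⟨hy, hwy⟩
    have := hval w hw q hq ⟨y, hyc, hne⟩ y hyc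
    split_ifs at this with h
    · subst h; exact ⟨hw, this⟩
    · exact absurd this hne
  · obtain ⟨q, hq, hqw, hu⟩ := huniq w hw
    have hwc := mem_comp_self (v := v) (hT hw)
    refine ⟨q, hq, ?_, fun q' hq' hne => hu q' hq' ⟨w, hwc, hne⟩⟩
    have := hval w hw q hq hqw w hwc
    rw [if_pos rfl] at this
    rw [this]
    refine mul_ne_zero ?_ hq
    rcases hσ w hw with h | h <;> rw [h] <;> decide

end

/-! ### Vectors of norm two or three, point sources, and deletion of a coordinate. -/

/-- A sum of squares between `1` and `3` has no room for a coordinate of absolute value `2`. Used to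
peel off the coordinates of short vectors. -/
theorem exists_unit_coord {S : Finset κ} {x : κ → ℤ} {n : ℤ} (hn : 0 < n) (hn3 : n ≤ 3)
    (h : ∑ q ∈ S, x q ^ 2 = n) :
    ∃ m ∈ S, x m ^ 2 = 1 ∧ ∑ q ∈ S.erase m, x q ^ 2 = n - 1 := by
  have : ∃ m ∈ S, x m ≠ 0 := by
    by_contra! hcon
    rw [sum_eq_zero fun q hq => by rw [hcon q hq]; rfl] at h
    omega
  obtain ⟨m, hm, hne⟩ := this
  have h1 := add_sum_erase S (fun q => x q ^ 2) hm
  have h2 : 0 ≤ ∑ q ∈ S.erase m, x q ^ 2 := sum_nonneg fun q _ => sq_nonneg _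
  have h3 : x m ^ 2 ≤ 3 := by linarith
  have h4 : x m < 2 := by nlinarith
  have h5 : -2 < x m := by nlinarith
  have h6 : x m ^ 2 = 1 := by
    have : x m = 1 ∨ x m = -1 := by omega
    rcases this with h | h <;> rw [h] <;> norm_num
  exact ⟨m, hm, h6, by linarith⟩

theorem eq_zero_of_sum_sq {S : Finset κ} {x : κ → ℤ} (h : ∑ q ∈ S, x q ^ 2 = 0) :
    ∀ q ∈ S, x q = 0 := fun q hq =>
  pow_eq_zero_iff two_ne_zero |>.1 ((sum_eq_zero_iff_of_nonneg fun _ _ => sq_nonneg _).1 h q hq)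

theorem dot_self_eq (x : κ → ℤ) : x ⬝ᵥ x = ∑ q, x q ^ 2 :=
  sum_congr rfl fun q _ => (sq (x q)).symm

theorem exists_coord_of_norm_two {x : κ → ℤ} {k : κ} (h : x ⬝ᵥ x = 2) (hk : x k ^ 2 = 1) :
    ∃ m, m ≠ k ∧ x m ^ 2 = 1 ∧ ∀ q, q ≠ k → q ≠ m → x q = 0 := by
  rw [dot_self_eq, ← add_sum_erase univ (fun q => x q ^ 2) (mem_univ k), hk] at h
  obtain ⟨m, hm, h1, h2⟩ := exists_unit_coord (S := univ.erase k) (x := x) (n := 1) (by norm_num)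
    (by norm_num) (by linarith)
  refine ⟨m, ne_of_mem_erase hm, h1, fun q hqk hqm => ?_⟩
  exact eq_zero_of_sum_sq h2 q (mem_erase.2 ⟨hqm, mem_erase.2 ⟨hqk, mem_univ q⟩⟩)

theorem exists_coord_of_norm_three {x : κ → ℤ} {k : κ} (h : x ⬝ᵥ x = 3) (hk : x k ^ 2 = 1) :
    ∃ m n, m ≠ k ∧ n ≠ k ∧ m ≠ n ∧ x m ^ 2 = 1 ∧ x n ^ 2 = 1 ∧
      ∀ q, q ≠ k → q ≠ m → q ≠ n → x q = 0 := by
  rw [dot_self_eq, ← add_sum_erase univ (fun q => x q ^ 2) (mem_univ k), hk] at h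
  obtain ⟨m, hm, h1, h2⟩ := exists_unit_coord (S := univ.erase k) (x := x) (n := 2) (by norm_num)
    (by norm_num) (by linarith)
  obtain ⟨n, hn, h3, h4⟩ := exists_unit_coord (n := 1) (by norm_num) (by norm_num)
    (show ∑ q ∈ (univ.erase k).erase m, x q ^ 2 = 1 by linarith)
  refine ⟨m, n, ne_of_mem_erase hm, ne_of_mem_erase (mem_of_mem_erase hn),
    (ne_of_mem_erase hn).symm, h1, h3, fun q hqk hqm hqn => ?_⟩
  exact eq_zero_of_sum_sq h4 q
    (mem_erase.2 ⟨hqn, mem_erase.2 ⟨hqm, mem_erase.2 ⟨hqk, mem_univ q⟩⟩⟩)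

theorem dot_of_support_pair {x y : κ → ℤ} {k m : κ} (hkm : m ≠ k)
    (h : ∀ q, q ≠ k → q ≠ m → x q = 0) : x ⬝ᵥ y = x k * y k + x m * y m := by
  rw [dotProduct, ← add_sum_erase univ _ (mem_univ k),
    ← add_sum_erase _ _ (mem_erase.2 ⟨hkm, mem_univ m⟩), sum_eq_zero, add_zero]
  intro q hq
  rw [h q (ne_of_mem_erase (mem_of_mem_erase hq)) (ne_of_mem_erase hq), zero_mul]

theorem dot_of_support_triple {x y : κ → ℤ} {k m n : κ} (hkm : m ≠ k) (hkn : n ≠ k) (hmn : m ≠ n)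
    (h : ∀ q, q ≠ k → q ≠ m → q ≠ n → x q = 0) :
    x ⬝ᵥ y = x k * y k + x m * y m + x n * y n := by
  rw [dotProduct, ← add_sum_erase univ _ (mem_univ k),
    ← add_sum_erase _ _ (mem_erase.2 ⟨hkm, mem_univ m⟩),
    ← add_sum_erase _ _ (mem_erase.2 ⟨hmn.symm, mem_erase.2 ⟨hkn, mem_univ n⟩⟩), sum_eq_zero]
  · ring
  intro q hq
  rw [h q (ne_of_mem_erase (mem_of_mem_erase (mem_of_mem_erase hq)))
    (ne_of_mem_erase (mem_of_mem_erase hq)) (ne_of_mem_erase hq), zero_mul]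

theorem ne_zero_of_sq_eq_one {a : ℤ} (h : a ^ 2 = 1) : a ≠ 0 := by
  rintro rfl; norm_num at h

theorem eq_one_or_of_sq_eq_one {a : ℤ} (h : a ^ 2 = 1) : a = 1 ∨ a = -1 := by
  have h1 : (a - 1) * (a + 1) = 0 := by linarith
  rcases mul_eq_zero.1 h1 with h2 | h2 <;> omega

section

variable {s s' A D T : Finset ι} {v v' : ι → κ → ℤ} {pos : ι → ℤ} {h g : ι → ℤ} {φ ψ : ι → ℚ}
  {i j u w x y z : ι} {k m q : κ}

theorem Conn.mono (hn : ∀ a ∈ s', nb s' v' a ⊆ nb s v a) (hx : x ∈ s')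
    (hc : Conn s' v' x y) : Conn s v x y := by
  induction hc with
  | refl => exact Conn.refl
  | tail hab hb ih => exact ih.trans (Conn.of_mem_nb (hn _ (Conn.mem hx hab) hb))

theorem nb_mono (hs : s' ⊆ s) : nb s' v y ⊆ nb s v y := filter_subset_filter _ hs

theorem nb_erase : nb (s.erase i) v y = (nb s v y).erase i := filter_erase _ _ _

theorem Conn.of_erase (hx : x ∈ s.erase i) (hc : Conn (s.erase i) v x y) : Conn s v x y :=
  hc.mono (fun _ _ => nb_mono (erase_subset _ _)) hx

/-- Paths avoiding a vertex stay on one side of it. -/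
theorem Fam.pos_lt_iff_of_conn (F : Fam s v pos) (hi : i ∉ s) (hx : x ∈ s) (hc : Conn s v x y) :
    pos x < pos i ↔ pos y < pos i := by
  induction hc with
  | refl => rfl
  | @tail b c hab hb ih =>
    rw [ih]
    have hbs := Conn.mem hx hab
    have h1 : pos b ≠ pos i := fun h => hi (F.inj h ▸ hbs)
    have h2 : pos c ≠ pos i := fun h => hi (F.inj h ▸ nb_subset hb)
    have := F.pos_nb hbs hb
    omega

/-- Removing a leaf does not change the connections between the other vertices. -/
theorem Conn.remove_leaf (hn : ∀ a ∈ s, a ≠ i → ∀ b ∈ nb s v a, b ≠ i → b ∈ nb s' v' a)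
    (hi : i ∈ s) (hleaf : nb s v i ⊆ {u}) (hui : u ≠ i) (hx : x ∈ s) (hc : Conn s v x y) :
    Conn s' v' (if x = i then u else x) (if y = i then u else y) := by
  induction hc with
  | refl => exact Conn.refl
  | @tail b c hab hb ih =>
    refine ih.trans ?_
    have hbs := Conn.mem hx hab
    by_cases hbi : b = i
    · subst hbi
      have := mem_singleton.1 (hleaf hb)
      subst this
      rw [if_pos rfl, if_neg hui]
      exact Conn.refl
    · by_cases hci : c = i
      · subst hci
        have := mem_singleton.1 (hleaf (mem_nb_comm hbs hb))
        subst this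
        rw [if_pos rfl, if_neg hbi]
        exact Conn.refl
      · rw [if_neg hbi, if_neg hci]
        exact Conn.of_mem_nb (hn b hbs hbi c hb hci)

/-- The potential of a single source on a component. -/
theorem Fam.point_source (F : Fam s v pos) (hφ : IsPot s v h φ) (hi : i ∈ s) (h1 : h i ^ 2 = 1)
    (h0 : ∀ y ∈ comp s v i, y ≠ i → h y = 0) :
    ∀ y ∈ comp s v i, 0 < h i * φ y ∧ (y ≠ i → h i * φ y < h i * φ i) := by
  have key : ∀ (h : ι → ℤ) (φ : ι → ℚ), IsPot s v h φ → h i = 1 →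
      (∀ y ∈ comp s v i, y ≠ i → h y = 0) →
      ∀ y ∈ comp s v i, 0 < φ y ∧ (y ≠ i → φ y < φ i) := by
    intro h φ hφ h1 h0
    have hpos := F.pos_of_source_nonneg hφ comp_subset comp_closed
      (fun x hx y hy => comp_conn hi hx hy) (fun y hy => by
        by_cases hyi : y = i
        · rw [hyi, h1]; norm_num
        · rw [h0 y hy hyi]) (mem_comp_self hi) (by rw [h1]; norm_num)
    intro y hy
    refine ⟨hpos y hy, F.lt_source hφ comp_subset comp_closed (hpos i (mem_comp_self hi))
      (fun y hy hne => (h0 y hy hne).le) y hy⟩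
  intro y hy
  rcases eq_one_or_of_sq_eq_one h1 with h | h
  · have := key _ φ hφ h h0 y hy
    rw [h]; simpa using this
  · have := key _ _ hφ.neg (by simp [h]) (fun y hy hne => by simp [h0 y hy hne]) y hy
    rw [h]; simpa using this

theorem Fam.pot_eq_mul (F : Fam s v pos) (hφ : IsPot s v h φ) (hi : i ∈ s) (h1 : h i ^ 2 = 1) :
    ((v i ⬝ᵥ v i : ℤ) : ℚ) * (h i * φ i) = 1 + ∑ z ∈ nb s v i, h i * φ z := by
  have e := F.pot_eq hφ hi
  have e1 : (h i : ℚ) * h i = 1 := by rw [← sq]; exact_mod_cast h1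
  rw [← mul_sum]
  linear_combination (h i : ℚ) * e + e1

/-- If the potential of a single source is at least `1/2` at the source, then the norm there is at
most the degree plus `1`, or the source is an isolated vertex of norm `2`. -/
theorem Fam.norm_le_of_half_le (F : Fam s v pos) (hφ : IsPot s v h φ) (hi : i ∈ s)
    (h1 : h i ^ 2 = 1) (h0 : ∀ y ∈ comp s v i, y ≠ i → h y = 0) (hhalf : 1 / 2 ≤ h i * φ i) :
    v i ⬝ᵥ v i ≤ (nb s v i).card + 1 ∨ (v i ⬝ᵥ v i = 2 ∧ nb s v i = ∅) := by
  have e := F.pot_eq_mul hφ hi h1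
  have hp := F.point_source hφ hi h1 h0
  rcases (nb s v i).eq_empty_or_nonempty with hE | hE
  · right
    refine ⟨le_antisymm ?_ (F.diag i hi), hE⟩
    rw [hE, sum_empty, add_zero] at e
    have : ((v i ⬝ᵥ v i : ℤ) : ℚ) ≤ 2 := by
      by_contra hcon
      nlinarith
    exact_mod_cast this
  · left
    -- With `x = h i * φ i`, the row at `i` gives `norm * x < 1 + degree * x`; as `x ≥ 1/2`, norm
    -- minus degree is less than `2`.
    have hlt : ∑ z ∈ nb s v i, h i * φ z < ∑ z ∈ nb s v i, h i * φ i := by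
      refine sum_lt_sum_of_nonempty hE fun z hz => ?_
      exact (hp z (comp_closed i (mem_comp_self hi) hz)).2 (F.ne_of_mem_nb hi hz)
    rw [sum_const, nsmul_eq_mul] at hlt
    have h2 : ((v i ⬝ᵥ v i : ℤ) : ℚ) < (nb s v i).card + 2 := by
      by_contra hcon
      nlinarith
    have h3 : v i ⬝ᵥ v i < (nb s v i).card + 2 := by exact_mod_cast h2
    omega

/-- A vertex that alone is hit by a basis vector of the span has norm `2` and degree `2`. -/
theorem Fam.of_column_single (F : Fam s v pos) (hi : i ∈ s) (hq : InSpan s v q φ)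
    (h1 : v i q ^ 2 = 1) (h0 : ∀ y ∈ s, y ≠ i → v y q = 0) :
    v i ⬝ᵥ v i = 2 ∧ (nb s v i).card = 2 ∧ (v i q : ℚ) * φ i = 1 := by
  -- The whole energy `1` sits at `i`, so the signed potential is `1` there and smaller at the
  -- neighbours. Hence the norm is less than the degree plus one, and norm `≥ 2 ≥` degree makes both
  -- equal to `2`.
  have hE := hq.energy
  rw [sum_eq_single_of_mem i hi fun y hy hne => by rw [h0 y hy hne]; simp] at hE
  have e := F.pot_eq_mul hq.isPot hi h1
  have hp := F.point_source hq.isPot hi h1 fun y hy hne => h0 y (comp_subset hy) hne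
  simp only [hE] at e hp
  have hd := F.diag i hi
  have hc := F.card_nb_le hi
  rcases (nb s v i).eq_empty_or_nonempty with hE0 | hE0
  · rw [hE0, sum_empty, mul_one, add_zero] at e
    have : v i ⬝ᵥ v i = 1 := by exact_mod_cast e
    omega
  · have hlt : ∑ z ∈ nb s v i, (v i q : ℚ) * φ z < ∑ z ∈ nb s v i, 1 := by
      refine sum_lt_sum_of_nonempty hE0 fun z hz => ?_
      exact (hp z (comp_closed i (mem_comp_self hi) hz)).2 (F.ne_of_mem_nb hi hz)
    rw [sum_const, nsmul_eq_mul, mul_one] at hlt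
    have h2 : ((v i ⬝ᵥ v i : ℤ) : ℚ) < (nb s v i).card + 1 := by linarith
    have h3 : v i ⬝ᵥ v i < (nb s v i).card + 1 := by exact_mod_cast h2
    refine ⟨by omega, by omega, hE⟩

/-- The family with the `k`-th coordinate of the `j`-th vector deleted. -/
noncomputable def dropCoord (v : ι → κ → ℤ) (j : ι) (k : κ) : ι → κ → ℤ :=
  Function.update v j (Function.update (v j) k 0)

theorem contr_of_ne (h : y ≠ j) : dropCoord v j k y = v y := Function.update_of_ne h _ _

theorem contr_self_apply : dropCoord v j k j k = 0 := by simp [dropCoord]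

theorem contr_apply_of_ne (h : q ≠ k) : dropCoord v j k y q = v y q := by
  by_cases hy : y = j
  · subst hy; simp [dropCoord, h]
  · rw [contr_of_ne hy]

theorem dot_update_zero (x y : κ → ℤ) (k : κ) :
    Function.update x k 0 ⬝ᵥ y = x ⬝ᵥ y - x k * y k := by
  rw [dotProduct, dotProduct, ← add_sum_erase univ _ (mem_univ k),
    ← add_sum_erase univ (fun q => x q * y q) (mem_univ k)]
  rw [sum_congr rfl fun q hq => by rw [Function.update_of_ne (ne_of_mem_erase hq)]]
  simp

/-- Without `i`, the only vector hit by `e_k` is the `j`-th one. Deleting that coordinate changes no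
product except the norm of this vector, which drops by `1`. -/
theorem contr_dot (hk : ∀ y ∈ s, y ≠ i → y ≠ j → v y k = 0) (h1 : v j k ^ 2 = 1)
    (hy : y ∈ s.erase i) (hz : z ∈ s.erase i) :
    dropCoord v j k y ⬝ᵥ dropCoord v j k z = v y ⬝ᵥ v z - if y = j ∧ z = j then 1 else 0 := by
  have hy' := mem_erase.1 hy
  have hz' := mem_erase.1 hz
  by_cases hyj : y = j <;> by_cases hzj : z = j
  · subst hyj; subst hzj
    simp only [dropCoord, Function.update_self]
    rw [dot_update_zero, dotProduct_comm, dot_update_zero]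
    simp [← sq, h1]
  · subst hyj
    rw [contr_of_ne hzj]
    simp only [dropCoord, Function.update_self]
    rw [dot_update_zero, hk z hz'.2 hz'.1 hzj]
    simp [hzj]
  · subst hzj
    rw [contr_of_ne hyj]
    simp only [dropCoord, Function.update_self]
    rw [dotProduct_comm, dot_update_zero, hk y hy'.2 hy'.1 hyj, dotProduct_comm]
    simp [hyj]
  · rw [contr_of_ne hyj, contr_of_ne hzj]; simp [hyj]

theorem Fam.contr (F : Fam s v pos) (hk : ∀ y ∈ s, y ≠ i → y ≠ j → v y k = 0)
    (h1 : v j k ^ 2 = 1) (h3 : 3 ≤ v j ⬝ᵥ v j) : Fam (s.erase i) (dropCoord v j k) pos := by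
  refine ⟨F.inj, fun y hy => ?_, fun y hy z hz hne => ?_, fun y hy z hz h => ?_⟩
  · rw [contr_dot hk h1 hy hy]
    split_ifs with h
    · rw [h.1]; linarith
    · simpa using F.diag y (mem_of_mem_erase hy)
  · rw [contr_dot hk h1 hy hz, if_neg (fun h => hne (h.1.trans h.2.symm)), sub_zero]
    exact F.off y (mem_of_mem_erase hy) z (mem_of_mem_erase hz) hne
  · rw [contr_dot hk h1 hy hz] at h
    split_ifs at h with h'
    · rw [h'.1, h'.2] at h; omega
    · rw [sub_zero] at h
      exact F.near y (mem_of_mem_erase hy) z (mem_of_mem_erase hz) h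

theorem nb_contr (hk : ∀ y ∈ s, y ≠ i → y ≠ j → v y k = 0) (h1 : v j k ^ 2 = 1)
    (h3 : 3 ≤ v j ⬝ᵥ v j) (hy : y ∈ s.erase i) :
    nb (s.erase i) (dropCoord v j k) y = (nb s v y).erase i := by
  ext z
  simp only [mem_nb, mem_erase]
  constructor
  · rintro ⟨⟨hzi, hz⟩, h⟩
    rw [contr_dot hk h1 hy (mem_erase.2 ⟨hzi, hz⟩)] at h
    split_ifs at h with h'
    · rw [h'.1, h'.2] at h; omega
    · exact ⟨hzi, hz, by linarith⟩
  · rintro ⟨hzi, hz, h⟩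
    refine ⟨⟨hzi, hz⟩, ?_⟩
    rw [contr_dot hk h1 hy (mem_erase.2 ⟨hzi, hz⟩), if_neg, h, sub_zero]
    rintro ⟨rfl, rfl⟩
    omega

theorem Conn.of_contr (hk : ∀ y ∈ s, y ≠ i → y ≠ j → v y k = 0) (h1 : v j k ^ 2 = 1)
    (h3 : 3 ≤ v j ⬝ᵥ v j) (hx : x ∈ s.erase i) (hc : Conn (s.erase i) (dropCoord v j k) x y) :
    Conn s v x y :=
  hc.mono (fun _ ha => by rw [nb_contr hk h1 h3 ha]; exact erase_subset _ _) hx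

/-- What is left of the `i`-th vector is in the span of the contracted family. -/
theorem contr_comb (hk : ∀ y ∈ s, y ≠ i → y ≠ j → v y k = 0) (hi : i ∈ s) (hq : InSpan s v k φ)
    (hφi : φ i ≠ 0) (p : κ) :
    ∑ y ∈ s.erase i, φ y / φ i * (dropCoord v j k y p : ℚ) = ((-Function.update (v i) k 0) p : ℤ) := by
  by_cases hp : p = k
  · subst hp
    rw [sum_eq_zero]
    · simp
    intro y hy
    have hy' := mem_erase.1 hy
    by_cases hyj : y = j
    · rw [hyj, contr_self_apply]; simp
    · rw [contr_of_ne hyj, hk y hy'.2 hy'.1 hyj]; simp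
  · have := hq p
    rw [if_neg hp, ← add_sum_erase s _ hi] at this
    simp only [contr_apply_of_ne hp, Pi.neg_apply, Function.update_of_ne hp, Int.cast_neg]
    rw [sum_congr rfl fun y _ => show φ y / φ i * (v y p : ℚ) = φ y * v y p / φ i by ring,
      ← sum_div, div_eq_iff hφi]
    linarith

end

/-! ### Two chains linked at their ends by a basis vector. -/

/-- Two vectors are hit by a common basis vector. -/
def Meet (v : ι → κ → ℤ) (x y : ι) : Prop := ∃ q, v x q ≠ 0 ∧ v y q ≠ 0

/-- The data of two chains that are linked to each other at their ends by a basis vector `e_m` of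
their span, which hits no other vector of the family. -/
structure EndLinked (s : Finset ι) (v : ι → κ → ℤ) (pos : ι → ℤ) (u u' : ι) (m : κ)
    (φ : ι → ℚ) : Prop where
  fam : Fam s v pos
  mem : u ∈ s
  mem' : u' ∈ s
  not_conn : ¬ Conn s v u u'
  sq : v u m ^ 2 = 1
  sq' : v u' m ^ 2 = 1
  zero : ∀ y ∈ s, y ≠ u → y ≠ u' → v y m = 0
  span : InSpan s v m φ
  deg : (nb s v u).card ≤ 1
  deg' : (nb s v u').card ≤ 1

section

variable {s : Finset ι} {v : ι → κ → ℤ} {pos : ι → ℤ} {h g : ι → ℤ} {φ ψ : ι → ℚ}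
  {i j u u' w x y z : ι} {k l m n q : κ}

theorem EndLinked.swap (E : EndLinked s v pos u u' m φ) : EndLinked s v pos u' u m φ :=
  ⟨E.fam, E.mem', E.mem, fun h => E.not_conn (h.symm E.mem'), E.sq', E.sq,
    fun y hy h1 h2 => E.zero y hy h2 h1, E.span, E.deg', E.deg⟩

/-- The energy of a basis vector of the span that hits two vectors. -/
theorem InSpan.energy_pair (hq : InSpan s v q φ) (hi : i ∈ s) (hj : j ∈ s) (hij : i ≠ j)
    (h0 : ∀ y ∈ s, y ≠ i → y ≠ j → v y q = 0) :
    (v i q : ℚ) * φ i + v j q * φ j = 1 := by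
  have hE := hq.energy
  rw [← add_sum_erase s _ hi, ← add_sum_erase _ _ (mem_erase.2 ⟨hij.symm, hj⟩), sum_eq_zero] at hE
  · linarith
  · intro y hy
    have h1 := mem_erase.1 hy
    have h2 := mem_erase.1 h1.2
    rw [h0 y h2.2 h2.1 h1.1]; simp

theorem InSpan.orth_pair (hq : InSpan s v q φ) (hi : i ∈ s) (hj : j ∈ s) (hij : i ≠ j) (hk : k ≠ q)
    (h0 : ∀ y ∈ s, y ≠ i → y ≠ j → v y k = 0) :
    (v i k : ℚ) * φ i + v j k * φ j = 0 := by
  have hE := hq.orth hk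
  rw [← add_sum_erase s _ hi, ← add_sum_erase _ _ (mem_erase.2 ⟨hij.symm, hj⟩), sum_eq_zero] at hE
  · linarith
  · intro y hy
    have h1 := mem_erase.1 hy
    have h2 := mem_erase.1 h1.2
    rw [h0 y h2.2 h2.1 h1.1]; simp

/-- A column hitting two vectors is, on the component of one of them, a point source. -/
theorem column_eq_zero_of_mem_comp (hnc : ¬ Conn s v i j)
    (h0 : ∀ y ∈ s, y ≠ i → y ≠ j → v y q = 0) :
    ∀ y ∈ comp s v i, y ≠ i → v y q = 0 := by
  intro y hy hyi
  refine h0 y (comp_subset hy) hyi ?_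
  rintro rfl
  exact hnc (mem_comp.1 hy).2

theorem EndLinked.ne (E : EndLinked s v pos u u' m φ) : u ≠ u' := fun h =>
  E.not_conn (h ▸ Conn.refl)

/-- At an end with signed potential at least `1/2` the norm is `2`, so `v u = ±e_m ± e_f`. Removing
`u` and deleting `e_m` from `v u'` passes the role of `e_m` to `e_f` and that of `u` to its
neighbour `z`, with one vector less. The chains are consumed from their linked ends until both are
single vectors supported on `{m, f}`. -/
theorem EndLinked.closed_step (E : EndLinked s v pos u u' m φ) (hhalf : 1 / 2 ≤ (v u m : ℚ) * φ u)
    (ih : ∀ (v' : ι → κ → ℤ) (z : ι) (f : κ) (φ' : ι → ℚ),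
      EndLinked (s.erase u) v' pos z u' f φ' → ∀ x ∈ s.erase u,
        (Conn (s.erase u) v' z x ∨ Conn (s.erase u) v' u' x) → ∀ y ∈ s.erase u, Meet v' x y →
        Conn (s.erase u) v' z y ∨ Conn (s.erase u) v' u' y) :
    ∀ x ∈ s, (Conn s v u x ∨ Conn s v u' x) → ∀ y ∈ s, Meet v x y →
      Conn s v u y ∨ Conn s v u' y := by
  have F := E.fam
  have hu := E.mem
  have hu' := E.mem'
  have hne := E.ne
  have hcol := column_eq_zero_of_mem_comp E.not_conn E.zero
  have hcol' := column_eq_zero_of_mem_comp (fun h => E.not_conn (h.symm hu'))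
    (fun y hy h1 h2 => E.zero y hy h2 h1)
  have hn2 : v u ⬝ᵥ v u = 2 := by
    have h1 := F.norm_le_of_half_le E.span.isPot hu E.sq hcol hhalf
    have h2 := F.diag u hu
    have h3 := E.deg
    rcases h1 with h1 | h1
    · omega
    · exact h1.1
  obtain ⟨f, hfm, hf1, hf0⟩ := exists_coord_of_norm_two hn2 E.sq
  have hdotu : ∀ y, v u ⬝ᵥ v y = v u m * v y m + v u f * v y f := fun y =>
    dot_of_support_pair hfm hf0
  have hf_zero : ∀ y ∈ s, y ≠ u → y ≠ u' → y ∉ nb s v u → v y f = 0 := by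
    intro y hy h1 h2 h3
    have h4 := F.dot_eq_zero hu hy h1 h3
    rw [hdotu, E.zero y hy h1 h2, mul_zero, zero_add] at h4
    exact (mul_eq_zero.1 h4).resolve_left (ne_zero_of_sq_eq_one hf1)
  have hu'nb : u' ∉ nb s v u := fun h => E.not_conn (Conn.of_mem_nb h)
  have hu'f : v u m * v u' m + v u f * v u' f = 0 := by
    rw [← hdotu]; exact F.dot_eq_zero hu hu' hne.symm hu'nb
  have hu'f1 : v u' f ^ 2 = 1 := by
    have h1 : v u f * v u' f = -(v u m * v u' m) := by linarith
    have h2 : (v u f * v u' f) ^ 2 = (v u m * v u' m) ^ 2 := by rw [h1]; ring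
    rw [mul_pow, mul_pow, hf1, E.sq, E.sq'] at h2
    linarith
  rcases (nb s v u).eq_empty_or_nonempty with hE | ⟨z, hz⟩
  -- End of the recursion: an isolated `u` of norm `2` has potential `1/2`, which leaves `1/2` for
  -- `u'`. A neighbour of `u'` would have a value strictly between `0` and `1/2`, making the norm at
  -- `u'` lie strictly between `2` and `3`.
  · have e := F.pot_eq_mul E.span.isPot hu E.sq
    rw [hE, sum_empty, hn2] at e
    have e1 := E.span.energy_pair hu hu' hne E.zero
    have e2 : (v u' m : ℚ) * φ u' = 1 / 2 := by push_cast at e; linarith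
    have e3 := F.pot_eq_mul E.span.isPot hu' E.sq'
    have hp := F.point_source E.span.isPot hu' E.sq' hcol'
    have hE' : nb s v u' = ∅ := by
      by_contra hcon
      have h1 : (nb s v u').card = 1 :=
        le_antisymm E.deg' (card_pos.2 (nonempty_iff_ne_empty.2 hcon))
      obtain ⟨z, hz⟩ := card_eq_one.1 h1
      have hzn : z ∈ nb s v u' := by rw [hz]; exact mem_singleton_self z
      have h2 := hp z (comp_closed u' (mem_comp_self hu') hzn)
      have h3 := h2.2 (F.ne_of_mem_nb hu' hzn)
      simp only [hz, sum_singleton, e2] at e3 h3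
      have h4 : (2 : ℚ) < ((v u' ⬝ᵥ v u' : ℤ) : ℚ) := by linarith [h2.1]
      have h5 : ((v u' ⬝ᵥ v u' : ℤ) : ℚ) < 3 := by linarith
      have h4' : 2 < v u' ⬝ᵥ v u' := by exact_mod_cast h4
      have h5' : v u' ⬝ᵥ v u' < 3 := by exact_mod_cast h5
      omega
    rw [hE', sum_empty] at e3
    simp only [e2] at e3
    have hn2' : v u' ⬝ᵥ v u' = 2 := by
      have : ((v u' ⬝ᵥ v u' : ℤ) : ℚ) = 2 := by linarith
      exact_mod_cast this
    obtain ⟨f', hfm', hf1', hf0'⟩ := exists_coord_of_norm_two hn2' E.sq'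
    have hff : f = f' := by
      by_contra hcon
      exact ne_zero_of_sq_eq_one hu'f1 (hf0' f hfm hcon)
    subst hff
    have hmf : ∀ y ∈ s, (v y m ≠ 0 ∨ v y f ≠ 0) → y = u ∨ y = u' := by
      intro y hy hor
      by_contra! hcon
      rcases hor with h | h
      · exact h (E.zero y hy hcon.1 hcon.2)
      · exact h (hf_zero y hy hcon.1 hcon.2 (by rw [hE]; simp))
    have hend : ∀ x, v x = v u ∨ v x = v u' → ∀ y ∈ s, Meet v x y → y = u ∨ y = u' := by
      rintro x hx y hy ⟨q, hq1, hq2⟩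
      refine hmf y hy ?_
      by_contra! hcon
      have hqm : q ≠ m := fun h => hq2 (h ▸ hcon.1)
      have hqf : q ≠ f := fun h => hq2 (h ▸ hcon.2)
      rcases hx with hx | hx <;> rw [hx] at hq1
      · exact hq1 (hf0 q hqm hqf)
      · exact hq1 (hf0' q hqm hqf)
    have hsing : ∀ a x, nb s v a = ∅ → Conn s v a x → x = a := by
      intro a x ha hc
      have := hc.mem_of_closed (D := {a}) (by simp [ha]) (mem_singleton_self a)
      exact mem_singleton.1 this
    intro x hx hc y hy hm
    have : v x = v u ∨ v x = v u' := by
      rcases hc with hc | hc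
      · left; rw [hsing u x hE hc]
      · right; rw [hsing u' x hE' hc]
    rcases hend x this y hy hm with h | h
    · left; rw [h]; exact Conn.refl
    · right; rw [h]; exact Conn.refl
  · have hnbu : nb s v u ⊆ {z} := by
      intro a ha
      rw [mem_singleton]
      exact card_le_one.1 E.deg a ha z hz
    have hzs := nb_subset hz
    have hzu := F.ne_of_mem_nb hu hz
    have hzu' : z ≠ u' := by rintro rfl; exact hu'nb hz
    have hzm : v z m = 0 := E.zero z hzs hzu hzu'
    have hzf : v u f * v z f = -1 := by
      have := (mem_nb.1 hz).2
      rw [hdotu, hzm] at this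
      linarith
    have hzf1 : v z f ^ 2 = 1 := by
      have : (v u f * v z f) ^ 2 = 1 := by rw [hzf]; norm_num
      rw [mul_pow, hf1] at this
      linarith
    -- With norm `2`, `v u'` would be supported on `{m, f}` and meet `v z` in `e_f` alone; so `u'`
    -- would be adjacent to `z`, joining the two chains.
    have hn3 : 3 ≤ v u' ⬝ᵥ v u' := by
      by_contra hcon
      have hn2' : v u' ⬝ᵥ v u' = 2 := by have := F.diag u' hu'; omega
      obtain ⟨f', hfm', hf1', hf0'⟩ := exists_coord_of_norm_two hn2' E.sq'
      have hff : f = f' := by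
        by_contra hcon
        exact ne_zero_of_sq_eq_one hu'f1 (hf0' f hfm hcon)
      subst hff
      have h1 : v u' ⬝ᵥ v z = v u' f * v z f := by
        rw [dot_of_support_pair hfm hf0', hzm]; ring
      have h2 : v u' ⬝ᵥ v z ≠ 0 := by
        rw [h1]
        exact mul_ne_zero (ne_zero_of_sq_eq_one hu'f1) (ne_zero_of_sq_eq_one hzf1)
      have h3 : z ∈ nb s v u' := by
        by_contra h3
        exact h2 (F.dot_eq_zero hu' hzs hzu' h3)
      exact E.not_conn ((Conn.of_mem_nb hz).trans (Conn.of_mem_nb (mem_nb_comm hu' h3)))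
    have hφu : φ u ≠ 0 := by
      intro h0
      rw [h0] at hhalf
      norm_num at hhalf
    have hz' : z ∈ s.erase u := mem_erase.2 ⟨hzu, hzs⟩
    have hu'' : u' ∈ s.erase u := mem_erase.2 ⟨hne.symm, hu'⟩
    -- What is left of `v u` without `e_m` is `±e_f`, in the span of the contracted family by
    -- `contr_comb`; the factor `-(v u f)` corrects the sign.
    have E' : EndLinked (s.erase u) (dropCoord v u' m) pos z u' f
        (fun y => -(v u f) * (φ y / φ u)) := by
      refine ⟨F.contr E.zero E.sq' hn3, hz', hu'', fun hc => ?_, ?_, ?_, ?_, ?_, ?_, ?_⟩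
      · exact E.not_conn ((Conn.of_mem_nb hz).trans (hc.of_contr E.zero E.sq' hn3 hz'))
      · rw [contr_apply_of_ne hfm]; exact hzf1
      · rw [contr_apply_of_ne hfm]; exact hu'f1
      · intro y hy h1 h2
        rw [contr_apply_of_ne hfm]
        have hy' := mem_erase.1 hy
        exact hf_zero y hy'.2 hy'.1 h2 fun h => h1 (mem_singleton.1 (hnbu h))
      · intro p
        have h1 := contr_comb E.zero hu E.span hφu p
        simp only [mul_assoc]
        rw [← mul_sum, h1]
        by_cases hpf : p = f
        · subst hpf
          rw [if_pos rfl, Pi.neg_apply, Function.update_of_ne hfm]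
          push_cast
          have : (v u p : ℚ) ^ 2 = 1 := by exact_mod_cast hf1
          linarith
        · rw [if_neg hpf]
          by_cases hpm : p = m
          · subst hpm; simp
          · rw [Pi.neg_apply, Function.update_of_ne hpm, hf0 p hpm hpf]; simp
      · rw [nb_contr E.zero E.sq' hn3 hz', card_erase_of_mem (mem_nb_comm hu hz)]
        have := F.card_nb_le hzs
        omega
      · rw [nb_contr E.zero E.sq' hn3 hu'']
        exact (card_le_card (erase_subset _ _)).trans E.deg'
    have hih := ih _ _ _ _ E'
    have hback : ∀ a ∈ s, a ≠ u → (Conn s v u a ∨ Conn s v u' a) →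
        Conn (s.erase u) (dropCoord v u' m) z a ∨
        Conn (s.erase u) (dropCoord v u' m) u' a := by
      have hstep : ∀ a ∈ s, a ≠ u → ∀ b ∈ nb s v a, b ≠ u →
          b ∈ nb (s.erase u) (dropCoord v u' m) a := by
        intro a ha hau b hb hbu
        rw [nb_contr E.zero E.sq' hn3 (mem_erase.2 ⟨hau, ha⟩)]
        exact mem_erase.2 ⟨hbu, hb⟩
      intro a ha hau hor
      rcases hor with hc | hc
      · have := Conn.remove_leaf hstep hu hnbu hzu hu hc
        rw [if_pos rfl, if_neg hau] at this
        exact Or.inl this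
      · have := Conn.remove_leaf hstep hu hnbu hzu hu' hc
        rw [if_neg hne.symm, if_neg hau] at this
        exact Or.inr this
    rintro x hx hc y hy ⟨q, hqx, hqy⟩
    by_cases hyu : y = u
    · left; rw [hyu]; exact Conn.refl
    by_cases hxu : x = u
    · subst hxu
      by_cases hyu' : y = u'
      · right; rw [hyu']; exact Conn.refl
      by_cases hyn : y ∈ nb s v x
      · left; exact Conn.of_mem_nb hyn
      · exfalso
        by_cases hqm : q = m
        · exact hqy (hqm ▸ E.zero y hy hyu hyu')
        · by_cases hqf : q = f
          · exact hqy (hqf ▸ hf_zero y hy hyu hyu' hyn)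
          · exact hqx (hf0 q hqm hqf)
    by_cases hqm : q = m
    · subst hqm
      right
      have : y = u' := by
        by_contra h
        exact hqy (E.zero y hy hyu h)
      rw [this]; exact Conn.refl
    have h1 := hih x (mem_erase.2 ⟨hxu, hx⟩) (hback x hx hxu hc) y (mem_erase.2 ⟨hyu, hy⟩)
      ⟨q, by rwa [contr_apply_of_ne hqm], by rwa [contr_apply_of_ne hqm]⟩
    rcases h1 with h1 | h1
    · exact Or.inl ((Conn.of_mem_nb hz).trans (h1.of_contr E.zero E.sq' hn3 hz'))
    · exact Or.inr (h1.of_contr E.zero E.sq' hn3 hu'')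

/-- Two chains linked to each other at their ends by a basis vector of their span meet no other
vector of the family. -/
theorem EndLinked.closed (E : EndLinked s v pos u u' m φ) :
    ∀ x ∈ s, (Conn s v u x ∨ Conn s v u' x) → ∀ y ∈ s, Meet v x y →
      Conn s v u y ∨ Conn s v u' y := by
  induction hn : s.card generalizing s v u u' m φ with
  | zero =>
    intro x hx
    rw [card_eq_zero.1 hn] at hx
    simp at hx
  | succ n ih =>
    have e1 := E.span.energy_pair E.mem E.mem' E.ne E.zero
    -- The two signed potentials add up to `1`, so one of them is at least `1/2`.
    rcases le_or_gt (1 / 2) ((v u m : ℚ) * φ u) with hhalf | hhalf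
    · exact E.closed_step hhalf fun v' z f φ' E' =>
        ih E' (by rw [card_erase_of_mem E.mem, hn]; rfl)
    · have := E.swap.closed_step (by linarith) fun v' z f φ' E' =>
        ih E' (by rw [card_erase_of_mem E.mem', hn]; rfl)
      intro x hx hc y hy hm
      exact (this x hx hc.symm y hy hm).symm

/-- If a vertex of degree `2` and its two neighbours are exactly the vectors hit by `e_m`, and
`e_m` is in the span of the family without that vertex, then the other vertices of the component
meet no vector outside the component. -/
theorem Fam.arms_closed (F : Fam s v pos) (hw : w ∈ s) (hu : u ∈ nb s v w) (hu' : u' ∈ nb s v w)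
    (huu' : u ≠ u') (h1 : v u m ^ 2 = 1) (h1' : v u' m ^ 2 = 1)
    (h0 : ∀ y ∈ s, y ≠ w → y ≠ u → y ≠ u' → v y m = 0) (hm : InSpan (s.erase w) v m φ) :
    ∀ x ∈ comp s v w, x ≠ w → ∀ y ∈ s, Meet v x y → y ∈ comp s v w := by
  have hwc := mem_comp_self (v := v) hw
  have hpu := F.pos_nb hw hu
  have hpu' := F.pos_nb hw hu'
  have hpne : pos u ≠ pos u' := fun h => huu' (F.inj h)
  have hus : u ∈ s.erase w := mem_erase.2 ⟨F.ne_of_mem_nb hw hu, nb_subset hu⟩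
  have hus' : u' ∈ s.erase w := mem_erase.2 ⟨F.ne_of_mem_nb hw hu', nb_subset hu'⟩
  have F' := F.mono (erase_subset w s)
  have hnb : ∀ a, a ∈ nb s v w → (nb (s.erase w) v a).card ≤ 1 := by
    intro a ha
    rw [nb_erase, card_erase_of_mem (mem_nb_comm hw ha)]
    have := F.card_nb_le (nb_subset ha)
    omega
  -- The two neighbours lie on opposite sides of `w` on the line, so without `w` they are ends of
  -- two different chains.
  have E : EndLinked (s.erase w) v pos u u' m φ := by
    refine ⟨F', hus, hus', fun hc => ?_, h1, h1', fun y hy => ?_, hm, hnb u hu, hnb u' hu'⟩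
    · have := F'.pos_lt_iff_of_conn (notMem_erase w s) hus hc
      omega
    · have := mem_erase.1 hy
      exact h0 y this.2 this.1
  have hnw : nb s v w ⊆ {u, u'} := by
    intro a ha
    have h3 := F.pos_nb hw ha
    rw [mem_insert, mem_singleton]
    by_contra! hcon
    have h4 : pos a ≠ pos u := fun h => hcon.1 (F.inj h)
    have h5 : pos a ≠ pos u' := fun h => hcon.2 (F.inj h)
    omega
  have hsub : ∀ x, Conn s v w x → x = w ∨ Conn (s.erase w) v u x ∨ Conn (s.erase w) v u' x := by
    intro x hc
    induction hc with
    | refl => exact Or.inl rfl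
    | @tail b c hab hb ih =>
      by_cases hcw : c = w
      · exact Or.inl hcw
      right
      rcases ih with rfl | ih
      · have := hnw hb
        rw [mem_insert, mem_singleton] at this
        rcases this with rfl | rfl
        · exact Or.inl Conn.refl
        · exact Or.inr Conn.refl
      · have hb' : c ∈ nb (s.erase w) v b := by
          rw [nb_erase]; exact mem_erase.2 ⟨hcw, hb⟩
        exact ih.imp (fun h => h.trans (Conn.of_mem_nb hb'))
          (fun h => h.trans (Conn.of_mem_nb hb'))
  intro x hx hxw y hy hm
  by_cases hyw : y = w
  · rw [hyw]; exact hwc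
  have h3 := (hsub x (mem_comp.1 hx).2).resolve_left hxw
  refine mem_comp.2 ⟨hy, ?_⟩
  rcases E.closed x (mem_erase.2 ⟨hxw, comp_subset hx⟩) h3 y (mem_erase.2 ⟨hyw, hy⟩) hm with h | h
  · exact (Conn.of_mem_nb hu).trans (h.of_erase hus)
  · exact (Conn.of_mem_nb hu').trans (h.of_erase hus')

end

/-! ### Twins: a second basis vector hitting the same two vectors. -/

section

variable {s : Finset ι} {v : ι → κ → ℤ} {pos : ι → ℤ} {φ ψ : ι → ℚ}
  {i j u u' w x y z : ι} {k l m n q : κ}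

/-- A basis vector in the span of a contracted family is in the span of the original one. -/
theorem InSpan.of_contr (hi : i ∈ s) (hj : j ∈ s) (hij : i ≠ j) (hk : InSpan s v k φ)
    (hq : InSpan (s.erase i) (dropCoord v j k) q ψ) : ∃ χ, InSpan s v q χ := by
  refine ⟨fun y => (if y = i then 0 else ψ y) - v j k * ψ j * φ y, fun p => ?_⟩
  have h1 := hq p
  have h2 := hk p
  have h3 : ∑ y ∈ s, (if y = i then 0 else ψ y) * (v y p : ℚ)
      = ∑ y ∈ s.erase i, ψ y * (v y p : ℚ) := by
    rw [← add_sum_erase s _ hi]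
    simp only [if_true, zero_mul, zero_add]
    exact sum_congr rfl fun y hy => by rw [if_neg (ne_of_mem_erase hy)]
  have h4 : ∑ y ∈ s, (v j k : ℚ) * ψ j * φ y * (v y p : ℚ)
      = v j k * ψ j * if p = k then 1 else 0 := by
    rw [← h2, mul_sum]
    exact sum_congr rfl fun y _ => by ring
  simp only [sub_mul, sum_sub_distrib]
  rw [h3, h4, ← h1]
  by_cases hpk : p = k
  · subst hpk
    have hj' : j ∈ s.erase i := mem_erase.2 ⟨hij.symm, hj⟩
    rw [← add_sum_erase _ _ hj', ← add_sum_erase (s.erase i)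
      (fun y => ψ y * (dropCoord v j p y p : ℚ)) hj', contr_self_apply, if_pos rfl]
    rw [sum_congr rfl fun y hy => by rw [← contr_of_ne (v := v) (k := p) (ne_of_mem_erase hy)]]
    push_cast
    ring
  · rw [if_neg hpk]
    simp only [contr_apply_of_ne hpk]
    ring

/-- Potential at least `1/2` and norm at least `3` give norm `3` and two neighbours at `i`. After
contracting `i` along `e_k`, its two remaining basis vectors form a vector linked once to the
components of the two neighbours and of `j`. By `link_structure` these three linked vertices are
shared out between two basis vectors, so one of them is hit alone and has degree `2` by
`of_column_single`. The neighbours of `i` have lost an edge, so it is `j`, and the basis vector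
hitting it is the twin. -/
theorem Fam.exists_twin_of_half_le (F : Fam s v pos) (hi : i ∈ s) (hj : j ∈ s)
    (hnc : ¬ Conn s v i j) (h1 : v i k ^ 2 = 1) (hs : v j k = v i k)
    (h0 : ∀ y ∈ s, y ≠ i → y ≠ j → v y k = 0) (hk : InSpan s v k φ) (h3i : 3 ≤ v i ⬝ᵥ v i)
    (h3j : 3 ≤ v j ⬝ᵥ v j) (hhalf : 1 / 2 ≤ (v i k : ℚ) * φ i) :
    ∃ n, n ≠ k ∧ v i n ^ 2 = 1 ∧ v j n = -v i n ∧ (∀ y ∈ s, y ≠ i → y ≠ j → v y n = 0) ∧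
      (nb s v i).card = 2 ∧ (nb s v j).card = 2 ∧ ∃ χ, InSpan s v n χ := by
  have hij : i ≠ j := fun h => hnc (h ▸ Conn.refl)
  have h1j : v j k ^ 2 = 1 := by rw [hs]; exact h1
  have hcol := column_eq_zero_of_mem_comp hnc h0
  have hle := F.norm_le_of_half_le hk.isPot hi h1 hcol hhalf
  have hcard := F.card_nb_le hi
  have hdeg : (nb s v i).card = 2 := by rcases hle with h | h <;> omega
  have hn3 : v i ⬝ᵥ v i = 3 := by rcases hle with h | h <;> omega
  obtain ⟨u, u', huu', hnb⟩ := card_eq_two.1 hdeg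
  have hu : u ∈ nb s v i := by rw [hnb]; simp
  have hu' : u' ∈ nb s v i := by rw [hnb]; simp
  obtain ⟨m, n, hmk, hnk, hmn, hm1, hn1, hmn0⟩ := exists_coord_of_norm_three hn3 h1
  have hus : u ∈ s.erase i := mem_erase.2 ⟨F.ne_of_mem_nb hi hu, nb_subset hu⟩
  have hus' : u' ∈ s.erase i := mem_erase.2 ⟨F.ne_of_mem_nb hi hu', nb_subset hu'⟩
  have hjs : j ∈ s.erase i := mem_erase.2 ⟨hij.symm, hj⟩
  have huj : u ≠ j := by rintro rfl; exact hnc (Conn.of_mem_nb hu)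
  have huj' : u' ≠ j := by rintro rfl; exact hnc (Conn.of_mem_nb hu')
  have hjnb : j ∉ nb s v i := fun h => hnc (Conn.of_mem_nb h)
  have F' := F.contr h0 h1j h3j
  have hφi : φ i ≠ 0 := by
    intro h
    rw [h] at hhalf
    norm_num at hhalf
  -- The sign makes all three products `1`: the neighbours had product `-1` with `v i`, and `v i ⬝ᵥ
  -- v j = 0` loses the summand `v i k * v j k = 1`.
  set t : κ → ℤ := -Function.update (v i) k 0 with ht
  have htk : t k = 0 := by simp [ht]
  have htne : ∀ q, q ≠ k → t q = -v i q := fun q hq => by simp [ht, hq]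
  have hpu := F.pos_nb hi hu
  have hpu' := F.pos_nb hi hu'
  have hpne : pos u ≠ pos u' := fun h => huu' (F.inj h)
  have hncuu' : ¬ Conn (s.erase i) (dropCoord v j k) u u' := by
    intro hc
    have := F'.pos_lt_iff_of_conn (notMem_erase i s) hus hc
    omega
  have hncu : ∀ a ∈ nb s v i, ¬ Conn (s.erase i) (dropCoord v j k) a j := by
    intro a ha hc
    have has : a ∈ s.erase i := mem_erase.2 ⟨F.ne_of_mem_nb hi ha, nb_subset ha⟩
    exact hnc ((Conn.of_mem_nb ha).trans (hc.of_contr h0 h1j h3j has))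
  have hdot : ∀ y ∈ s.erase i, t ⬝ᵥ dropCoord v j k y = v i k * v y k - v i ⬝ᵥ v y := by
    intro y hy
    have e1 : t ⬝ᵥ dropCoord v j k y = t ⬝ᵥ v y := by
      refine sum_congr rfl fun q _ => ?_
      by_cases hq : q = k
      · rw [hq, htk, zero_mul, zero_mul]
      · rw [contr_apply_of_ne hq]
    rw [e1, ht, neg_dotProduct, dot_update_zero]
    ring
  have hls := F'.link_structure (T := {u, u', j}) (t := t) (σ := fun _ => 1)
    (by
      intro a ha
      simp only [mem_insert, mem_singleton] at ha
      rcases ha with rfl | rfl | rfl <;> assumption)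
    (by
      intro a ha b hb hc
      simp only [mem_insert, mem_singleton] at ha hb
      rcases ha with rfl | rfl | rfl <;> rcases hb with rfl | rfl | rfl
      · rfl
      · exact absurd hc hncuu'
      · exact absurd hc (hncu _ hu)
      · exact absurd (hc.symm hus') hncuu'
      · rfl
      · exact absurd hc (hncu _ hu')
      · exact absurd (hc.symm hjs) (hncu _ hu)
      · exact absurd (hc.symm hjs) (hncu _ hu')
      · rfl)
    (contr_comb h0 hi hk hφi) (fun _ _ => Or.inl rfl)
    (by
      intro a ha
      simp only [mem_insert, mem_singleton] at ha
      rcases ha with rfl | rfl | rfl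
      · rw [hdot _ hus, h0 _ (nb_subset hu) (F.ne_of_mem_nb hi hu) huj, (mem_nb.1 hu).2]; norm_num
      · rw [hdot _ hus', h0 _ (nb_subset hu') (F.ne_of_mem_nb hi hu') huj', (mem_nb.1 hu').2]
        norm_num
      · rw [hdot _ hjs, hs, F.dot_eq_zero hi hj hij.symm hjnb]
        linarith)
    (by
      intro y hy hyT
      simp only [mem_insert, mem_singleton, not_or] at hyT
      have hy' := mem_erase.1 hy
      rw [hdot y hy, h0 y hy'.2 hy'.1 hyT.2.2, F.dot_eq_zero hi hy'.2 hy'.1]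
      · simp
      · rw [hnb]; simp [hyT.1, hyT.2.1])
  obtain ⟨hls1, hls2⟩ := hls
  have hqmn : ∀ q, t q ≠ 0 → q = m ∨ q = n := by
    intro q hq
    by_contra! hcon
    by_cases hqk : q = k
    · exact hq (hqk ▸ htk)
    · exact hq (by rw [htne q hqk, hmn0 q hqk hcon.1 hcon.2, neg_zero])
  have htm : t m ≠ 0 := by rw [htne m hmk]; exact neg_ne_zero.2 (ne_zero_of_sq_eq_one hm1)
  have htn : t n ≠ 0 := by rw [htne n hnk]; exact neg_ne_zero.2 (ne_zero_of_sq_eq_one hn1)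
  -- a basis vector hitting a single linked vertex hits `j`
  have hsing : ∀ q, t q ≠ 0 → ∀ a ∈ s.erase i,
      (∀ y ∈ s.erase i, y ≠ a → dropCoord v j k y q = 0) → a ∈ nb s v i → False := by
    intro q hq a ha hz hanb
    obtain ⟨hq1, ⟨χ, hχ⟩, hq2⟩ := hls1 q hq
    have hne : dropCoord v j k a q ≠ 0 := by
      intro h
      have := hχ.energy
      rw [sum_eq_single_of_mem a ha fun y hy hya => by rw [hz y hy hya]; simp, h] at this
      simp at this
    have hval := (hq2 a ha hne).2
    have := (F'.of_column_single ha hχ (by rw [hval]; rcases hq1 with h | h <;> rw [h] <;> norm_num)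
      hz).2.1
    rw [nb_contr h0 h1j h3j ha, card_erase_of_mem (mem_nb_comm hi hanb)] at this
    have h5 := F.card_nb_le (mem_of_mem_erase ha)
    omega
  have hmain : ∃ q, t q ≠ 0 ∧ ∀ y ∈ s.erase i, y ≠ j → dropCoord v j k y q = 0 := by
    have hsplit : ∀ a ∈ ({u, u', j} : Finset ι),
        (dropCoord v j k a m ≠ 0 ∧ dropCoord v j k a n = 0) ∨
          (dropCoord v j k a n ≠ 0 ∧ dropCoord v j k a m = 0) := by
      intro a ha
      obtain ⟨q, hq, hqa, huniq⟩ := hls2 a ha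
      rcases hqmn q hq with rfl | rfl
      · left
        refine ⟨hqa, ?_⟩
        by_contra h
        exact hmn (huniq n htn h).symm
      · right
        refine ⟨hqa, ?_⟩
        by_contra h
        exact hmn (huniq m htm h)
    have hout : ∀ q, t q ≠ 0 → ∀ y ∈ s.erase i, y ≠ u → y ≠ u' → y ≠ j → dropCoord v j k y q = 0 := by
      intro q hq y hy hyu hyu' hyj
      by_contra h
      have := ((hls1 q hq).2.2 y hy h).1
      simp only [mem_insert, mem_singleton] at this
      tauto
    have hnz : ∀ q, t q ≠ 0 → ∃ y ∈ s.erase i, dropCoord v j k y q ≠ 0 := by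
      intro q hq
      by_contra! hcon
      obtain ⟨-, ⟨χ, hχ⟩, -⟩ := hls1 q hq
      have := hχ.energy
      rw [sum_eq_zero fun y hy => by rw [hcon y hy]; simp] at this
      norm_num at this
    have hu3 := hsplit u (by simp)
    have hu3' := hsplit u' (by simp)
    have hj3 := hsplit j (by simp)
    by_contra! hcon
    -- the vertex `a` is hit by `q` alone if the two other linked vertices are not
    have hno : ∀ q, t q ≠ 0 → dropCoord v j k u q = 0 → dropCoord v j k u' q = 0 → False := by
      intro q hq e1 e2
      obtain ⟨y, hy, hyj, hne⟩ := hcon q hq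
      by_cases hyu : y = u
      · exact hne (hyu ▸ e1)
      by_cases hyu' : y = u'
      · exact hne (hyu' ▸ e2)
      exact hne (hout q hq y hy hyu hyu' hyj)
    have hno1 : ∀ q, t q ≠ 0 → dropCoord v j k u' q = 0 → dropCoord v j k j q = 0 → False := by
      intro q hq e1 e2
      refine hsing q hq u hus (fun y hy hyu => ?_) hu
      by_cases hyu' : y = u'
      · rw [hyu', e1]
      by_cases hyj : y = j
      · rw [hyj, e2]
      exact hout q hq y hy hyu hyu' hyj
    have hno2 : ∀ q, t q ≠ 0 → dropCoord v j k u q = 0 → dropCoord v j k j q = 0 → False := by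
      intro q hq e1 e2
      refine hsing q hq u' hus' (fun y hy hyu' => ?_) hu'
      by_cases hyu : y = u
      · rw [hyu, e1]
      by_cases hyj : y = j
      · rw [hyj, e2]
      exact hout q hq y hy hyu hyu' hyj
    rcases hu3 with e1 | e1 <;> rcases hu3' with e2 | e2 <;> rcases hj3 with e3 | e3
    · exact hno n htn e1.2 e2.2
    · exact hno n htn e1.2 e2.2
    · exact hno2 n htn e1.2 e3.2
    · exact hno1 m htm e2.2 e3.2
    · exact hno1 n htn e2.2 e3.2
    · exact hno2 m htm e1.2 e3.2
    · exact hno m htm e1.2 e2.2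
    · exact hno m htm e1.2 e2.2
  obtain ⟨q, hq, hqz⟩ := hmain
  obtain ⟨hq1, ⟨χ, hχ⟩, hq2⟩ := hls1 q hq
  have hqk : q ≠ k := by rintro rfl; exact hq htk
  have hne : dropCoord v j k j q ≠ 0 := by
    intro h
    have := hχ.energy
    rw [sum_eq_single_of_mem j hjs fun y hy hya => by rw [hqz y hy hya]; simp, h] at this
    simp at this
  have hval := (hq2 j hjs hne).2
  rw [contr_apply_of_ne hqk, htne q hqk, one_mul] at hval
  have hjdeg := (F'.of_column_single hjs hχ (by
    rw [contr_apply_of_ne hqk, hval, ← htne q hqk]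
    rcases hq1 with h | h <;> rw [h] <;> norm_num) hqz).2.1
  rw [nb_contr h0 h1j h3j hjs, erase_eq_of_notMem fun h => hjnb (mem_nb_comm hj h)] at hjdeg
  refine ⟨q, hqk, ?_, hval, fun y hy hyi hyj => ?_, hdeg, hjdeg, hk.of_contr hi hj hij hχ⟩
  · rw [htne q hqk] at hq1
    rcases hq1 with h | h
    · rw [show v i q = -1 by linarith]; norm_num
    · rw [show v i q = 1 by linarith]; norm_num
  · have := hqz y (mem_erase.2 ⟨hyi, hy⟩) hyj
    rwa [contr_apply_of_ne hqk] at this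

/-- If a basis vector `e_k` of the span hits exactly two vectors, with the same sign and in
different components, both of norm at least `3`, then there is another basis vector of the span
that hits just these two vectors, with opposite signs. -/
theorem Fam.exists_twin (F : Fam s v pos) (hi : i ∈ s) (hj : j ∈ s)
    (hnc : ¬ Conn s v i j) (h1 : v i k ^ 2 = 1) (hs : v j k = v i k)
    (h0 : ∀ y ∈ s, y ≠ i → y ≠ j → v y k = 0) (hk : InSpan s v k φ) (h3i : 3 ≤ v i ⬝ᵥ v i)
    (h3j : 3 ≤ v j ⬝ᵥ v j) :
    ∃ n, n ≠ k ∧ v i n ^ 2 = 1 ∧ v j n = -v i n ∧ (∀ y ∈ s, y ≠ i → y ≠ j → v y n = 0) ∧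
      (nb s v i).card = 2 ∧ (nb s v j).card = 2 ∧ ∃ χ, InSpan s v n χ := by
  have hij : i ≠ j := fun h => hnc (h ▸ Conn.refl)
  have e := hk.energy_pair hi hj hij h0
  rcases le_or_gt (1 / 2) ((v i k : ℚ) * φ i) with hh | hh
  · exact F.exists_twin_of_half_le hi hj hnc h1 hs h0 hk h3i h3j hh
  · obtain ⟨n, a1, a2, a3, a4, a5, a6, a7⟩ := F.exists_twin_of_half_le hj hi
      (fun h => hnc (h.symm hj)) (by rw [hs]; exact h1) hs.symm
      (fun y hy h1 h2 => h0 y hy h2 h1) hk h3j h3i (by linarith)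
    exact ⟨n, a1, by rw [a3, neg_sq]; exact a2, by rw [a3, neg_neg],
      fun y hy h1 h2 => a4 y hy h2 h1, a6, a5, a7⟩

end

/-! ### Systems, their labels, and blocks of one or two linked vertices. -/

/-- The vectors of the family that are hit by `e_q`. -/
noncomputable def col (s : Finset ι) (v : ι → κ → ℤ) (q : κ) : Finset ι := s.filter fun y => v y q ≠ 0

/-- A family spanning the coordinate space of `K`, together with a vector `t` having product `1`
with exactly one vector (the one in `T`) of every component and `0` with all the others. -/
structure Sys (s : Finset ι) (v : ι → κ → ℤ) (pos : ι → ℤ) (K : Finset κ) (t : κ → ℤ)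
    (T : Finset ι) : Prop where
  fam : Fam s v pos
  subset : T ⊆ s
  full : ∀ q ∈ K, ∃ φ, InSpan s v q φ
  supp : ∀ y ∈ s, ∀ q, q ∉ K → v y q = 0
  tsupp : ∀ q, q ∉ K → t q = 0
  one : ∀ y ∈ T, t ⬝ᵥ v y = 1
  zero : ∀ y ∈ s, y ∉ T → t ⬝ᵥ v y = 0
  sep : ∀ w ∈ T, ∀ w' ∈ T, Conn s v w w' → w = w'
  cover : ∀ x ∈ s, ∃ w ∈ T, Conn s v x w
  irr : ∀ B ⊆ s, B.Nonempty → (∀ x ∈ B, ∀ y ∈ s, Meet v x y → y ∈ B) → B = s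
  count : ∑ y ∈ s, v y ⬝ᵥ v y + T.card ≤ 3 * K.card

section

variable {s T : Finset ι} {K : Finset κ} {t : κ → ℤ} {v : ι → κ → ℤ} {pos : ι → ℤ} {φ ψ : ι → ℚ}
  {i j u u' w w' x y z : ι} {k l m n q : κ}

theorem mem_col : y ∈ col s v q ↔ y ∈ s ∧ v y q ≠ 0 := by simp [col]

theorem eq_zero_of_notMem_col (hy : y ∈ s) (h : y ∉ col s v q) : v y q = 0 := by
  by_contra hne
  exact h (mem_col.2 ⟨hy, hne⟩)

theorem InSpan.of_erase_eq_zero (hq : InSpan s v q φ) (h : φ w = 0) : InSpan (s.erase w) v q φ := by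
  intro p
  rw [← hq p]
  by_cases hw : w ∈ s
  · rw [← add_sum_erase s _ hw, h]; simp
  · rw [erase_eq_of_notMem hw]

theorem InSpan.sum_col (hq : InSpan s v q φ) :
    ∑ y ∈ col s v q, (v y q : ℚ) * φ y = 1 := by
  rw [← hq.energy]
  refine sum_subset (filter_subset _ _) fun y hy h => ?_
  rw [eq_zero_of_notMem_col hy h]; simp

theorem InSpan.sum_col_of_ne (hq : InSpan s v q φ) {p : κ} (hp : p ≠ q) :
    ∑ y ∈ col s v p, (v y p : ℚ) * φ y = 0 := by
  rw [← hq.orth hp]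
  refine sum_subset (filter_subset _ _) fun y hy h => ?_
  rw [eq_zero_of_notMem_col hy h]; simp

theorem InSpan.col_nonempty (hq : InSpan s v q φ) : (col s v q).Nonempty := by
  rw [nonempty_iff_ne_empty]
  intro h
  have := hq.sum_col
  rw [h] at this
  simp at this

namespace Sys

variable (Y : Sys s v pos K t T)
include Y

theorem mem_of_ne_zero (hy : y ∈ s) (h : v y q ≠ 0) : q ∈ K := by
  by_contra hq
  exact h (Y.supp y hy q hq)

theorem mem_of_t_ne_zero (h : t q ≠ 0) : q ∈ K := by
  by_contra hq
  exact h (Y.tsupp q hq)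

/-- Since `t` is a combination of basis vectors of the span, `link_structure` applies with all signs
`1`. The columns `col s v q` with `t q ≠ 0` thus cut `T` into blocks on which the coordinate is
constantly `t q`. -/
theorem link :
    (∀ q, t q ≠ 0 → (t q = 1 ∨ t q = -1) ∧ ∀ y ∈ s, v y q ≠ 0 → y ∈ T ∧ v y q = t q) ∧
    ∀ w ∈ T, ∃ q, t q ≠ 0 ∧ v w q ≠ 0 ∧ ∀ q', t q' ≠ 0 → v w q' ≠ 0 → q' = q := by
  have hf : ∀ q, ∃ φ, t q ≠ 0 → InSpan s v q φ := fun q => by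
    by_cases h : t q = 0
    · exact ⟨0, fun h' => absurd h h'⟩
    · obtain ⟨φ, hφ⟩ := Y.full q (Y.mem_of_t_ne_zero h)
      exact ⟨φ, fun _ => hφ⟩
  choose f hf using hf
  have hψ : ∀ p, ∑ y ∈ s, (∑ q, (t q : ℚ) * f q y) * (v y p : ℚ) = t p := by
    intro p
    simp only [sum_mul]
    rw [sum_comm]
    have : ∀ q, ∑ y ∈ s, (t q : ℚ) * f q y * (v y p : ℚ) = if p = q then (t q : ℚ) else 0 := by
      intro q
      simp only [mul_assoc]
      rw [← mul_sum]
      by_cases h : t q = 0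
      · simp [h]
      · rw [hf q h p]; simp
    simp [this]
  have := Y.fam.link_structure (T := T) (σ := fun _ => 1) Y.subset Y.sep hψ
    (fun _ _ => Or.inl rfl) Y.one Y.zero
  refine ⟨fun q hq => ⟨(this.1 q hq).1, fun y hy h => ?_⟩, this.2⟩
  have h2 := (this.1 q hq).2.2 y hy h
  exact ⟨h2.1, by rw [h2.2, one_mul]⟩

theorem t_sq (h : t q ≠ 0) : t q ^ 2 = 1 := by
  rcases (Y.link.1 q h).1 with h | h <;> rw [h] <;> norm_num

theorem col_subset (h : t q ≠ 0) : col s v q ⊆ T := fun y hy =>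
  ((Y.link.1 q h).2 y (mem_col.1 hy).1 (mem_col.1 hy).2).1

theorem eq_t (h : t q ≠ 0) (hy : y ∈ col s v q) : v y q = t q :=
  ((Y.link.1 q h).2 y (mem_col.1 hy).1 (mem_col.1 hy).2).2

/-- The coordinates of a basis vector with respect to the family add up to zero on the set of
vectors hit by another basis vector linked to `t`. -/
theorem sum_block (hk : InSpan s v k φ) (hl : t l ≠ 0) (hkl : k ≠ l) :
    ∑ y ∈ col s v l, φ y = 0 := by
  have := hk.sum_col_of_ne hkl.symm
  rw [sum_congr rfl fun y hy => by rw [Y.eq_t hl hy], ← mul_sum] at this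
  exact (mul_eq_zero.1 this).resolve_left (by exact_mod_cast hl)

theorem not_conn (hw : w ∈ T) (hw' : w' ∈ T) (h : w ≠ w') : ¬ Conn s v w w' :=
  fun hc => h (Y.sep w hw w' hw' hc)

/-- If the vertices of the components of `A ⊆ T` meet only each other, then `A = T`. -/
theorem subset_of_closed {A : Finset ι} (hA : A ⊆ T) (hne : A.Nonempty)
    (h : ∀ w ∈ A, ∀ x ∈ comp s v w, ∀ y ∈ s, Meet v x y → ∃ w' ∈ A, y ∈ comp s v w') : T ⊆ A := by
  have hB := Y.irr (A.biUnion (comp s v)) (biUnion_subset.2 fun _ _ => comp_subset) (by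
    obtain ⟨a, ha⟩ := hne
    exact ⟨a, mem_biUnion.2 ⟨a, ha, mem_comp_self (Y.subset (hA ha))⟩⟩) (by
    intro x hx y hy hm
    obtain ⟨w, hw, hx⟩ := mem_biUnion.1 hx
    exact mem_biUnion.2 (h w hw x hx y hy hm))
  intro w hw
  have hws := Y.subset hw
  rw [← hB] at hws
  obtain ⟨w', hw', hc⟩ := mem_biUnion.1 hws
  rw [← Y.sep w' (hA hw') w hw (mem_comp.1 hc).2]
  exact hw'

/-- A block `{w}` gives `v w = ±e_l ± e_m` with two neighbours, and `e_m` hits exactly `w` and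
these. The coordinate of `e_m` at `w` is `0` by `sum_block`, so `e_m` is in the span without `w`; by
`arms_closed` the component meets nothing else, and by irreducibility it is everything. -/
theorem card_le_of_col_singleton (hl : t l ≠ 0) (hcol : col s v l = {w}) : T.card ≤ 1 := by
  have hwcol : w ∈ col s v l := by rw [hcol]; simp
  have hwT : w ∈ T := Y.col_subset hl hwcol
  have hws := Y.subset hwT
  obtain ⟨φ, hφ⟩ := Y.full l (Y.mem_of_t_ne_zero hl)
  have h0 : ∀ y ∈ s, y ≠ w → v y l = 0 := fun y hy hne =>
    eq_zero_of_notMem_col hy (by rw [hcol]; simpa using hne)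
  have h1 : v w l ^ 2 = 1 := by rw [Y.eq_t hl hwcol]; exact Y.t_sq hl
  obtain ⟨hn2, hdeg, -⟩ := Y.fam.of_column_single hws hφ h1 h0
  obtain ⟨m, hml, hm1, hm0⟩ := exists_coord_of_norm_two hn2 h1
  obtain ⟨u, u', huu', hnb⟩ := card_eq_two.1 hdeg
  have hu : u ∈ nb s v w := by rw [hnb]; simp
  have hu' : u' ∈ nb s v w := by rw [hnb]; simp
  have hdot : ∀ y ∈ s, y ≠ w → v w ⬝ᵥ v y = v w m * v y m := fun y hy hne => by
    rw [dot_of_support_pair hml hm0, h0 y hy hne]; ring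
  have hm1' : ∀ y ∈ nb s v w, v y m ^ 2 = 1 := by
    intro y hy
    have h := hdot y (nb_subset hy) (Y.fam.ne_of_mem_nb hws hy)
    rw [(mem_nb.1 hy).2] at h
    have : (v w m * v y m) ^ 2 = 1 := by rw [← h]; norm_num
    rwa [mul_pow, hm1, one_mul] at this
  have hm0' : ∀ y ∈ s, y ≠ w → y ∉ nb s v w → v y m = 0 := by
    intro y hy hne hy'
    have h := hdot y hy hne
    rw [Y.fam.dot_eq_zero hws hy hne hy'] at h
    exact (mul_eq_zero.1 h.symm).resolve_left (ne_zero_of_sq_eq_one hm1)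
  obtain ⟨χ, hχ⟩ := Y.full m (Y.mem_of_ne_zero hws (ne_zero_of_sq_eq_one hm1))
  have hχw : χ w = 0 := by
    have := Y.sum_block hχ hl hml
    rwa [hcol, sum_singleton] at this
  have harm := Y.fam.arms_closed hws hu hu' huu' (hm1' u hu) (hm1' u' hu')
    (fun y hy h1 h2 h3 => hm0' y hy h1 (by rw [hnb]; simp [h2, h3])) (hχ.of_erase_eq_zero hχw)
  have hsub := Y.subset_of_closed (A := {w}) (by simpa using hwT) (by simp) (by
    intro a ha x hx y hy hm
    rw [mem_singleton.1 ha] at hx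
    refine ⟨w, by simp, ?_⟩
    by_cases hxw : x = w
    · subst hxw
      obtain ⟨q, hq, hqy⟩ := hm
      by_cases hyx : y = x
      · rw [hyx]; exact hx
      by_cases hyn : y ∈ nb s v x
      · exact mem_comp.2 ⟨hy, Conn.of_mem_nb hyn⟩
      exfalso
      by_cases hql : q = l
      · exact hqy (hql ▸ h0 y hy hyx)
      by_cases hqm : q = m
      · exact hqy (hqm ▸ hm0' y hy hyx hyn)
      exact hq (hm0 q hql hqm)
    · exact harm x hx hxw y hy hm)
  simpa using card_le_card hsub

/-- Orthogonality to `e_n` gives every `e_q` with `q ≠ n` equal coordinates at `w` and `w'`. For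
`e_l` they are `±1/2`, so `w` is isolated of norm `2` or has norm `3` and two neighbours. In the
second case the third basis vector `e_m` of `v w` is treated as for a block of one vertex. -/
theorem closed_of_double (hl : t l ≠ 0) (hww' : w ≠ w') (hcol : col s v l = {w, w'})
    (hnl : n ≠ l) (h1n : v w n ^ 2 = 1) (hsn : v w' n = -v w n) (hcoln : col s v n = {w, w'}) :
    ∀ x ∈ comp s v w, ∀ y ∈ s, Meet v x y → y ∈ comp s v w ∨ y ∈ comp s v w' := by
  have hwcol : w ∈ col s v l := by rw [hcol]; simp
  have hwcol' : w' ∈ col s v l := by rw [hcol]; simp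
  have hwT : w ∈ T := Y.col_subset hl hwcol
  have hwT' : w' ∈ T := Y.col_subset hl hwcol'
  have hws := Y.subset hwT
  have hws' := Y.subset hwT'
  have hnc := Y.not_conn hwT hwT' hww'
  obtain ⟨φ, hφ⟩ := Y.full l (Y.mem_of_t_ne_zero hl)
  have h0 : ∀ y ∈ s, y ≠ w → y ≠ w' → v y l = 0 := fun y hy hne hne' =>
    eq_zero_of_notMem_col hy (by rw [hcol]; simp [hne, hne'])
  have h0n : ∀ y ∈ s, y ≠ w → y ≠ w' → v y n = 0 := fun y hy hne hne' =>
    eq_zero_of_notMem_col hy (by rw [hcoln]; simp [hne, hne'])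
  have e1 := Y.eq_t hl hwcol
  have e1' := Y.eq_t hl hwcol'
  have h1 : v w l ^ 2 = 1 := by rw [e1]; exact Y.t_sq hl
  have hn0 := ne_zero_of_sq_eq_one h1n
  have key : ∀ (q : κ) (χ : ι → ℚ), InSpan s v q χ → q ≠ n → χ w = χ w' := by
    intro q χ hχ hqn
    have := hχ.orth_pair hws hws' hww' hqn.symm h0n
    rw [hsn] at this
    push_cast at this
    have h2 : (v w n : ℚ) * (χ w - χ w') = 0 := by linarith
    have h3 : (v w n : ℚ) ≠ 0 := by exact_mod_cast hn0
    linarith [(mul_eq_zero.1 h2).resolve_left h3]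
  have hE := hφ.energy_pair hws hws' hww' h0
  rw [e1', ← e1, ← key l φ hφ hnl.symm] at hE
  have hhalf : (v w l : ℚ) * φ w = 1 / 2 := by linarith
  have hc0 := column_eq_zero_of_mem_comp hnc h0
  have hpt := Y.fam.point_source hφ.isPot hws h1 hc0
  have hpot := Y.fam.pot_eq_mul hφ.isPot hws h1
  have hdegle := Y.fam.card_nb_le hws
  have ha2 := Y.fam.diag w hws
  have hne2 : (nb s v w).Nonempty → v w ⬝ᵥ v w ≠ 2 := by
    intro hne h2
    rw [h2, hhalf] at hpot
    have : 0 < ∑ z ∈ nb s v w, (v w l : ℚ) * φ z := sum_pos (fun z hz =>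
      (hpt z (mem_comp.2 ⟨nb_subset hz, Conn.of_mem_nb hz⟩)).1) hne
    push_cast at hpot
    linarith
  have hww := mem_comp_self (v := v) hws
  have hww2 := mem_comp_self (v := v) hws'
  have hw'nb : w' ∉ nb s v w := fun h => hnc (Conn.of_mem_nb h)
  rcases (nb s v w).eq_empty_or_nonempty with hnb | hnb
  · have ha : v w ⬝ᵥ v w = 2 := by
      rcases Y.fam.norm_le_of_half_le hφ.isPot hws h1 hc0 hhalf.ge with h | h
      · rw [hnb] at h
        simp only [card_empty] at h
        omega
      · exact h.1
    obtain ⟨m, hml, hm1, hm0⟩ := exists_coord_of_norm_two ha h1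
    have hnm : n = m := by
      by_contra h
      exact hn0 (hm0 n hnl h)
    subst hnm
    intro x hx y hy ⟨q, hq, hqy⟩
    have hxw : x = w := by
      have := Conn.mem_of_closed (D := {w}) (s := s) (v := v) (by simp [hnb])
        (mem_singleton_self w) (mem_comp.1 hx).2
      simpa using this
    rw [hxw] at hq
    by_cases hyw : y = w
    · left; rw [hyw]; exact hww
    by_cases hyw' : y = w'
    · right; rw [hyw']; exact hww2
    exfalso
    by_cases hql : q = l
    · exact hqy (hql ▸ h0 y hy hyw hyw')
    by_cases hqm : q = n
    · exact hqy (hqm ▸ h0n y hy hyw hyw')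
    exact hq (hm0 q hql hqm)
  · have hne := hne2 hnb
    have ha := (Y.fam.norm_le_of_half_le hφ.isPot hws h1 hc0 hhalf.ge).resolve_right
      (fun h => hne h.1)
    have hdeg : (nb s v w).card = 2 := by omega
    have ha3 : v w ⬝ᵥ v w = 3 := by omega
    obtain ⟨m, hml, hmn, hm1, hm0⟩ : ∃ m, m ≠ l ∧ m ≠ n ∧ v w m ^ 2 = 1 ∧
        ∀ q, q ≠ l → q ≠ n → q ≠ m → v w q = 0 := by
      obtain ⟨m, n', g1, g2, g3, g4, g5, g6⟩ := exists_coord_of_norm_three ha3 h1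
      by_cases hnm : n = m
      · subst hnm
        exact ⟨n', g2, g3.symm, g5, g6⟩
      · have : n = n' := by
          by_contra h
          exact hn0 (g6 n hnl hnm h)
        subst this
        exact ⟨m, g1, g3, g4, fun q a b c => g6 q a c b⟩
    have hdot : ∀ y, v w ⬝ᵥ v y = v w l * v y l + v w n * v y n + v w m * v y m :=
      fun y => dot_of_support_triple hnl hml hmn.symm hm0
    obtain ⟨u, u', huu', hnb2⟩ := card_eq_two.1 hdeg
    have hu : u ∈ nb s v w := by rw [hnb2]; simp
    have hu' : u' ∈ nb s v w := by rw [hnb2]; simp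
    have hm1' : ∀ y ∈ nb s v w, v y m ^ 2 = 1 := by
      intro y hy
      have h := hdot y
      have hyw := Y.fam.ne_of_mem_nb hws hy
      have hyw' : y ≠ w' := fun h => hw'nb (h ▸ hy)
      rw [(mem_nb.1 hy).2, h0 y (nb_subset hy) hyw hyw', h0n y (nb_subset hy) hyw hyw'] at h
      have : (v w m * v y m) ^ 2 = 1 := by
        rw [show v w m * v y m = -1 by linarith]; norm_num
      rwa [mul_pow, hm1, one_mul] at this
    have hm0' : ∀ y ∈ s, y ≠ w → y ∉ nb s v w → v y m = 0 := by
      intro y hy hyw hy'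
      have h := hdot y
      rw [Y.fam.dot_eq_zero hws hy hyw hy'] at h
      have h4 : v w m * v y m = 0 := by
        by_cases hyw' : y = w'
        · rw [hyw', hsn, e1', ← e1] at h
          rw [hyw']
          linarith
        · rw [h0 y hy hyw hyw', h0n y hy hyw hyw'] at h
          linarith
      exact (mul_eq_zero.1 h4).resolve_left (ne_zero_of_sq_eq_one hm1)
    obtain ⟨χ, hχ⟩ := Y.full m (Y.mem_of_ne_zero hws (ne_zero_of_sq_eq_one hm1))
    -- The coordinates of `e_m` at `w` and `w'` are equal and add up to `0`.
    have hχw : χ w = 0 := by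
      have h5 := Y.sum_block hχ hl hml
      rw [hcol, sum_pair hww'] at h5
      linarith [key m χ hχ hmn]
    have harm := Y.fam.arms_closed hws hu hu' huu' (hm1' u hu) (hm1' u' hu')
      (fun y hy h1 h2 h3 => hm0' y hy h1 (by rw [hnb2]; simp [h2, h3])) (hχ.of_erase_eq_zero hχw)
    intro x hx y hy hm
    by_cases hxw : x = w
    · subst hxw
      obtain ⟨q, hq, hqy⟩ := hm
      by_cases hyw : y = x
      · left; rw [hyw]; exact hww
      by_cases hyw' : y = w'
      · right; rw [hyw']; exact hww2
      by_cases hyn : y ∈ nb s v x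
      · left; exact mem_comp.2 ⟨hy, Conn.of_mem_nb hyn⟩
      exfalso
      by_cases hql : q = l
      · exact hqy (hql ▸ h0 y hy hyw hyw')
      by_cases hqn : q = n
      · exact hqy (hqn ▸ h0n y hy hyw hyw')
      by_cases hqm : q = m
      · exact hqy (hqm ▸ hm0' y hy hyw hyn)
      exact hq (hm0 q hql hqn hqm)
    · exact Or.inl (harm x hx hxw y hy hm)

/-- Two linked vectors hit together by a further basis vector, with opposite signs and without
others, fill up the whole family with their components. -/
theorem card_le_two_of_double (hl : t l ≠ 0) (hww' : w ≠ w') (hcol : col s v l = {w, w'})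
    (hnl : n ≠ l) (h1n : v w n ^ 2 = 1) (hsn : v w' n = -v w n) (hcoln : col s v n = {w, w'}) :
    T.card ≤ 2 := by
  have h1 := Y.closed_of_double hl hww' hcol hnl h1n hsn hcoln
  have h2 := Y.closed_of_double hl hww'.symm (by rw [hcol, pair_comm]) hnl
    (by rw [hsn, neg_sq, h1n]) (by rw [hsn, neg_neg]) (by rw [hcoln, pair_comm])
  have hsub := Y.subset_of_closed (A := {w, w'}) (by rw [← hcol]; exact Y.col_subset hl) (by simp)
    (by
      intro a ha x hx y hy hm
      rcases mem_insert.1 ha with rfl | ha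
      · rcases h1 x hx y hy hm with h | h
        · exact ⟨a, by simp, h⟩
        · exact ⟨w', by simp, h⟩
      · rw [mem_singleton.1 ha] at hx
        rcases h2 x hx y hy hm with h | h
        · exact ⟨w', by simp, h⟩
        · exact ⟨w, by simp, h⟩)
  exact (card_le_card hsub).trans card_le_two

end Sys

end

/-! ### Contraction of a leaf of norm two in a system. -/

section

variable {s T : Finset ι} {K : Finset κ} {t : κ → ℤ} {v : ι → κ → ℤ} {pos : ι → ℤ} {φ ψ : ι → ℚ}
  {i j u u' w w' x y z : ι} {k l m n q : κ}

/-- The coefficient of the removed vector is traded for others: by `contr_comb`, `v i` without its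
`e_k` part is a combination of the contracted family. -/
theorem InSpan.contr (h0 : ∀ y ∈ s, y ≠ i → y ≠ j → v y k = 0) (hi : i ∈ s)
    (hk : InSpan s v k φ) (hφi : φ i ≠ 0) (hqk : q ≠ k) (hq : InSpan s v q ψ) :
    InSpan (s.erase i) (dropCoord v j k) q (fun y => ψ y - ψ i * (φ y / φ i)) := by
  intro p
  have h1 := contr_comb h0 hi hk hφi p
  simp only [sub_mul, sum_sub_distrib, mul_assoc (ψ i)]
  rw [← mul_sum, h1]
  by_cases hp : p = k
  · subst hp
    rw [if_neg hqk.symm, sum_eq_zero fun y hy => ?_]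
    · simp
    · by_cases hyj : y = j
      · rw [hyj, contr_self_apply]; simp
      · rw [contr_of_ne hyj, h0 y (mem_of_mem_erase hy) (ne_of_mem_erase hy) hyj]; simp
  · rw [← hq p, ← add_sum_erase s _ hi]
    simp only [contr_apply_of_ne hp, Pi.neg_apply, Function.update_of_ne hp]
    push_cast
    ring

namespace Sys

variable (Y : Sys s v pos K t T)
include Y

/-- Contraction of a leaf of norm `2` that shares a basis vector with just one other vector. -/
theorem contr (hi : i ∈ s) (hj : j ∈ s) (hij : i ≠ j) (hkK : k ∈ K)
    (h0 : ∀ y ∈ s, y ≠ i → y ≠ j → v y k = 0) (h1i : v i k ^ 2 = 1) (h1j : v j k ^ 2 = 1)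
    (h2i : v i ⬝ᵥ v i = 2) (h3j : 3 ≤ v j ⬝ᵥ v j) (hnb : nb s v i = {u}) (huj : u ≠ j)
    (htk : t k = (t ⬝ᵥ v i) * v i k) :
    Sys (s.erase i) (dropCoord v j k) pos (K.erase k) (t - (t ⬝ᵥ v i) • v i)
      (T.image fun x => if x = i then u else x) ∧
    (T.image fun x => if x = i then u else x).card = T.card := by
  have hu : u ∈ nb s v i := by rw [hnb]; simp
  have hus := nb_subset hu
  have hui := Y.fam.ne_of_mem_nb hi hu
  have hus' : u ∈ s.erase i := mem_erase.2 ⟨hui, hus⟩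
  obtain ⟨φ, hφ⟩ := Y.full k hkK
  -- Otherwise `e_k` would be in the span without `i`, hitting only `j`, and `j` would have norm
  -- `2`.
  have hφi : φ i ≠ 0 := by
    intro h
    have := ((Y.fam.mono (erase_subset i s)).of_column_single (mem_erase.2 ⟨hij.symm, hj⟩)
      (hφ.of_erase_eq_zero h) h1j fun y hy hyj =>
        h0 y (mem_of_mem_erase hy) (ne_of_mem_erase hy) hyj).1
    omega
  obtain ⟨m, hmk, hm1, hm0⟩ := exists_coord_of_norm_two h2i h1i
  have hdot : ∀ y, v i ⬝ᵥ v y = v i k * v y k + v i m * v y m := fun y =>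
    dot_of_support_pair hmk hm0
  have hjnb : j ∉ nb s v i := by rw [hnb]; simpa using huj.symm
  have hjm : v j m ≠ 0 := by
    intro h
    have h2 := hdot j
    rw [Y.fam.dot_eq_zero hi hj hij.symm hjnb, h, mul_zero, add_zero] at h2
    exact mul_ne_zero (ne_zero_of_sq_eq_one h1i) (ne_zero_of_sq_eq_one h1j) h2.symm
  have hum : v u m ≠ 0 := by
    intro h
    have h2 := hdot u
    rw [(mem_nb.1 hu).2, h0 u hus hui huj, h] at h2
    norm_num at h2
  have hym : ∀ y ∈ s, y ≠ i → y ≠ u → y ≠ j → v y m = 0 := by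
    intro y hy hyi hyu hyj
    have h2 := hdot y
    rw [Y.fam.dot_eq_zero hi hy hyi (by rw [hnb]; simpa using hyu), h0 y hy hyi hyj] at h2
    have : v i m * v y m = 0 := by linarith
    exact (mul_eq_zero.1 this).resolve_left (ne_zero_of_sq_eq_one hm1)
  have hstep : ∀ a ∈ s, a ≠ i → ∀ b ∈ nb s v a, b ≠ i →
      b ∈ nb (s.erase i) (dropCoord v j k) a := by
    intro a ha hai b hb hbi
    rw [nb_contr h0 h1j h3j (mem_erase.2 ⟨hai, ha⟩)]
    exact mem_erase.2 ⟨hbi, hb⟩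
  have hmap : ∀ x ∈ s, (if x = i then u else x) ∈ s.erase i := by
    intro x hx
    split_ifs with h
    · exact hus'
    · exact mem_erase.2 ⟨h, hx⟩
  have hmapc : ∀ x, Conn s v x (if x = i then u else x) := by
    intro x
    split_ifs with h
    · rw [h]; exact Conn.of_mem_nb hu
    · exact Conn.refl
  have hsep : ∀ a ∈ T, ∀ b ∈ T, Conn s v (if a = i then u else a) (if b = i then u else b) →
      a = b := by
    intro a ha b hb hc
    refine Y.sep a ha b hb (((hmapc a).trans hc).trans ((hmapc b).symm (Y.subset hb)))
  -- Subtracting this multiple of `v i` clears the coordinate `k` and, when `i` is linked, passes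
  -- the link on to its neighbour `u`.
  have htk0 : (t - (t ⬝ᵥ v i) • v i) k = 0 := by
    simp only [Pi.sub_apply, Pi.smul_apply, smul_eq_mul]
    rw [htk, sub_self]
  have htdot : ∀ y, (t - (t ⬝ᵥ v i) • v i) ⬝ᵥ dropCoord v j k y
      = t ⬝ᵥ v y - (t ⬝ᵥ v i) * (v i ⬝ᵥ v y) := by
    intro y
    rw [← smul_eq_mul (t ⬝ᵥ v i), ← smul_dotProduct, ← sub_dotProduct]
    refine sum_congr rfl fun q _ => ?_
    by_cases hq : q = k
    · rw [hq, htk0, zero_mul, zero_mul]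
    · rw [contr_apply_of_ne hq]
  refine ⟨⟨Y.fam.contr h0 h1j h3j, ?_, ?_, ?_, ?_, ?_, ?_, ?_, ?_, ?_, ?_⟩, ?_⟩
  · intro x hx
    obtain ⟨a, ha, rfl⟩ := mem_image.1 hx
    exact hmap a (Y.subset ha)
  · intro q hq
    obtain ⟨ψ, hψ⟩ := Y.full q (mem_of_mem_erase hq)
    exact ⟨_, hφ.contr h0 hi hφi (ne_of_mem_erase hq) hψ⟩
  · intro y hy q hq
    have hy' := mem_erase.1 hy
    by_cases hqk : q = k
    · subst hqk
      by_cases hyj : y = j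
      · rw [hyj, contr_self_apply]
      · rw [contr_of_ne hyj, h0 y hy'.2 hy'.1 hyj]
    · rw [contr_apply_of_ne hqk]
      exact Y.supp y hy'.2 q fun h => hq (mem_erase.2 ⟨hqk, h⟩)
  · intro q hq
    by_cases hqk : q = k
    · rw [hqk, htk0]
    · have hqK : q ∉ K := fun h => hq (mem_erase.2 ⟨hqk, h⟩)
      simp [Y.tsupp q hqK, Y.supp i hi q hqK]
  · intro x hx
    obtain ⟨a, ha, rfl⟩ := mem_image.1 hx
    rw [htdot]
    split_ifs with h
    · subst h
      have huT : u ∉ T := fun h => hui (Y.sep _ h _ ha ((Conn.of_mem_nb hu).symm hi))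
      rw [Y.one _ ha, Y.zero u hus huT, (mem_nb.1 hu).2]
      norm_num
    · rw [Y.one a ha]
      by_cases hiT : i ∈ T
      · have hc := Y.not_conn hiT ha (fun h' => h h'.symm)
        rw [Y.fam.dot_eq_zero hi (Y.subset ha) h fun h' => hc (Conn.of_mem_nb h')]
        simp
      · rw [Y.zero i hi hiT]; simp
  · intro y hy hyT
    have hy' := mem_erase.1 hy
    have hyT' : y ∉ T := fun h => hyT (mem_image.2 ⟨y, h, if_neg hy'.1⟩)
    rw [htdot, Y.zero y hy'.2 hyT']
    by_cases hiT : i ∈ T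
    · have hyu : y ≠ u := fun h => hyT (mem_image.2 ⟨i, hiT, by rw [if_pos rfl, h]⟩)
      rw [Y.fam.dot_eq_zero hi hy'.2 hy'.1 (by rw [hnb]; simpa using hyu)]
      simp
    · rw [Y.zero i hi hiT]; simp
  · intro a' ha' b' hb' hc
    obtain ⟨a, ha, rfl⟩ := mem_image.1 ha'
    obtain ⟨b, hb, rfl⟩ := mem_image.1 hb'
    rw [hsep a ha b hb (hc.of_contr h0 h1j h3j (hmap a (Y.subset ha)))]
  · intro x hx
    have hx' := mem_erase.1 hx
    obtain ⟨a, ha, hc⟩ := Y.cover x hx'.2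
    refine ⟨_, mem_image_of_mem _ ha, ?_⟩
    have := Conn.remove_leaf hstep hi hnb.subset hui hx'.2 hc
    rwa [if_neg hx'.1] at this
  · intro B hB hne hcl
    have hmeet : ∀ x ∈ B, ∀ y ∈ s, y ≠ i → Meet v x y → y ∈ B := by
      rintro x hx y hy hyi ⟨q, hqx, hqy⟩
      have hx' := mem_erase.1 (hB hx)
      by_cases hqk : q = k
      · subst hqk
        have h1 : x = j := by
          by_contra h
          exact hqx (h0 x hx'.2 hx'.1 h)
        have h2 : y = j := by
          by_contra h
          exact hqy (h0 y hy hyi h)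
        rwa [h2, ← h1]
      · exact hcl x hx y (mem_erase.2 ⟨hyi, hy⟩)
          ⟨q, by rwa [contr_apply_of_ne hqk], by rwa [contr_apply_of_ne hqk]⟩
    have hmi : ∀ y ∈ s, y ≠ i → (∃ q, v i q ≠ 0 ∧ v y q ≠ 0) → y = u ∨ y = j := by
      rintro y hy hyi ⟨q, hqi, hqy⟩
      by_contra! hcon
      by_cases hqk : q = k
      · exact hqy (hqk ▸ h0 y hy hyi hcon.2)
      by_cases hqm : q = m
      · exact hqy (hqm ▸ hym y hy hyi hcon.1 hcon.2)
      exact hqi (hm0 q hqk hqm)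
    -- The vectors `u` and `j` share `e_m` and are the only others meeting `v i`. So a closed set
    -- `B` of the contracted family contains both or neither, and is closed in the old family with
    -- or without `i` accordingly.
    have huB : u ∈ B ↔ j ∈ B := ⟨fun h => hmeet u h j hj hij.symm ⟨m, hum, hjm⟩,
      fun h => hmeet j h u hus hui ⟨m, hjm, hum⟩⟩
    by_cases huB' : u ∈ B
    · have := Y.irr (insert i B) (insert_subset hi (hB.trans (erase_subset _ _)))
        (insert_nonempty _ _) (by
          intro x hx y hy hm
          by_cases hyi : y = i
          · rw [hyi]; exact mem_insert_self _ _
          refine mem_insert_of_mem ?_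
          rcases mem_insert.1 hx with rfl | hx
          · rcases hmi y hy hyi hm with rfl | rfl
            · exact huB'
            · exact huB.1 huB'
          · exact hmeet x hx y hy hyi hm)
      rw [← this, erase_insert fun h => notMem_erase _ _ (hB h)]
    · have := Y.irr B (hB.trans (erase_subset _ _)) hne (by
          intro x hx y hy hm
          have hx' := mem_erase.1 (hB hx)
          by_cases hyi : y = i
          · exfalso
            obtain ⟨q, h1, h2⟩ := hm
            rcases hmi x hx'.2 hx'.1 ⟨q, hyi ▸ h2, h1⟩ with rfl | rfl
            · exact huB' hx
            · exact huB' (huB.2 hx)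
          · exact hmeet x hx y hy hyi hm)
      exact absurd (hB (this ▸ hi)) (notMem_erase _ _)
  -- The norms lose `2` with `i` and `1` at `j`, matching the loss of one basis vector, which counts
  -- `3`.
  · have hcard : (T.image fun x => if x = i then u else x).card ≤ T.card := card_image_le
    have hs := Y.count
    rw [← add_sum_erase s _ hi, h2i] at hs
    have hjs : j ∈ s.erase i := mem_erase.2 ⟨hij.symm, hj⟩
    rw [← add_sum_erase _ _ hjs] at hs ⊢
    rw [contr_dot h0 h1j hjs hjs, if_pos ⟨rfl, rfl⟩, card_erase_of_mem hkK,
      sum_congr rfl fun y hy => by rw [contr_of_ne (ne_of_mem_erase hy)]]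
    have : 1 ≤ K.card := card_pos.2 ⟨k, hkK⟩
    push_cast [this]
    have h4 : ((T.image fun x => if x = i then u else x).card : ℤ) ≤ T.card := by exact_mod_cast hcard
    linarith
  · refine card_image_of_injOn fun a ha b hb hab => hsep a ha b hb ?_
    rw [hab]
    exact Conn.refl

end Sys

end

/-! ### Signs of columns, and the position of the linked vertex. -/

section

variable {s T : Finset ι} {K : Finset κ} {t : κ → ℤ} {v v' : ι → κ → ℤ} {pos : ι → ℤ} {φ ψ : ι → ℚ}
  {i j u u' w w' x y z : ι} {k l m n q : κ}

theorem nb_congr (h : ∀ y ∈ s, ∀ z ∈ s, v' y ⬝ᵥ v' z = v y ⬝ᵥ v z) (hy : y ∈ s) :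
    nb s v' y = nb s v y :=
  filter_congr fun z hz => by rw [h y hy z hz]

theorem Fam.congr (F : Fam s v pos) (h : ∀ y ∈ s, ∀ z ∈ s, v' y ⬝ᵥ v' z = v y ⬝ᵥ v z) :
    Fam s v' pos := by
  refine ⟨F.inj, fun y hy => ?_, fun y hy z hz hne => ?_, fun y hy z hz hd => ?_⟩
  · rw [h y hy y hy]; exact F.diag y hy
  · rw [h y hy z hz]; exact F.off y hy z hz hne
  · rw [h y hy z hz] at hd; exact F.near y hy z hz hd

/-- The version of `Fam.exists_twin` for a basis vector hitting with opposite signs. -/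
theorem Fam.exists_twin_neg (F : Fam s v pos) (hi : i ∈ s) (hj : j ∈ s)
    (hnc : ¬ Conn s v i j) (h1 : v i k ^ 2 = 1) (hs : v j k = -v i k)
    (h0 : ∀ y ∈ s, y ≠ i → y ≠ j → v y k = 0) (hk : InSpan s v k φ) (h3i : 3 ≤ v i ⬝ᵥ v i)
    (h3j : 3 ≤ v j ⬝ᵥ v j) :
    ∃ n, n ≠ k ∧ v i n ^ 2 = 1 ∧ v j n = v i n ∧ (∀ y ∈ s, y ≠ i → y ≠ j → v y n = 0) ∧
      (nb s v i).card = 2 ∧ (nb s v j).card = 2 ∧ ∃ χ, InSpan s v n χ := by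
  -- Reversing all vectors of the component of `j` preserves the Gram matrix and turns opposite
  -- signs at `i` and `j` into equal ones.
  set ε : ι → ℤ := fun y => if y ∈ comp s v j then -1 else 1 with hε
  have hε2 : ∀ y, ε y * ε y = 1 := fun y => by simp only [hε]; split_ifs <;> norm_num
  have hεj : ε j = -1 := if_pos (mem_comp_self hj)
  have hεi : ε i = 1 := if_neg fun h => hnc ((mem_comp.1 h).2.symm hj)
  have hdot : ∀ y ∈ s, ∀ z ∈ s, (ε y • v y) ⬝ᵥ (ε z • v z) = v y ⬝ᵥ v z := by
    intro y hy z hz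
    rw [smul_dotProduct, dotProduct_smul, smul_eq_mul, smul_eq_mul]
    by_cases hz' : z ∈ nb s v y
    · have : ε y = ε z := by
        have : y ∈ comp s v j ↔ z ∈ comp s v j :=
          ⟨fun h => comp_closed y h hz', fun h => comp_closed z h (mem_nb_comm hy hz')⟩
        simp only [hε, this]
      rw [this, ← mul_assoc, hε2, one_mul]
    · by_cases hzy : z = y
      · rw [hzy, ← mul_assoc, hε2, one_mul]
      · rw [F.dot_eq_zero hy hz hzy hz']; simp
  have hspan : ∀ {q : κ} {χ : ι → ℚ} (v₀ : ι → κ → ℤ), InSpan s v₀ q χ →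
      InSpan s (fun y => ε y • v₀ y) q fun y => ε y * χ y := by
    intro q χ v₀ hχ p
    rw [← hχ p]
    refine sum_congr rfl fun y _ => ?_
    have : (ε y : ℚ) * ε y = 1 := by exact_mod_cast hε2 y
    simp only [Pi.smul_apply, smul_eq_mul]
    push_cast
    linear_combination (χ y * v₀ y p) * this
  have hnb : ∀ a ∈ s, nb s (fun y => ε y • v y) a ⊆ nb s v a := fun a ha =>
    (nb_congr hdot ha).subset
  obtain ⟨n, a1, a2, a3, a4, a5, a6, χ, hχ⟩ := (F.congr hdot).exists_twin hi hj
    (fun h => hnc (h.mono hnb hi)) (k := k)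
    (by simp only [Pi.smul_apply, smul_eq_mul, hεi, one_mul, h1])
    (by simp only [Pi.smul_apply, smul_eq_mul, hεi, hεj, hs]; ring)
    (fun y hy h1 h2 => by simp only [Pi.smul_apply, smul_eq_mul, h0 y hy h1 h2, mul_zero])
    (hspan v hk) (by rw [hdot i hi i hi]; exact h3i) (by rw [hdot j hj j hj]; exact h3j)
  simp only [Pi.smul_apply, smul_eq_mul, hεi, hεj, one_mul] at a2 a3 a4
  rw [nb_congr hdot hi] at a5
  rw [nb_congr hdot hj] at a6
  refine ⟨n, a1, a2, by linarith, fun y hy h1 h2 => ?_, a5, a6, fun y => ε y * χ y, ?_⟩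
  · refine (mul_eq_zero.1 (a4 y hy h1 h2)).resolve_left fun h => ?_
    have := hε2 y
    rw [h] at this
    norm_num at this
  · have := hspan _ hχ
    have hv : (fun y => ε y • ε y • v y) = v := by
      funext y
      rw [smul_smul, hε2, one_smul]
    rwa [hv] at this

/-- The potential of a point source strictly decreases away from the source. -/
theorem Fam.point_source_side (F : Fam s v pos) {g : ι → ℚ}
    (hg : IsPot s v (fun y => if y = w then 1 else 0) g) (hi : i ∈ s)
    (hij : i ≠ j) (hpos : 0 < g j) (hle : g j ≤ g i) :
    w ≠ j ∧ (pos j < pos w ↔ pos j < pos i) := by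
  by_contra hcon
  -- The part of `{g ≥ g j}` on the side of `j` containing `i`. If the claim fails, it does not
  -- contain the source, although it sends a nonnegative flux to `j`.
  set A := s.filter fun y => y ≠ j ∧ g j ≤ g y ∧ (pos j < pos y ↔ pos j < pos i) with hA
  have hwA : w ∉ A := by
    intro h
    rw [hA, mem_filter] at h
    exact hcon ⟨h.2.1, h.2.2.2⟩
  have hflux := F.flux_to (A := A) (z := j) hg (filter_subset _ _)
    ⟨i, mem_filter.2 ⟨hi, hij, hle, Iff.rfl⟩⟩ (by simp [hA])
    (fun y hy => hpos.trans_le (mem_filter.1 hy).2.2.1)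
    (by
      intro y hy x hx hxA hxj
      have hy' := mem_filter.1 hy
      have hpx := F.pos_nb hy'.1 hx
      have hyj : pos y ≠ pos j := fun h => hy'.2.1 (F.inj h)
      have hxj' : pos x ≠ pos j := fun h => hxj (F.inj h)
      by_contra! hlt
      refine hxA (mem_filter.2 ⟨nb_subset hx, hxj, hy'.2.2.1.trans hlt, ?_⟩)
      rw [← hy'.2.2.2]
      omega)
  have h1 : ∑ y ∈ A, ((if y = w then (1 : ℤ) else 0 : ℤ) : ℚ) = 0 :=
    sum_eq_zero fun y hy => by
    rw [if_neg (ne_of_mem_of_not_mem hy hwA)]; simp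
  rw [h1] at hflux
  refine absurd hflux (not_lt.2 (sum_nonneg fun y hy => ?_))
  have := (mem_filter.1 (mem_filter.1 hy).1).2.2.1
  linarith

/-- By `point_source_side` used from both ends, the source is on the same side of `j` as `i` and on
the same side of `i` as `j`. -/
theorem Fam.between_of_eq (F : Fam s v pos) (hw : w ∈ s) (hi : i ∈ s) (hj : j ∈ s) (hij : i ≠ j)
    (hwi : Conn s v w i) (hwj : Conn s v w j) {g : ι → ℚ}
    (hg : IsPot s v (fun y => if y = w then 1 else 0) g) (heq : g i = g j) :
    pos i < pos w ∧ pos w < pos j ∨ pos j < pos w ∧ pos w < pos i := by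
  have hp := F.point_source hg hw (by simp) (fun y _ h => if_neg h)
  have hpi := (hp i (mem_comp.2 ⟨hi, hwi⟩)).1
  have hpj := (hp j (mem_comp.2 ⟨hj, hwj⟩)).1
  simp only [if_true, Int.cast_one, one_mul] at hpi hpj
  have h1 := F.point_source_side hg hi hij hpj heq.ge
  have h2 := F.point_source_side hg hj hij.symm hpi heq.le
  have h3 : pos i ≠ pos j := fun h => hij (F.inj h)
  have h4 : pos w ≠ pos i := fun h => h2.1 (F.inj h)
  have h5 : pos w ≠ pos j := fun h => h1.1 (F.inj h)
  omega

namespace Sys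

variable (Y : Sys s v pos K t T)
include Y

/-- A basis vector not linked to `t` cannot hit all vectors with the same sign. -/
theorem exists_sign (hkK : k ∈ K) (htk : t k = 0) {ε : ℤ} (hε : ε = 1 ∨ ε = -1) :
    ∃ y ∈ s, ε * v y k < 0 := by
  by_contra! hcon
  obtain ⟨φ, hφ⟩ := Y.full k hkK
  have hε0 : (ε : ℚ) ≠ 0 := by rcases hε with h | h <;> rw [h] <;> norm_num
  -- If all signs agree, the signed potential is positive on every component hit by `e_k` and `0` on
  -- the others, so its sum over the block of a component that is hit cannot be `0`, against
  -- `sum_block`.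
  have hp : IsPot s v (fun y => ε * v y k) (fun y => ε * φ y) := by
    intro y hy
    have := hφ.isPot y hy
    simp only [mul_assoc, Int.cast_mul]
    rw [← mul_sum, this]
  have hval : ∀ w ∈ s, (∃ y ∈ comp s v w, v y k ≠ 0) → 0 < ε * φ w := by
    rintro w hw ⟨y, hy, hne⟩
    exact Y.fam.pos_of_source_nonneg hp comp_subset comp_closed
      (fun a ha b hb => comp_conn hw ha hb) (fun a ha => hcon a (comp_subset ha)) hy
      (mul_ne_zero (by exact_mod_cast hε0) hne) w (mem_comp_self hw)
  have hval0 : ∀ w ∈ s, (¬ ∃ y ∈ comp s v w, v y k ≠ 0) → ε * φ w = 0 := by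
    intro w hw hne
    push Not at hne
    refine Y.fam.eq_zero_of_source_eq_zero hp comp_subset comp_closed (fun a ha => ?_) w
      (mem_comp_self hw)
    rw [hne a ha, mul_zero]
  obtain ⟨i, hicol⟩ := hφ.col_nonempty
  obtain ⟨hi, hine⟩ := mem_col.1 hicol
  obtain ⟨w, hw, hc⟩ := Y.cover i hi
  have hws := Y.subset hw
  obtain ⟨l, hl, hwl, -⟩ := Y.link.2 w hw
  have hkl : k ≠ l := by rintro rfl; exact hl htk
  have h1 := Y.sum_block hφ hl hkl
  have h2 : 0 < ∑ y ∈ col s v l, (ε : ℚ) * φ y := by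
    refine sum_pos' (fun y hy => ?_) ⟨w, mem_col.2 ⟨hws, hwl⟩,
      hval w hws ⟨i, mem_comp.2 ⟨hi, hc.symm hi⟩, hine⟩⟩
    have hys := (mem_col.1 hy).1
    by_cases h : ∃ z ∈ comp s v y, v z k ≠ 0
    · exact (hval y hys h).le
    · exact (hval0 y hys h).ge
  rw [← mul_sum, h1, mul_zero] at h2
  exact lt_irrefl _ h2

/-- The coordinate of `e_k` at the linked vertex `w` of the component is `0` by `sum_block`, as
`e_k` hits no other component. By reciprocity the potential of a unit source at `w` has equal values
at `i` and `j`, so `w` lies between them. -/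
theorem between (htk : t k = 0) (hi : i ∈ s) (hj : j ∈ s) (hij : i ≠ j)
    (hc : Conn s v i j) (h1 : v i k ^ 2 = 1) (hs : v j k = -v i k)
    (h0 : ∀ y ∈ s, y ≠ i → y ≠ j → v y k = 0) (hφ : InSpan s v k φ) :
    ∃ w ∈ T, Conn s v i w ∧ φ w = 0 ∧
      (pos i < pos w ∧ pos w < pos j ∨ pos j < pos w ∧ pos w < pos i) := by
  obtain ⟨w, hw, hcw⟩ := Y.cover i hi
  have hws := Y.subset hw
  obtain ⟨l, hl, hwl, -⟩ := Y.link.2 w hw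
  have hkl : k ≠ l := by rintro rfl; exact hl htk
  have h2 := Y.sum_block hφ hl hkl
  have hφw : φ w = 0 := by
    rw [← h2, sum_eq_single_of_mem w (mem_col.2 ⟨hws, hwl⟩)]
    intro y hy hyw
    have hyT := Y.col_subset hl hy
    have hnc := Y.not_conn hyT hw hyw
    refine Y.fam.eq_zero_of_source_eq_zero hφ.isPot comp_subset comp_closed (fun a ha => ?_) y
      (mem_comp_self (Y.subset hyT))
    have ha' := mem_comp.1 ha
    refine h0 a ha'.1 ?_ ?_
    · rintro rfl; exact hnc (ha'.2.trans hcw)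
    · rintro rfl; exact hnc (ha'.2.trans ((hc.symm hi).trans hcw))
  obtain ⟨g, hg⟩ := Y.fam.exists_pot fun y => if y = w then (1 : ℤ) else 0
  have hrec := hφ.isPot.reciprocity hg
  have e1 : ∑ y ∈ s, ((if y = w then (1 : ℤ) else 0 : ℤ) : ℚ) * φ y = 0 := by
    rw [sum_eq_single_of_mem w hws fun y _ hy => by rw [if_neg hy]; simp, hφw, mul_zero]
  rw [e1, ← add_sum_erase s _ hi, ← add_sum_erase (s.erase i) _ (mem_erase.2 ⟨hij.symm, hj⟩),
    sum_eq_zero fun y hy => ?_, hs] at hrec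
  · have h3 : (v i k : ℚ) * (g i - g j) = 0 := by
      push_cast at hrec
      linarith
    have h4 : (v i k : ℚ) ≠ 0 := by exact_mod_cast ne_zero_of_sq_eq_one h1
    have h5 : g i = g j := by linarith [(mul_eq_zero.1 h3).resolve_left h4]
    exact ⟨w, hw, hcw, hφw, Y.fam.between_of_eq hws hi hj hij (hcw.symm hi)
      ((hcw.symm hi).trans hc) hg h5⟩
  · have hy1 := mem_erase.1 hy
    have hy2 := mem_erase.1 hy1.2
    rw [h0 y hy2.2 hy2.1 hy1.1]; simp

end Sys

end

/-! ### A minimal counterexample, and its basis vectors hitting two vectors. -/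

/-- A system with at least three components, such that all smaller ones have at most two. -/
structure MinSys (s : Finset ι) (v : ι → κ → ℤ) (pos : ι → ℤ) (K : Finset κ) (t : κ → ℤ)
    (T : Finset ι) : Prop extends Sys s v pos K t T where
  three_le : 3 ≤ T.card
  min : ∀ (s' : Finset ι) (v' : ι → κ → ℤ) (K' : Finset κ) (t' : κ → ℤ) (T' : Finset ι),
    s'.card < s.card → Sys s' v' pos K' t' T' → T'.card ≤ 2

/-- The basis vector `e_k` hits exactly the two vectors `i` and `j`, in the way possible for a
basis vector of the span. -/
structure PairCol (s : Finset ι) (v : ι → κ → ℤ) (t : κ → ℤ) (k : κ) (i j : ι) : Prop where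
  ne : i ≠ j
  col_eq : col s v k = {i, j}
  sq : v i k ^ 2 = 1
  sign : t k = 0 ∧ v j k = -v i k ∨ t k ≠ 0 ∧ v j k = v i k

/-- A component with three vectors `i`, `u`, `j`, whose ends `i` and `j` have norm `2` and are
supported on `{k, m}`. -/
structure ShortComp (s : Finset ι) (v : ι → κ → ℤ) (t : κ → ℤ) (T : Finset ι) (k : κ)
    (i j u : ι) (m : κ) : Prop where
  mem : u ∈ T
  ne : i ≠ j
  t_eq : t k = 0
  t_eq' : t m = 0
  col_eq : col s v k = {i, j}
  col_eq' : col s v m = {i, j, u}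
  sq : ∀ y ∈ col s v m, v y m ^ 2 = 1
  norm : v i ⬝ᵥ v i = 2
  norm' : v j ⬝ᵥ v j = 2
  supp : ∀ q, q ≠ k → q ≠ m → v i q = 0
  supp' : ∀ q, q ≠ k → q ≠ m → v j q = 0
  nb_eq : nb s v i = {u}
  nb_eq' : nb s v j = {u}
  nb_mid : nb s v u = {i, j}

/-- The pair hit by `e_k` contains a vector `i` of norm `2` with two neighbours, supported on
`{k, m}`. -/
structure InnerPair (s : Finset ι) (v : ι → κ → ℤ) (pos : ι → ℤ) (t : κ → ℤ) (T : Finset ι)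
    (k : κ) (i j : ι) (m : κ) : Prop where
  ne : i ≠ j
  ne_coord : m ≠ k
  t_eq : t m = 0
  col_eq : col s v k = {i, j}
  deg : (nb s v i).card = 2
  notMem : j ∉ nb s v i
  col_eq' : col s v m = insert i (insert j (nb s v i))
  sq : ∀ y ∈ col s v m, v y m ^ 2 = 1
  supp : ∀ q, q ≠ k → q ≠ m → v i q = 0
  between : Conn s v i j → ∃ w ∈ T, Conn s v i w ∧
    (pos i < pos w ∧ pos w < pos j ∨ pos j < pos w ∧ pos w < pos i)

section

variable {s T : Finset ι} {K : Finset κ} {t : κ → ℤ} {v v' : ι → κ → ℤ} {pos : ι → ℤ} {φ ψ : ι → ℚ}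
  {i j u u' w w' x y z : ι} {k l m n q : κ}

namespace PairCol

variable (P : PairCol s v t k i j)
include P

theorem left_mem : i ∈ s := (mem_col.1 (by rw [P.col_eq]; simp : i ∈ col s v k)).1

theorem right_mem : j ∈ s := (mem_col.1 (by rw [P.col_eq]; simp : j ∈ col s v k)).1

theorem sq' : v j k ^ 2 = 1 := by
  rcases P.sign with h | h <;> rw [h.2]
  · rw [neg_sq, P.sq]
  · exact P.sq

theorem zero : ∀ y ∈ s, y ≠ i → y ≠ j → v y k = 0 := fun y hy hi hj =>
  eq_zero_of_notMem_col hy (by rw [P.col_eq]; simp [hi, hj])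

theorem swap : PairCol s v t k j i := by
  refine ⟨P.ne.symm, by rw [P.col_eq, pair_comm], P.sq', ?_⟩
  rcases P.sign with h | h
  · exact Or.inl ⟨h.1, by rw [h.2, neg_neg]⟩
  · exact Or.inr ⟨h.1, h.2.symm⟩

end PairCol

namespace MinSys

variable (Y : MinSys s v pos K t T)
include Y

theorem col_of_pair (P : PairCol s v t k i j) : k ∈ K :=
  Y.mem_of_ne_zero P.left_mem (ne_zero_of_sq_eq_one P.sq)

theorem t_eq_of_pair (P : PairCol s v t k i j) (h : t k ≠ 0) :
    i ∈ T ∧ j ∈ T ∧ v i k = t k ∧ ¬ Conn s v i j := by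
  have hi : i ∈ col s v k := by rw [P.col_eq]; simp
  have hj : j ∈ col s v k := by rw [P.col_eq]; simp
  exact ⟨Y.col_subset h hi, Y.col_subset h hj, Y.eq_t h hi,
    Y.not_conn (Y.col_subset h hi) (Y.col_subset h hj) P.ne⟩

theorem pair_between (P : PairCol s v t k i j) (hc : Conn s v i j) :
    t k = 0 ∧ v j k = -v i k ∧ ∃ φ, InSpan s v k φ ∧ ∃ w ∈ T, Conn s v i w ∧ φ w = 0 ∧
      (pos i < pos w ∧ pos w < pos j ∨ pos j < pos w ∧ pos w < pos i) := by
  rcases P.sign with h | h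
  · obtain ⟨φ, hφ⟩ := Y.full k (Y.col_of_pair P)
    exact ⟨h.1, h.2, φ, hφ, Y.between h.1 P.left_mem P.right_mem P.ne hc P.sq h.2 P.zero hφ⟩
  · exact absurd hc (Y.t_eq_of_pair P h.1).2.2.2

/-- Neighbours have consecutive positions, which leaves no room for the linked vertex between them.
-/
theorem pair_notMem_nb (P : PairCol s v t k i j) : j ∉ nb s v i := by
  intro h
  obtain ⟨-, -, -, -, w, -, -, -, hpos⟩ := Y.pair_between P (Conn.of_mem_nb h)
  have := Y.fam.pos_nb P.left_mem h
  omega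

/-- Two vectors of the span cannot be hit by `e_k` and by `e_n` alone, with opposite signs for `k`
and equal signs for `n`. -/
theorem not_double (P : PairCol s v t k i j) (hs : v j k = -v i k) (hnk : n ≠ k)
    (hn1 : v i n ^ 2 = 1) (hn : v j n = v i n)
    (h0 : ∀ y ∈ s, y ≠ i → y ≠ j → v y n = 0) : False := by
  have hcol : col s v n = {i, j} := by
    ext y
    rw [mem_col, mem_insert, mem_singleton]
    constructor
    · rintro ⟨hy, hne⟩
      by_contra! hcon
      exact hne (h0 y hy hcon.1 hcon.2)
    · rintro (rfl | rfl)
      · exact ⟨P.left_mem, ne_zero_of_sq_eq_one hn1⟩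
      · exact ⟨P.right_mem, by rw [hn]; exact ne_zero_of_sq_eq_one hn1⟩
  -- An unlinked `e_n` would need both signs by `exists_sign`; a linked one would make `{i, j}` a
  -- block with a second column of opposite signs.
  by_cases htn : t n = 0
  · have hnK := Y.mem_of_ne_zero P.left_mem (ne_zero_of_sq_eq_one hn1)
    obtain ⟨y, hy, hlt⟩ := Y.exists_sign hnK htn (eq_one_or_of_sq_eq_one hn1)
    by_cases hyi : y = i
    · rw [hyi] at hlt; nlinarith
    by_cases hyj : y = j
    · rw [hyj, hn] at hlt; nlinarith
    rw [h0 y hy hyi hyj, mul_zero] at hlt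
    exact lt_irrefl _ hlt
  · have := Y.card_le_two_of_double htn P.ne hcol hnk.symm P.sq hs P.col_eq
    have := Y.three_le
    omega

/-- A twin gives a second column on `{i, j}` with the other relative sign, excluded by `not_double`
or `card_le_two_of_double`. -/
theorem not_three_le_of_not_conn (P : PairCol s v t k i j) (hnc : ¬ Conn s v i j)
    (h3i : 3 ≤ v i ⬝ᵥ v i) (h3j : 3 ≤ v j ⬝ᵥ v j) : False := by
  obtain ⟨φ, hφ⟩ := Y.full k (Y.col_of_pair P)
  rcases P.sign with h | h
  · obtain ⟨n, hnk, hn1, hn, h0, -⟩ := Y.fam.exists_twin_neg P.left_mem P.right_mem hnc P.sq h.2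
      P.zero hφ h3i h3j
    exact Y.not_double P h.2 hnk hn1 hn h0
  · obtain ⟨n, hnk, hn1, hn, h0, -⟩ := Y.fam.exists_twin P.left_mem P.right_mem hnc P.sq h.2
      P.zero hφ h3i h3j
    have hcol : col s v n = {i, j} := by
      ext y
      rw [mem_col, mem_insert, mem_singleton]
      constructor
      · rintro ⟨hy, hne⟩
        by_contra! hcon
        exact hne (h0 y hy hcon.1 hcon.2)
      · rintro (rfl | rfl)
        · exact ⟨P.left_mem, ne_zero_of_sq_eq_one hn1⟩
        · exact ⟨P.right_mem, by rw [hn]; exact neg_ne_zero.2 (ne_zero_of_sq_eq_one hn1)⟩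
    have := Y.card_le_two_of_double h.1 P.ne P.col_eq hnk hn1 hn hcol
    have := Y.three_le
    omega

/-- The linked vertex `w` between `i` and `j` has coordinate `0` in `e_k`. So `e_k` is in the span
without `w`, where `i` and `j` are disconnected and have a twin `e_n`. It remains to see that `e_n`
does not hit `w`. -/
theorem not_three_le_of_conn (P : PairCol s v t k i j) (hc : Conn s v i j)
    (h3i : 3 ≤ v i ⬝ᵥ v i) (h3j : 3 ≤ v j ⬝ᵥ v j) : False := by
  obtain ⟨-, hs, φ, hφ, w, hw, hcw, hφw, hpos⟩ := Y.pair_between P hc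
  have hws := Y.subset hw
  have F' := Y.fam.mono (erase_subset w s)
  have hiw : i ≠ w := by rintro rfl; omega
  have hjw : j ≠ w := by rintro rfl; omega
  have hi' : i ∈ s.erase w := mem_erase.2 ⟨hiw, P.left_mem⟩
  have hj' : j ∈ s.erase w := mem_erase.2 ⟨hjw, P.right_mem⟩
  have hnc : ¬ Conn (s.erase w) v i j := fun h => by
    have := F'.pos_lt_iff_of_conn (notMem_erase w s) hi' h
    omega
  obtain ⟨n, hnk, hn1, hn, h0, hdi, hdj, χ, hχ⟩ := F'.exists_twin_neg hi' hj' hnc P.sq hs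
    (fun y hy => P.zero y (mem_of_mem_erase hy)) (hφ.of_erase_eq_zero hφw) h3i h3j
  have hn1' : v j n ^ 2 = 1 := by rw [hn]; exact hn1
  have hE := hχ.energy_pair hi' hj' P.ne h0
  rw [hn] at hE
  have hci := column_eq_zero_of_mem_comp hnc h0
  have hcj := column_eq_zero_of_mem_comp (q := n) (fun h => hnc (h.symm hj'))
    fun y hy h1 h2 => h0 y hy h2 h1
  have hpi := F'.point_source hχ.isPot hi' hn1 hci
  have hpj := F'.point_source hχ.isPot hj' hn1' hcj
  rw [hn] at hpj
  have hposi := (hpi i (mem_comp_self hi')).1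
  have hposj := (hpj j (mem_comp_self hj')).1
  have hnot : ∀ a, (nb (s.erase w) v a).card = 2 → a ∈ s → a ∉ nb s v w := by
    intro a ha has hanb
    rw [nb_erase, card_erase_of_mem (mem_nb_comm hws hanb)] at ha
    have := Y.fam.card_nb_le has
    omega
  have hnoti := hnot i hdi P.left_mem
  have hnotj := hnot j hdj P.right_mem
  have hside : ∀ a ∈ s.erase w, (pos i < pos w ↔ pos a < pos w) → a ≠ i →
      0 ≤ (v i n : ℚ) * χ a ∧ (v i n : ℚ) * χ a < v i n * χ i := by
    intro a ha hsa hai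
    by_cases hca : Conn (s.erase w) v i a
    · have := hpi a (mem_comp.2 ⟨ha, hca⟩)
      exact ⟨this.1.le, this.2 hai⟩
    · have : χ a = 0 := by
        refine F'.eq_zero_of_source_eq_zero hχ.isPot comp_subset comp_closed (fun b hb => ?_) a
          (mem_comp_self ha)
        have hb' := mem_comp.1 hb
        refine h0 b hb'.1 ?_ ?_
        · rintro rfl; exact hca (hb'.2.symm ha)
        · rintro rfl
          have := F'.pos_lt_iff_of_conn (notMem_erase w s) ha hb'.2
          omega
      rw [this]
      simpa using hposi
  have hside' : ∀ a ∈ s.erase w, (pos j < pos w ↔ pos a < pos w) → a ≠ j →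
      0 ≤ (v i n : ℚ) * χ a ∧ (v i n : ℚ) * χ a < v i n * χ j := by
    intro a ha hsa hai
    by_cases hca : Conn (s.erase w) v j a
    · have := hpj a (mem_comp.2 ⟨ha, hca⟩)
      exact ⟨this.1.le, this.2 hai⟩
    · have : χ a = 0 := by
        refine F'.eq_zero_of_source_eq_zero hχ.isPot comp_subset comp_closed (fun b hb => ?_) a
          (mem_comp_self ha)
        have hb' := mem_comp.1 hb
        refine h0 b hb'.1 ?_ ?_
        · rintro rfl
          have := F'.pos_lt_iff_of_conn (notMem_erase w s) ha hb'.2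
          omega
        · rintro rfl; exact hca (hb'.2.symm ha)
      rw [this]
      simpa using hposj
  have hnbw : ∀ a ∈ nb s v w, a ∈ s.erase w ∧ a ≠ i ∧ a ≠ j := fun a ha =>
    ⟨mem_erase.2 ⟨Y.fam.ne_of_mem_nb hws ha, nb_subset ha⟩, by rintro rfl; exact hnoti ha,
      by rintro rfl; exact hnotj ha⟩
  have hone : ∀ a ∈ nb s v w, 0 ≤ (v i n : ℚ) * χ a ∧ (v i n : ℚ) * χ a < 1 := by
    intro a ha
    obtain ⟨h1, h2, h3⟩ := hnbw a ha
    by_cases h : pos i < pos w ↔ pos a < pos w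
    · have := hside a h1 h h2
      exact ⟨this.1, by linarith⟩
    · have := hside' a h1 (by omega) h3
      exact ⟨this.1, by linarith⟩
  -- The neighbours of `w` are neither `i` nor `j`, and two of them lie on different sides of `w`;
  -- so their signed potentials add up to less than those of `i` and `j`, that is, less than `1`.
  have hlt : ∑ a ∈ nb s v w, (v i n : ℚ) * χ a < 1 := by
    have hcard := Y.fam.card_nb_le hws
    interval_cases hc : (nb s v w).card
    · rw [card_eq_zero.1 hc]; simp
    · obtain ⟨a, ha⟩ := card_eq_one.1 hc
      rw [ha, sum_singleton]
      exact (hone a (by rw [ha]; simp)).2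
    · obtain ⟨a, b, hab, hnb⟩ := card_eq_two.1 hc
      have ha : a ∈ nb s v w := by rw [hnb]; simp
      have hb : b ∈ nb s v w := by rw [hnb]; simp
      have hpa := Y.fam.pos_nb hws ha
      have hpb := Y.fam.pos_nb hws hb
      have hpab : pos a ≠ pos b := fun h => hab (Y.fam.inj h)
      rw [hnb, sum_pair hab]
      obtain ⟨a1, a2, a3⟩ := hnbw a ha
      obtain ⟨b1, b2, b3⟩ := hnbw b hb
      by_cases h : pos i < pos w ↔ pos a < pos w
      · have := hside a a1 h a2
        have := hside' b b1 (by omega) b3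
        linarith
      · have := hside' a a1 (by omega) a3
        have := hside b b1 (by omega) b2
        linarith
  have hwn : (v w n : ℚ) = -∑ a ∈ nb s v w, χ a := by
    have hp : ∑ y ∈ s.erase w, χ y * ((v w ⬝ᵥ v y : ℤ) : ℚ) = v w n := by
      simp only [cast_dot]
      rw [← sum_comb_mul]
      rw [sum_eq_single n fun q _ hq => by rw [hχ q, if_neg hq, mul_zero]]
      · rw [hχ n, if_pos rfl, mul_one]
      · simp
    rw [← hp, ← sum_neg_distrib]
    symm
    refine sum_subset_zero_on_sdiff (fun a ha => (hnbw a ha).1) (fun a ha => ?_) fun a ha => ?_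
    · have ha' := mem_sdiff.1 ha
      rw [Y.fam.dot_eq_zero hws (mem_of_mem_erase ha'.1) (ne_of_mem_erase ha'.1) ha'.2]
      simp
    · rw [(mem_nb.1 ha).2]; push_cast; ring
  -- The integer `v i n * v w n` lies in the interval `(-1, 0]`.
  have hzero : v w n = 0 := by
    have h1 : ((v i n * v w n : ℤ) : ℚ) = -∑ a ∈ nb s v w, (v i n : ℚ) * χ a := by
      rw [← mul_sum]; push_cast; rw [hwn]; ring
    have h2 : 0 ≤ ∑ a ∈ nb s v w, (v i n : ℚ) * χ a := sum_nonneg fun a ha => (hone a ha).1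
    have h3 : v i n * v w n ≤ 0 := by
      have : ((v i n * v w n : ℤ) : ℚ) ≤ 0 := by linarith
      exact_mod_cast this
    have h4 : -1 < v i n * v w n := by
      have : (-1 : ℚ) < ((v i n * v w n : ℤ) : ℚ) := by linarith
      exact_mod_cast this
    have h5 : v i n * v w n = 0 := by omega
    exact (mul_eq_zero.1 h5).resolve_left (ne_zero_of_sq_eq_one hn1)
  refine Y.not_double P hs hnk hn1 hn fun y hy hyi hyj => ?_
  by_cases hyw : y = w
  · rw [hyw, hzero]
  · exact h0 y (mem_erase.2 ⟨hyw, hy⟩) hyi hyj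

/-- The possibilities for a pair containing a vector of norm `2`. -/
theorem pair_cases_of_norm_two (P : PairCol s v t k i j) (h2i : v i ⬝ᵥ v i = 2) :
    (∃ m, InnerPair s v pos t T k i j m) ∨ ∃ u m, ShortComp s v t T k i j u m := by
  have hi := P.left_mem
  have hj := P.right_mem
  have hij := P.ne
  have h0 := P.zero
  have hjnb := Y.pair_notMem_nb P
  have hki := ne_zero_of_sq_eq_one P.sq
  obtain ⟨m, hmk, hm1, hm0⟩ := exists_coord_of_norm_two h2i P.sq
  have hmi := ne_zero_of_sq_eq_one hm1
  have hdot : ∀ y, v i ⬝ᵥ v y = v i k * v y k + v i m * v y m := fun y =>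
    dot_of_support_pair hmk hm0
  have hjm : v j m = -(v i k * v j k * v i m) := by
    have h := hdot j
    rw [Y.fam.dot_eq_zero hi hj hij.symm hjnb] at h
    linear_combination (v i m) * (-h) - v j m * hm1
  have hjm1 : v j m ^ 2 = 1 := by
    rw [hjm, neg_sq, mul_pow, mul_pow, P.sq, P.sq', hm1]; norm_num
  have hnbm : ∀ y ∈ nb s v i, v y m ^ 2 = 1 := by
    intro y hy
    have h := hdot y
    rw [(mem_nb.1 hy).2, h0 y (nb_subset hy) (Y.fam.ne_of_mem_nb hi hy)
      (ne_of_mem_of_not_mem hy hjnb)] at h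
    have : (v i m * v y m) ^ 2 = 1 := by
      rw [show v i m * v y m = -1 by linarith]; norm_num
    rwa [mul_pow, hm1, one_mul] at this
  have hym : ∀ y ∈ s, y ≠ i → y ≠ j → y ∉ nb s v i → v y m = 0 := by
    intro y hy hyi hyj hyn
    have h := hdot y
    rw [Y.fam.dot_eq_zero hi hy hyi hyn, h0 y hy hyi hyj] at h
    have : v i m * v y m = 0 := by linarith
    exact (mul_eq_zero.1 this).resolve_left hmi
  have hcolm : col s v m = insert i (insert j (nb s v i)) := by
    ext y
    rw [mem_col, mem_insert, mem_insert]
    constructor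
    · rintro ⟨hy, hne⟩
      by_contra! hcon
      exact hne (hym y hy hcon.1 hcon.2.1 hcon.2.2)
    · rintro (rfl | rfl | h)
      · exact ⟨hi, hmi⟩
      · exact ⟨hj, ne_zero_of_sq_eq_one hjm1⟩
      · exact ⟨nb_subset h, ne_zero_of_sq_eq_one (hnbm y h)⟩
  have hsq : ∀ y ∈ col s v m, v y m ^ 2 = 1 := by
    intro y hy
    rw [hcolm, mem_insert, mem_insert] at hy
    rcases hy with rfl | rfl | h
    · exact hm1
    · exact hjm1
    · exact hnbm y h
  have hlabel : i ∈ T → t k = 0 → t m ≠ 0 := by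
    intro hiT htk
    obtain ⟨l, hl, hil, -⟩ := Y.link.2 i hiT
    have hlk : l ≠ k := by rintro rfl; exact hl htk
    have : l = m := by
      by_contra h
      exact hil (hm0 l hlk h)
    rwa [← this]
  have h3 := Y.three_le
  rcases (nb s v i).eq_empty_or_nonempty with hnb | ⟨u, hu⟩
  -- An isolated `i` makes `e_m` a second basis vector hitting just `i` and `j`, with the opposite
  -- relative sign.
  · exfalso
    have hcolm' : col s v m = {i, j} := by rw [hcolm, hnb, insert_empty_eq]
    have hiT : i ∈ T := by
      obtain ⟨w, hw, hc⟩ := Y.cover i hi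
      have : w ∈ ({i} : Finset ι) := Conn.mem_of_closed (s := s) (v := v) (by simp [hnb])
        (mem_singleton_self i) hc
      rwa [mem_singleton.1 this] at hw
    rcases P.sign with h | h
    · have := Y.card_le_two_of_double (hlabel hiT h.1) hij hcolm' hmk.symm P.sq h.2 P.col_eq
      omega
    · have hs : v j m = -v i m := by
        rw [hjm, h.2]
        linear_combination (-v i m) * P.sq
      have := Y.card_le_two_of_double h.1 hij P.col_eq hmk hm1 hs hcolm'
      omega
  have hus := nb_subset hu
  have hui := Y.fam.ne_of_mem_nb hi hu
  have huj : u ≠ j := ne_of_mem_of_not_mem hu hjnb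
  have htm : t m = 0 := by
    by_contra h
    have hiT := Y.col_subset h (by rw [hcolm]; simp : i ∈ col s v m)
    have huT := Y.col_subset h (by rw [hcolm]; simp [hu] : u ∈ col s v m)
    exact Y.not_conn hiT huT hui.symm (Conn.of_mem_nb hu)
  have hcard := Y.fam.card_nb_le hi
  have hcard1 : 1 ≤ (nb s v i).card := card_pos.2 ⟨u, hu⟩
  by_cases hdeg : (nb s v i).card = 2
  · left
    refine ⟨m, hij, hmk, htm, P.col_eq, hdeg, hjnb, hcolm, hsq, hm0, fun hc => ?_⟩
    obtain ⟨-, -, -, -, w, hw, hcw, -, hpos⟩ := Y.pair_between P hc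
    exact ⟨w, hw, hcw, hpos⟩
  right
  have hnb : nb s v i = {u} := by
    obtain ⟨a, ha⟩ := card_eq_one.1 (by omega : (nb s v i).card = 1)
    rw [ha] at hu ⊢
    rw [mem_singleton.1 hu]
  have htk : t k = (t ⬝ᵥ v i) * v i k := by
    rcases P.sign with h | h
    · have hiT : i ∉ T := fun hiT => hlabel hiT h.1 htm
      rw [Y.zero i hi hiT, h.1, zero_mul]
    · obtain ⟨hiT, -, hk, -⟩ := Y.t_eq_of_pair P h.1
      rw [Y.one i hiT, hk, one_mul]
  -- Minimality: for norm at least `3` at `j`, contracting the leaf `i` would give a smaller system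
  -- with equally many components.
  have h2j : v j ⬝ᵥ v j = 2 := by
    have := Y.fam.diag j hj
    by_contra hne
    obtain ⟨hY, hc⟩ := Y.toSys.contr hi hj hij (Y.col_of_pair P) h0 P.sq P.sq' h2i
      (by omega) hnb huj htk
    have := Y.min _ _ _ _ _ (card_erase_lt_of_mem hi) hY
    omega
  have hm0' : ∀ q, q ≠ k → q ≠ m → v j q = 0 := by
    obtain ⟨m', -, -, h⟩ := exists_coord_of_norm_two h2j P.sq'
    have : m = m' := by
      by_contra hne
      exact ne_zero_of_sq_eq_one hjm1 (h m hmk hne)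
    rw [this]
    exact h
  have hdotj : ∀ y, v j ⬝ᵥ v y = v j k * v y k + v j m * v y m := fun y =>
    dot_of_support_pair hmk hm0'
  have hujnb : u ∈ nb s v j := by
    by_contra h
    have h1 := hdotj u
    rw [Y.fam.dot_eq_zero hj hus huj h, h0 u hus hui huj] at h1
    have : v j m * v u m = 0 := by linarith
    rcases mul_eq_zero.1 this with h | h
    · exact ne_zero_of_sq_eq_one hjm1 h
    · exact ne_zero_of_sq_eq_one (hnbm u hu) h
  have hc : Conn s v i j := (Conn.of_mem_nb hu).trans (Conn.of_mem_nb (mem_nb_comm hj hujnb))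
  obtain ⟨htk0, -, -, -, w, hw, hcw, -, hpos⟩ := Y.pair_between P hc
  have hnbj : nb s v j = {u} := by
    refine eq_singleton_iff_unique_mem.2 ⟨hujnb, fun y hy => ?_⟩
    by_contra hyu
    have hyj := Y.fam.ne_of_mem_nb hj hy
    have hyi : y ≠ i := by
      rintro rfl
      exact hjnb (mem_nb_comm hj hy)
    have h1 := hdotj y
    rw [(mem_nb.1 hy).2, h0 y (nb_subset hy) hyi hyj, hym y (nb_subset hy) hyi hyj
      (by rw [hnb]; simpa using hyu)] at h1
    norm_num at h1
  have hnbu : nb s v u = {i, j} := by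
    symm
    refine eq_of_subset_of_card_le ?_ ?_
    · intro y hy
      rcases mem_insert.1 hy with rfl | hy
      · exact mem_nb_comm hi hu
      · rw [mem_singleton.1 hy]; exact mem_nb_comm hj hujnb
    · rw [card_pair hij]; exact Y.fam.card_nb_le hus
  -- The component is `{i, u, j}`, and its linked vertex lies strictly between `i` and `j`.
  have hwu : w = u := by
    have : w ∈ ({i, j, u} : Finset ι) := by
      refine Conn.mem_of_closed (s := s) (v := v) (fun x hx => ?_) (by simp) hcw
      simp only [mem_insert, mem_singleton] at hx
      rcases hx with rfl | rfl | rfl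
      · rw [hnb]; simp
      · rw [hnbj]; simp
      · rw [hnbu]
        exact insert_subset (by simp) (by simp)
    simp only [mem_insert, mem_singleton] at this
    rcases this with rfl | rfl | h
    · omega
    · omega
    · exact h
  exact ⟨u, m, hwu ▸ hw, hij, htk0, htm, P.col_eq, by rw [hcolm, hnb], hsq, h2i, h2j,
    hm0, hm0', hnb, hnbj, hnbu⟩

theorem pair_cases (P : PairCol s v t k i j) :
    (∃ i j m, InnerPair s v pos t T k i j m) ∨ ∃ i j u m, ShortComp s v t T k i j u m := by
  have h2i := Y.fam.diag i P.left_mem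
  have h2j := Y.fam.diag j P.right_mem
  by_cases hi : v i ⬝ᵥ v i = 2
  · rcases Y.pair_cases_of_norm_two P hi with ⟨m, h⟩ | ⟨u, m, h⟩
    · exact Or.inl ⟨i, j, m, h⟩
    · exact Or.inr ⟨i, j, u, m, h⟩
  by_cases hj : v j ⬝ᵥ v j = 2
  · rcases Y.pair_cases_of_norm_two P.swap hj with ⟨m, h⟩ | ⟨u, m, h⟩
    · exact Or.inl ⟨j, i, m, h⟩
    · exact Or.inr ⟨j, i, u, m, h⟩
  exfalso
  by_cases hc : Conn s v i j
  · exact Y.not_three_le_of_conn P hc (by omega) (by omega)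
  · exact Y.not_three_le_of_not_conn P hc (by omega) (by omega)

end MinSys

end

/-! ### Counting square sums of columns. -/

/-- The sum of the squares of the `q`-th coordinates of the family. -/
def sumSq (s : Finset ι) (v : ι → κ → ℤ) (q : κ) : ℤ := ∑ y ∈ s, v y q ^ 2

section

variable {s T : Finset ι} {K : Finset κ} {t : κ → ℤ} {v v' : ι → κ → ℤ} {pos : ι → ℤ}
  {h : ι → ℤ} {φ ψ : ι → ℚ} {i j i' j' u u' w w' x y z : ι} {k k' l l' m m' n q : κ}

theorem sumSq_eq_col : sumSq s v q = ∑ y ∈ col s v q, v y q ^ 2 := by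
  symm
  refine sum_subset (filter_subset _ _) fun y hy h => ?_
  rw [eq_zero_of_notMem_col hy h]; norm_num

theorem one_le_sq_of_mem_col (hy : y ∈ col s v q) : 1 ≤ v y q ^ 2 :=
  Int.add_one_le_of_lt (sq_pos_of_ne_zero (mem_col.1 hy).2)

theorem card_col_le : ((col s v q).card : ℤ) ≤ sumSq s v q := by
  rw [sumSq_eq_col, card_eq_sum_ones]
  push_cast
  exact sum_le_sum fun y hy => one_le_sq_of_mem_col hy

theorem sumSq_eq_card (h1 : ∀ y ∈ col s v q, v y q ^ 2 = 1) : sumSq s v q = (col s v q).card := by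
  rw [sumSq_eq_col, sum_congr rfl h1]; simp

/-- Excludes columns of square sum `3` with just two entries. -/
theorem sq_add_sq_ne_three (a b : ℤ) : a ^ 2 + b ^ 2 ≠ 3 := by
  intro h
  have h1 : a ≤ 1 := by nlinarith [sq_nonneg b]
  have h2 : -1 ≤ a := by nlinarith [sq_nonneg b]
  have h3 : b ≤ 1 := by nlinarith [sq_nonneg a]
  have h4 : -1 ≤ b := by nlinarith [sq_nonneg a]
  interval_cases a <;> interval_cases b <;> simp at h

namespace Sys

variable (Y : Sys s v pos K t T)
include Y

theorem label_eq (hw : w ∈ T) (hl : t l ≠ 0) (hl' : t l' ≠ 0) (h : v w l ≠ 0) (h' : v w l' ≠ 0) :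
    l = l' := by
  obtain ⟨q, -, -, hq⟩ := Y.link.2 w hw
  rw [hq l hl h, hq l' hl' h']

theorem sum_sumSq : ∑ q ∈ K, sumSq s v q = ∑ y ∈ s, v y ⬝ᵥ v y := by
  simp only [sumSq]
  rw [sum_comm]
  refine sum_congr rfl fun y hy => ?_
  rw [dot_self_eq]
  refine sum_subset (subset_univ _) fun q _ hq => ?_
  rw [Y.supp y hy q hq]; norm_num

theorem sumSq_of_t_ne_zero (hl : t l ≠ 0) : sumSq s v l = (col s v l).card :=
  sumSq_eq_card fun y hy => by rw [Y.eq_t hl hy, Y.t_sq hl]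

theorem sum_card_col : ∑ l ∈ K.filter (fun q => t q ≠ 0), (col s v l).card = T.card := by
  rw [← card_biUnion]
  · congr 1
    ext w
    rw [mem_biUnion]
    constructor
    · rintro ⟨l, hl, hw⟩
      exact Y.col_subset (mem_filter.1 hl).2 hw
    · intro hw
      obtain ⟨l, hl, hwl, -⟩ := Y.link.2 w hw
      exact ⟨l, mem_filter.2 ⟨Y.mem_of_t_ne_zero hl, hl⟩, mem_col.2 ⟨Y.subset hw, hwl⟩⟩
  · intro l hl l' hl' hne
    refine disjoint_left.2 fun w hw hw' => hne ?_
    have h1 := (mem_filter.1 hl).2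
    exact Y.label_eq (Y.col_subset h1 hw) h1 (mem_filter.1 hl').2 (mem_col.1 hw).2 (mem_col.1 hw').2

/-- Both signs occur by `exists_sign`; square sum `2` leaves exactly one entry of each. -/
theorem two_le_sumSq (hkK : k ∈ K) (htk : t k = 0) :
    2 ≤ sumSq s v k ∧ (sumSq s v k = 2 → ∃ i j, PairCol s v t k i j) := by
  obtain ⟨i, hi, hneg⟩ := Y.exists_sign hkK htk (Or.inl rfl)
  obtain ⟨j, hj, hpos⟩ := Y.exists_sign hkK htk (Or.inr rfl)
  rw [one_mul] at hneg
  have hij : i ≠ j := by rintro rfl; omega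
  have hj' : j ∈ s.erase i := mem_erase.2 ⟨hij.symm, hj⟩
  have hsum : sumSq s v k = v i k ^ 2 + (v j k ^ 2 + ∑ y ∈ (s.erase i).erase j, v y k ^ 2) := by
    rw [sumSq, ← add_sum_erase s _ hi, ← add_sum_erase _ _ hj']
  have hrest : 0 ≤ ∑ y ∈ (s.erase i).erase j, v y k ^ 2 := sum_nonneg fun y _ => sq_nonneg _
  have hi1 : 1 ≤ v i k ^ 2 := by nlinarith
  have hj1 : 1 ≤ v j k ^ 2 := by nlinarith
  refine ⟨by linarith, fun h2 => ⟨i, j, hij, ?_, by linarith, Or.inl ⟨htk, ?_⟩⟩⟩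
  · have h0 := (sum_eq_zero_iff_of_nonneg fun y _ => sq_nonneg (v y k)).1
      (by linarith : ∑ y ∈ (s.erase i).erase j, v y k ^ 2 = 0)
    ext y
    rw [mem_col, mem_insert, mem_singleton]
    constructor
    · rintro ⟨hy, hne⟩
      by_contra! hcon
      exact hne (pow_eq_zero_iff two_ne_zero |>.1
        (h0 y (mem_erase.2 ⟨hcon.2, mem_erase.2 ⟨hcon.1, hy⟩⟩)))
    · rintro (rfl | rfl)
      · exact ⟨hi, hneg.ne⟩
      · exact ⟨hj, fun h => by rw [h] at hpos; simp at hpos⟩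
  · have h1 : v i k = -1 := by nlinarith
    have h2 : v j k = 1 := by nlinarith
    rw [h1, h2]; norm_num

end Sys

theorem InnerPair.card_col (F : Fam s v pos) (Q : InnerPair s v pos t T k i j m) (hi : i ∈ s) :
    (col s v m).card = 4 := by
  rw [Q.col_eq', card_insert_of_notMem, card_insert_of_notMem Q.notMem, Q.deg]
  rw [mem_insert]
  rintro (h | h)
  · exact Q.ne h
  · exact F.ne_of_mem_nb hi h rfl

theorem InnerPair.left_mem (Q : InnerPair s v pos t T k i j m) : i ∈ col s v k := by
  rw [Q.col_eq]; simp

/-- Two inner pairs sharing `e_m` would occupy consecutive positions `j'`, `i`, `i'`, `j` of one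
component. Its linked vertex, strictly between `i` and `j`, would be `i'`, and strictly between `i'`
and `j'`, would be `i`. -/
theorem InnerPair.coord_eq (Y : Sys s v pos K t T) (Q : InnerPair s v pos t T k i j m)
    (Q' : InnerPair s v pos t T k' i' j' m) : k = k' := by
  by_contra hne
  have hi := (mem_col.1 Q.left_mem).1
  have hi' := (mem_col.1 Q'.left_mem).1
  -- `i'` is a neighbour of `i`
  have key : ∀ {k k' : κ} {i j i' j' : ι}, InnerPair s v pos t T k i j m →
      InnerPair s v pos t T k' i' j' m → k ≠ k' → i' ∈ nb s v i := by
    intro k k' i j i' j' Q Q' hne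
    have h1 : i' ∈ col s v m := by rw [Q'.col_eq']; simp
    rw [Q.col_eq', mem_insert, mem_insert] at h1
    rcases h1 with h | h | h
    · have h2 := (mem_col.1 Q'.left_mem).2
      rw [h] at h2
      exact absurd (Q.supp k' (Ne.symm hne) Q'.ne_coord.symm) h2
    · have h2 : j ∈ col s v k := by rw [Q.col_eq]; simp
      have h3 := (mem_col.1 h2).2
      rw [← h] at h3
      exact absurd (Q'.supp k hne Q.ne_coord.symm) h3
    · exact h
  have h1 := key Q Q' hne
  have h2 := key Q' Q (Ne.symm hne)
  have hpi := Y.fam.pos_nb hi h1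
  -- the other neighbour of `i` is `j'`
  have key2 : ∀ {k k' : κ} {i j i' j' : ι}, InnerPair s v pos t T k i j m →
      InnerPair s v pos t T k' i' j' m → i ∈ s → i' ∈ s → i' ∈ nb s v i → i ∈ nb s v i' →
      j' ∈ nb s v i ∧ j' ≠ i' := by
    intro k k' i j i' j' Q Q' hi hi' h1 h2
    obtain ⟨y, hy, hyi'⟩ := exists_mem_ne (by rw [Q.deg]; norm_num : 1 < (nb s v i).card) i'
    have hyc : y ∈ col s v m := by rw [Q.col_eq']; simp [hy]
    rw [Q'.col_eq', mem_insert, mem_insert] at hyc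
    rcases hyc with h | h | h
    · exact absurd h hyi'
    · rw [← h]; exact ⟨hy, hyi'⟩
    · exfalso
      have e1 := Y.fam.pos_nb hi hy
      have e2 := Y.fam.pos_nb hi' h
      have e3 := Y.fam.pos_nb hi h1
      have e4 : pos y ≠ pos i' := fun h => hyi' (Y.fam.inj h)
      have e5 : pos y ≠ pos i := fun h' => Y.fam.ne_of_mem_nb hi hy (Y.fam.inj h')
      omega
  have h3 := key2 Q Q' hi hi' h1 h2
  have h4 := key2 Q' Q hi' hi h2 h1
  have hc : Conn s v i j := (Conn.of_mem_nb h1).trans (Conn.of_mem_nb h4.1)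
  have hc' : Conn s v i' j' := (Conn.of_mem_nb h2).trans (Conn.of_mem_nb h3.1)
  obtain ⟨w, hw, hcw, hpw⟩ := Q.between hc
  obtain ⟨w', hw', hcw', hpw'⟩ := Q'.between hc'
  have e1 := Y.fam.pos_nb hi h3.1
  have e2 := Y.fam.pos_nb hi' h4.1
  have e3 : pos j' ≠ pos i' := fun h => h3.2 (Y.fam.inj h)
  have e4 : pos j ≠ pos i := fun h => h4.2 (Y.fam.inj h)
  have e5 := Y.sep w hw w' hw' ((hcw.symm hi).trans ((Conn.of_mem_nb h1).trans hcw'))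
  rw [← e5] at hpw'
  omega

namespace ShortComp

variable (S : ShortComp s v t T k i j u m)
include S

theorem left_mem : i ∈ s := (mem_col.1 (by rw [S.col_eq]; simp : i ∈ col s v k)).1

theorem right_mem : j ∈ s := (mem_col.1 (by rw [S.col_eq]; simp : j ∈ col s v k)).1

theorem mem_nb_left : u ∈ nb s v i := by rw [S.nb_eq]; simp

theorem mem_nb_right : u ∈ nb s v j := by rw [S.nb_eq']; simp

theorem left_notMem (Y : Sys s v pos K t T) : i ∉ T := fun h =>
  Y.fam.ne_of_mem_nb S.left_mem S.mem_nb_left (Y.sep i h u S.mem (Conn.of_mem_nb S.mem_nb_left)).symm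

theorem right_notMem (Y : Sys s v pos K t T) : j ∉ T := fun h =>
  Y.fam.ne_of_mem_nb S.right_mem S.mem_nb_right
    (Y.sep j h u S.mem (Conn.of_mem_nb S.mem_nb_right)).symm

theorem card_col (Y : Sys s v pos K t T) : (col s v m).card = 3 := by
  rw [S.col_eq']
  refine card_eq_three.2 ⟨i, j, u, S.ne, ?_, ?_, rfl⟩
  · rintro rfl; exact S.left_notMem Y S.mem
  · rintro rfl; exact S.right_notMem Y S.mem

theorem mem_of_conn (hc : Conn s v u x) : x = i ∨ x = j ∨ x = u := by
  have : x ∈ ({i, j, u} : Finset ι) := by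
    refine Conn.mem_of_closed (s := s) (v := v) (fun x hx => ?_) (by simp) hc
    simp only [mem_insert, mem_singleton] at hx
    rcases hx with rfl | rfl | rfl
    · rw [S.nb_eq]; simp
    · rw [S.nb_eq']; simp
    · rw [S.nb_mid]
      exact insert_subset (by simp) (by simp)
  simpa using this

/-- The centre determines the ends, which are supported on `{k, m}` and one of which is hit by
`e_k'`; and `k' ≠ m` because `e_m` hits three vectors. -/
theorem coord_eq (Y : Sys s v pos K t T) (S' : ShortComp s v t T k' i' j' u m') : k = k' := by
  by_contra hne
  have hi' : i' ∈ col s v k' := by rw [S'.col_eq]; simp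
  have h1 : i' ∈ nb s v u := by rw [S'.nb_mid]; simp
  rw [S.nb_mid, mem_insert, mem_singleton] at h1
  have hk'm : k' ≠ m := by
    intro h
    have h2 := S.card_col Y
    rw [← h, S'.col_eq, card_pair S'.ne] at h2
    norm_num at h2
  have h3 := (mem_col.1 hi').2
  rcases h1 with rfl | rfl
  · exact h3 (S.supp k' (Ne.symm hne) hk'm)
  · exact h3 (S.supp' k' (Ne.symm hne) hk'm)

/-- Without source at the ends, each end carries half the value of the centre; together they lower
the coefficient of `φ u` by `1`. -/
theorem pot (Y : Sys s v pos K t T) (hφ : IsPot s v h φ) (hi0 : h i = 0) (hj0 : h j = 0) :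
    (((v u ⬝ᵥ v u : ℤ) : ℚ) - 1) * φ u = h u := by
  have h1 := Y.fam.pot_eq hφ S.left_mem
  have h2 := Y.fam.pot_eq hφ S.right_mem
  have h3 := Y.fam.pot_eq hφ (Y.subset S.mem)
  rw [S.norm, hi0, S.nb_eq, sum_singleton] at h1
  rw [S.norm', hj0, S.nb_eq', sum_singleton] at h2
  rw [S.nb_mid, sum_pair S.ne] at h3
  push_cast at h1 h2
  linarith

end ShortComp

/-- The label `l` is not `m'`, so a common vector would force `m' = m`; but `e_m` hits four vectors
and `e_m'` three. -/
theorem InnerPair.ne_center (Y : Sys s v pos K t T) (Q : InnerPair s v pos t T l i j m)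
    (hl : t l ≠ 0) (S : ShortComp s v t T k i' j' u m') : i ≠ u := by
  rintro rfl
  have hi := (mem_col.1 Q.left_mem).1
  have h1 : i ∈ col s v m' := by rw [S.col_eq']; simp
  have h2 : m' = m := by
    by_contra hne
    refine (mem_col.1 h1).2 (Q.supp m' ?_ hne)
    rintro rfl
    exact hl S.t_eq'
  have h3 := S.card_col Y
  rw [h2, Q.card_col Y.fam hi] at h3
  norm_num at h3

end

section

variable {s T : Finset ι} {K : Finset κ} {t : κ → ℤ} {v v' : ι → κ → ℤ} {pos : ι → ℤ}
  {h : ι → ℤ} {φ ψ : ι → ℚ} {i j i' j' u u' w w' x y z : ι} {k k' l l' m m' n q : κ}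

theorem sum_indicator_of_subset {A B : Finset κ} (h : A ⊆ B) :
    ∑ q ∈ B, (if q ∈ A then (1 : ℤ) else 0) = A.card := by
  rw [sum_boole, filter_mem_eq_inter, inter_eq_right.2 h]

namespace MinSys

variable (Y : MinSys s v pos K t T)
include Y

theorem two_le_card_col (hl : t l ≠ 0) :
    2 ≤ (col s v l).card ∧ ((col s v l).card = 2 → ∃ i j, PairCol s v t l i j) := by
  obtain ⟨φ, hφ⟩ := Y.full l (Y.mem_of_t_ne_zero hl)
  have h1 : 1 ≤ (col s v l).card := card_pos.2 hφ.col_nonempty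
  have h3 := Y.three_le
  have h2 : (col s v l).card ≠ 1 := fun h => by
    obtain ⟨w, hw⟩ := card_eq_one.1 h
    have := Y.card_le_of_col_singleton hl hw
    omega
  refine ⟨by omega, fun h => ?_⟩
  obtain ⟨i, j, hij, hcol⟩ := card_eq_two.1 h
  have hi := Y.eq_t hl (by rw [hcol]; simp : i ∈ col s v l)
  have hj := Y.eq_t hl (by rw [hcol]; simp : j ∈ col s v l)
  exact ⟨i, j, hij, hcol, by rw [hi, Y.t_sq hl], Or.inr ⟨hl, by rw [hi, hj]⟩⟩

/-- In a minimal counterexample the count is attained: all components are short. -/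
theorem tight :
    (∀ w ∈ T, ∃ k i j m, ShortComp s v t T k i j w m) ∧
    (∀ q ∈ K, t q = 0 → sumSq s v q = 3 ∨ ∃ i j u m, ShortComp s v t T q i j u m) ∧
    ∀ l, t l ≠ 0 → (col s v l).card = 3 := by
  have h3 := Y.three_le
  obtain ⟨w₀, hw₀⟩ : T.Nonempty := card_pos.1 (by omega)
  obtain ⟨l₀, hl₀, -, -⟩ := Y.link.2 w₀ hw₀
  have : Nonempty ι := ⟨w₀⟩
  have : Nonempty κ := ⟨l₀⟩
  -- `V` collects the labels and `U` the other columns; `P` those in `U` of square sum `2`, `A`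
  -- those of short components, `V₂` the blocks of two. Each member of `B` has an inner pair, and
  -- `M` collects the second basis vectors of these, of square sum `4`.
  set V := K.filter fun q => t q ≠ 0 with hV
  set U := K.filter fun q => ¬ t q ≠ 0 with hU
  set P := U.filter fun q => sumSq s v q = 2 with hP
  set A := P.filter fun q => ∃ i j u m, ShortComp s v t T q i j u m with hA
  set V₂ := V.filter fun q => (col s v q).card = 2 with hV₂
  set B := (P \ A) ∪ V₂ with hB
  have hVmem : ∀ l, t l ≠ 0 → l ∈ V := fun l hl => mem_filter.2 ⟨Y.mem_of_t_ne_zero hl, hl⟩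
  have hUmem : ∀ q ∈ U, q ∈ K ∧ t q = 0 := fun q hq =>
    ⟨(mem_filter.1 hq).1, not_not.1 (mem_filter.1 hq).2⟩
  have hPU : P ⊆ U := filter_subset _ _
  have hAP : A ⊆ P := filter_subset _ _
  have hV₂V : V₂ ⊆ V := filter_subset _ _
  have hinner : ∀ q ∈ B, ∃ i j m, InnerPair s v pos t T q i j m := by
    intro q hq
    rcases mem_union.1 hq with hq | hq
    · obtain ⟨h1, h2⟩ := mem_sdiff.1 hq
      obtain ⟨h4, h5⟩ := mem_filter.1 h1
      obtain ⟨i, j, hp⟩ := (Y.two_le_sumSq (hUmem q h4).1 (hUmem q h4).2).2 h5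
      refine (Y.pair_cases hp).resolve_right fun h => h2 (mem_filter.2 ⟨h1, h⟩)
    · obtain ⟨h1, h2⟩ := mem_filter.1 hq
      obtain ⟨i, j, hp⟩ := (Y.two_le_card_col (mem_filter.1 h1).2).2 h2
      refine (Y.pair_cases hp).resolve_right ?_
      rintro ⟨i, j, u, m, S⟩
      exact (mem_filter.1 h1).2 S.t_eq
  choose! iB jB mB hQ using hinner
  have hshort : ∀ q ∈ A, ∃ i j u m, ShortComp s v t T q i j u m := fun q hq => (mem_filter.1 hq).2
  choose! iA jA uA mA hS using hshort
  set M := B.image mB with hM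
  have hMcard : M.card = B.card := card_image_of_injOn fun q hq q' hq' h => by
    have h1 := hQ q hq
    rw [show mB q = mB q' from h] at h1
    exact h1.coord_eq Y.toSys (hQ q' hq')
  have hMU : ∀ q ∈ M, q ∈ U ∧ sumSq s v q = 4 := by
    intro q hq
    obtain ⟨k, hk, rfl⟩ := mem_image.1 hq
    have Q := hQ k hk
    have hi : iB k ∈ col s v (mB k) := by rw [Q.col_eq']; simp
    refine ⟨mem_filter.2 ⟨Y.mem_of_ne_zero (mem_col.1 hi).1 (mem_col.1 hi).2,
      not_not.2 Q.t_eq⟩, ?_⟩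
    rw [sumSq_eq_card Q.sq, Q.card_col Y.fam (mem_col.1 hi).1]
    norm_num
  have hBcard : B.card = (P \ A).card + V₂.card := by
    refine card_union_of_disjoint (disjoint_left.2 fun q hq hq' => ?_)
    exact (mem_filter.1 (hV₂V hq')).2 (hUmem q (hPU (mem_sdiff.1 hq).1)).2
  have hPcard : (P \ A).card + A.card = P.card := card_sdiff_add_card_eq_card hAP
  -- In `U`, square sums fall below `3` only on `P`, by one, and exceed `3` on `M`, by one.
  have hUsum : ∀ q ∈ U, (if q ∈ M then (1 : ℤ) else 0) - (if q ∈ P then 1 else 0)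
      ≤ sumSq s v q - 3 := by
    intro q hq
    have h2 := (Y.two_le_sumSq (hUmem q hq).1 (hUmem q hq).2).1
    by_cases hqM : q ∈ M
    · rw [if_pos hqM, (hMU q hqM).2]
      split_ifs <;> norm_num
    · rw [if_neg hqM]
      by_cases hqP : q ∈ P
      · rw [if_pos hqP, (mem_filter.1 hqP).2]; norm_num
      · have : sumSq s v q ≠ 2 := fun h => hqP (mem_filter.2 ⟨hq, h⟩)
        rw [if_neg hqP]
        omega
  have hU1 : (M.card : ℤ) - P.card ≤ ∑ q ∈ U, (sumSq s v q - 3) := by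
    rw [← sum_indicator_of_subset (fun q hq => (hMU q hq).1 : M ⊆ U),
      ← sum_indicator_of_subset hPU, ← sum_sub_distrib]
    exact sum_le_sum hUsum
  have hVsum : ∀ l ∈ V, (3 : ℤ) - (if l ∈ V₂ then 1 else 0) ≤ (col s v l).card := by
    intro l hl
    have h2 := (Y.two_le_card_col (mem_filter.1 hl).2).1
    split_ifs with h
    · rw [(mem_filter.1 h).2]; norm_num
    · have : (col s v l).card ≠ 2 := fun h' => h (mem_filter.2 ⟨hl, h'⟩)
      omega
  have hVc : ∑ l ∈ V, ((col s v l).card : ℤ) = T.card := by exact_mod_cast Y.sum_card_col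
  have hV1 : (3 : ℤ) * V.card - V₂.card ≤ T.card := by
    have := sum_le_sum hVsum
    rw [sum_sub_distrib, sum_indicator_of_subset hV₂V, hVc, sum_const, nsmul_eq_mul] at this
    linarith
  have hcount : (T.card : ℤ) + ∑ q ∈ U, (sumSq s v q - 3) + T.card ≤ 3 * V.card := by
    have h1 := Y.count
    have h2 : ∑ q ∈ V, sumSq s v q + ∑ q ∈ U, sumSq s v q = ∑ q ∈ K, sumSq s v q :=
      sum_filter_add_sum_filter_not K _ _
    have h4 : V.card + U.card = K.card := card_filter_add_card_filter_not _
    have h5 : ∑ q ∈ V, sumSq s v q = T.card := by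
      rw [← hVc]
      exact sum_congr rfl fun l hl => Y.sumSq_of_t_ne_zero (mem_filter.1 hl).2
    have h6 : ∑ q ∈ U, (sumSq s v q - 3) = ∑ q ∈ U, sumSq s v q - 3 * U.card := by
      rw [sum_sub_distrib, sum_const, nsmul_eq_mul]; ring
    have h7 : (K.card : ℤ) = V.card + U.card := by exact_mod_cast h4.symm
    rw [← Y.sum_sumSq, ← h2, h5, h7] at h1
    rw [h6]
    linarith
  have hAT : A.image uA ⊆ T := fun x hx => by
    obtain ⟨q, hq, rfl⟩ := mem_image.1 hx
    exact (hS q hq).mem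
  have hAcard : (A.image uA).card = A.card := card_image_of_injOn fun q hq q' hq' h => by
    have h1 := hS q hq
    rw [show uA q = uA q' from h] at h1
    exact h1.coord_eq Y.toSys (hS q' hq')
  have hV₂B : V₂ ⊆ B := subset_union_right
  have hVT : V₂.image iB ⊆ T := fun x hx => by
    obtain ⟨q, hq, rfl⟩ := mem_image.1 hx
    exact Y.col_subset (mem_filter.1 (hV₂V hq)).2 (hQ q (hV₂B hq)).left_mem
  have hV₂card : (V₂.image iB).card = V₂.card := card_image_of_injOn fun q hq q' hq' h => by
    have h1 := (hQ q (hV₂B hq)).left_mem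
    have h2 := (hQ q' (hV₂B hq')).left_mem
    have e1 := (mem_filter.1 (hV₂V hq)).2
    rw [← show iB q = iB q' from h] at h2
    exact Y.label_eq (Y.col_subset e1 h1) e1 (mem_filter.1 (hV₂V hq')).2 (mem_col.1 h1).2
      (mem_col.1 h2).2
  have hAV : A.card + V₂.card ≤ T.card := by
    rw [← hAcard, ← hV₂card, ← card_union_of_disjoint]
    · exact card_le_card (union_subset hAT hVT)
    · refine disjoint_left.2 fun x hx hx' => ?_
      obtain ⟨q, hq, rfl⟩ := mem_image.1 hx
      obtain ⟨q', hq', h⟩ := mem_image.1 hx'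
      exact (hQ q' (hV₂B hq')).ne_center Y.toSys (mem_filter.1 (hV₂V hq')).2 (hS q hq) h
  -- From `hU1` and `|M| = |P| - |A| + |V₂|` the excess over `U` is at least `|V₂| - |A|`. With
  -- `hV1`, that is `3|V| ≤ |T| + |V₂|`, the bound `hcount` gives `|T| ≤ |A|`, while `|A| + |V₂| ≤
  -- |T|`.
  have hV₂0 : V₂ = ∅ := card_eq_zero.1 (by omega)
  have hAT' : A.card = T.card := by omega
  have hall : ∀ w ∈ T, ∃ k i j m, ShortComp s v t T k i j w m := by
    intro w hw
    rw [← eq_of_subset_of_card_le hAT (by omega)] at hw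
    obtain ⟨q, hq, rfl⟩ := mem_image.1 hw
    exact ⟨q, _, _, _, hS q hq⟩
  -- The vertex with two neighbours of an inner pair would be a linked centre; but its vector is
  -- supported on two coordinates where `t` vanishes, so it has no label.
  have hPA : P ⊆ A := by
    intro q hq
    by_contra hqA
    have Q := hQ q (mem_union_left _ (mem_sdiff.2 ⟨hq, hqA⟩))
    have hi := (mem_col.1 Q.left_mem).1
    obtain ⟨w, hw, hc⟩ := Y.cover _ hi
    obtain ⟨k, i, j, m, S⟩ := hall w hw
    have hdeg := Q.deg
    rcases S.mem_of_conn (hc.symm hi) with h | h | h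
    · rw [h, S.nb_eq] at hdeg; simp at hdeg
    · rw [h, S.nb_eq'] at hdeg; simp at hdeg
    · rw [← h] at hw
      obtain ⟨l, hl, hil, -⟩ := Y.link.2 _ hw
      refine hil (Q.supp l ?_ ?_)
      · rintro rfl; exact hl (hUmem l (hPU hq)).2
      · rintro rfl; exact hl Q.t_eq
  have hPAeq : P = A := subset_antisymm hPA hAP
  have hM0 : M = ∅ := by rw [hM, hB, hPAeq, hV₂0]; simp
  have hUeq : ∑ q ∈ U, (sumSq s v q - 3 + if q ∈ P then 1 else 0) = 0 := by
    refine le_antisymm ?_ (sum_nonneg fun q hq => ?_)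
    · rw [sum_add_distrib, sum_indicator_of_subset hPU, hPAeq]
      rw [hV₂0] at hV1
      simp only [card_empty] at hV1
      have : (A.card : ℤ) = T.card := by exact_mod_cast hAT'
      push_cast at hV1
      linarith
    · have := hUsum q hq
      rw [hM0] at this
      simp only [notMem_empty, if_false] at this
      linarith
  refine ⟨hall, fun q hqK htq => ?_, fun l hl => ?_⟩
  · have hqU : q ∈ U := mem_filter.2 ⟨hqK, not_not.2 htq⟩
    by_cases hqP : q ∈ P
    · exact Or.inr (mem_filter.1 (hPA hqP)).2
    · left
      have h1 := (sum_eq_zero_iff_of_nonneg fun q hq => by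
        have := hUsum q hq
        rw [hM0] at this
        simp only [notMem_empty, if_false] at this
        linarith).1 hUeq q hqU
      rw [if_neg hqP] at h1
      linarith
  · have hVeq : ∑ l ∈ V, (((col s v l).card : ℤ) - 3) = 0 := by
      refine le_antisymm ?_ (sum_nonneg fun l hl => ?_)
      · rw [sum_sub_distrib, hVc, sum_const, nsmul_eq_mul]
        rw [hM0, hPAeq] at hU1
        simp only [card_empty] at hU1
        have : (A.card : ℤ) = T.card := by exact_mod_cast hAT'
        push_cast at hU1
        linarith
      · have := hVsum l hl
        rw [hV₂0] at this
        simp only [notMem_empty, if_false] at this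
        linarith
    have h1 := (sum_eq_zero_iff_of_nonneg fun l hl => by
      have := hVsum l hl
      rw [hV₂0] at this
      simp only [notMem_empty, if_false] at this
      linarith).1 hVeq l (hVmem l hl)
    omega

end MinSys

end

/-! ### Excluding systems made of short components. -/

section

variable {s T : Finset ι} {K : Finset κ} {t : κ → ℤ} {v v' : ι → κ → ℤ} {pos : ι → ℤ}
  {h : ι → ℤ} {φ ψ : ι → ℚ} {i j i' j' u u' w w' x y z : ι} {k k' l l' m m' n q : κ}

/-- Fix a label `l`, with its block of three centres. A further column through one of them, other
than its `e_m`, has square sum `3` and is supported on centres; coordinate sum `0` on blocks makes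
it hit each block it touches at least twice, so it is exactly this block with entries `±1`. Hence
the centres have a common norm `2 + |R|`, and the coordinates of `e_q` there are its entries divided
by `|R| + 1`. If `R` is nonempty, three signs would add up to `0`; if it is empty, `e_l` would have
energy `3`. -/
theorem MinSys.false (Y : MinSys s v pos K t T) : False := by
  obtain ⟨hall, hU, hV⟩ := Y.tight
  obtain ⟨w₀, hw₀⟩ : T.Nonempty := card_pos.1 (by have := Y.three_le; omega)
  obtain ⟨l, hl, -, -⟩ := Y.link.2 w₀ hw₀
  have : Nonempty ι := ⟨w₀⟩
  have : Nonempty κ := ⟨l⟩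
  choose! k i j m hS using hall
  have hiT : ∀ w ∈ T, i w ∉ T := fun w hw => (hS w hw).left_notMem Y.toSys
  have hjT : ∀ w ∈ T, j w ∉ T := fun w hw => (hS w hw).right_notMem Y.toSys
  have hgen : ∀ q ∈ K, t q = 0 → ∀ w ∈ T, v w q ≠ 0 → q ≠ m w →
      sumSq s v q = 3 ∧ col s v q ⊆ T := by
    intro q hqK htq w hw hwq hqm
    have hwc : w ∈ col s v q := mem_col.2 ⟨Y.subset hw, hwq⟩
    have hnp : ∀ {i' j' u' : ι} {m' : κ}, ShortComp s v t T q i' j' u' m' → False := by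
      intro i' j' u' m' S
      rw [S.col_eq, mem_insert, mem_singleton] at hwc
      rcases hwc with rfl | rfl
      · exact S.left_notMem Y.toSys hw
      · exact S.right_notMem Y.toSys hw
    refine ⟨(hU q hqK htq).resolve_right fun ⟨i', j', u', m', S⟩ => hnp S, fun y hy => ?_⟩
    obtain ⟨hys, hyq⟩ := mem_col.1 hy
    obtain ⟨w', hw', hc⟩ := Y.cover y hys
    have S := hS w' hw'
    have hqk : q ≠ k w' := by
      rintro rfl
      exact hnp S
    have hqm' : q ≠ m w' := by
      rintro rfl
      rw [S.col_eq', mem_insert, mem_insert, mem_singleton] at hwc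
      rcases hwc with h | h | h
      · exact hiT w' hw' (h ▸ hw)
      · exact hjT w' hw' (h ▸ hw)
      · exact hqm (by rw [h])
    rcases S.mem_of_conn (hc.symm hys) with h | h | h
    · exact absurd (S.supp q hqk hqm') (h ▸ hyq)
    · exact absurd (S.supp' q hqk hqm') (h ▸ hyq)
    · rw [h]; exact hw'
  have hpot : ∀ (q : κ) (φ : ι → ℚ), InSpan s v q φ → col s v q ⊆ T → ∀ w ∈ T,
      (((v w ⬝ᵥ v w : ℤ) : ℚ) - 1) * φ w = v w q := by
    intro q φ hφ hsub w hw
    have S := hS w hw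
    exact S.pot Y.toSys hφ.isPot
      (eq_zero_of_notMem_col S.left_mem fun h => hiT w hw (hsub h))
      (eq_zero_of_notMem_col S.right_mem fun h => hjT w hw (hsub h))
  have hblock : ∀ q ∈ K, t q = 0 → ∀ l', t l' ≠ 0 → ∀ w ∈ col s v l', v w q ≠ 0 → q ≠ m w →
      ∃ w' ∈ col s v l', w' ≠ w ∧ v w' q ≠ 0 := by
    intro q hqK htq l' hl' w hw hwq hqm
    by_contra! hcon
    have hwT := Y.col_subset hl' hw
    obtain ⟨φ, hφ⟩ := Y.full q hqK
    have hsub := (hgen q hqK htq w hwT hwq hqm).2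
    have h1 := Y.sum_block hφ hl' (by rintro rfl; exact hl' htq)
    rw [sum_eq_single_of_mem w hw fun y hy hne => ?_] at h1
    · have := hpot q φ hφ hsub w hwT
      rw [h1, mul_zero] at this
      exact hwq (by exact_mod_cast this.symm)
    · have := hpot q φ hφ hsub y (Y.col_subset hl' hy)
      rw [hcon y hy hne, Int.cast_zero] at this
      refine (mul_eq_zero.1 this).resolve_left ?_
      have h2 := Y.fam.diag y (mem_col.1 hy).1
      have : (2 : ℚ) ≤ ((v y ⬝ᵥ v y : ℤ) : ℚ) := by exact_mod_cast h2
      linarith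
  have hcol : ∀ q ∈ K, t q = 0 → ∀ w ∈ col s v l, v w q ≠ 0 → q ≠ m w →
      col s v q = col s v l ∧ ∀ y ∈ col s v q, v y q ^ 2 = 1 := by
    intro q hqK htq w hw hwq hqm
    have hwT := Y.col_subset hl hw
    obtain ⟨hp, hsub⟩ := hgen q hqK htq w hwT hwq hqm
    have hmem : ∀ y ∈ s, v y q ≠ 0 → y ∈ col s v q := fun y hy h => mem_col.2 ⟨hy, h⟩
    have hle : (col s v q).card ≤ 3 := by
      have := card_col_le (s := s) (v := v) (q := q)
      omega
    have hcoords : ∀ y ∈ col s v q, q ≠ m y := by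
      rintro y hy rfl
      have hyT := hsub hy
      have : i y ∈ col s v (m y) := by rw [(hS y hyT).col_eq']; simp
      exact hiT y hyT (hsub this)
    obtain ⟨w₂, hw₂, hne, hw₂q⟩ := hblock q hqK htq l hl w hw hwq hqm
    have hwc := hmem w (mem_col.1 hw).1 hwq
    have hw₂c := hmem w₂ (mem_col.1 hw₂).1 hw₂q
    obtain ⟨y, hy, hyw, hyw₂⟩ : ∃ y ∈ col s v q, y ≠ w ∧ y ≠ w₂ := by
      by_contra! hcon
      have h1 : col s v q = {w, w₂} := by
        ext y
        rw [mem_insert, mem_singleton]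
        constructor
        · intro hy
          by_contra! h
          exact h.2 (hcon y hy h.1)
        · rintro (rfl | rfl) <;> assumption
      rw [sumSq_eq_col, h1, sum_pair hne.symm] at hp
      exact sq_add_sq_ne_three _ _ hp
    have hthree : ({w, w₂, y} : Finset ι).card = 3 :=
      card_eq_three.2 ⟨w, w₂, y, hne.symm, hyw.symm, hyw₂.symm, rfl⟩
    have hsub3 : ({w, w₂, y} : Finset ι) ⊆ col s v q :=
      insert_subset hwc (insert_subset hw₂c (singleton_subset_iff.2 hy))
    have heq3 := eq_of_subset_of_card_le hsub3 (by omega)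
    -- A third vector in another block would need a companion there, but the column has only three
    -- vectors.
    have hyl : y ∈ col s v l := by
      by_contra hyl
      have hyT := hsub hy
      obtain ⟨l', hl', hyl', -⟩ := Y.link.2 y hyT
      obtain ⟨y', hy', hyy', hy'q⟩ := hblock q hqK htq l' hl' y
        (mem_col.2 ⟨Y.subset hyT, hyl'⟩) (mem_col.1 hy).2 (hcoords y hy)
      have h1 := hmem y' (mem_col.1 hy').1 hy'q
      rw [← heq3, mem_insert, mem_insert, mem_singleton] at h1
      have hcontra : ∀ a ∈ col s v l, y' ≠ a := by
        rintro a ha rfl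
        have := Y.label_eq (Y.col_subset hl ha) hl hl' (mem_col.1 ha).2 (mem_col.1 hy').2
        subst this
        exact hyl (mem_col.2 ⟨Y.subset hyT, hyl'⟩)
      rcases h1 with h | h | h
      · exact hcontra w hw h
      · exact hcontra w₂ hw₂ h
      · exact hyy' h
    have heql := eq_of_subset_of_card_le
      (insert_subset hw (insert_subset hw₂ (singleton_subset_iff.2 hyl)) :
        ({w, w₂, y} : Finset ι) ⊆ col s v l) (by rw [hV l hl]; omega)
    refine ⟨by rw [← heq3, heql], ?_⟩
    have h1 : ∑ y ∈ col s v q, (v y q ^ 2 - 1) = 0 := by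
      rw [sum_sub_distrib, ← sumSq_eq_col, hp, ← heq3, sum_const, hthree]
      norm_num
    intro a ha
    have := (sum_eq_zero_iff_of_nonneg fun b hb => by
      have := one_le_sq_of_mem_col hb
      linarith).1 h1 a ha
    linarith
  set R := K.filter fun q => t q = 0 ∧ col s v q = col s v l with hR
  have hRm : ∀ w ∈ T, m w ∉ R := by
    intro w hw h
    have h1 : i w ∈ col s v (m w) := by rw [(hS w hw).col_eq']; simp
    rw [(mem_filter.1 h).2.2] at h1
    exact hiT w hw (Y.col_subset hl h1)
  have hRsq : ∀ q ∈ R, ∀ w ∈ col s v l, v w q ^ 2 = 1 := by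
    intro q hq w hw
    obtain ⟨hqK, htq, hqc⟩ := mem_filter.1 hq
    have hwc : w ∈ col s v q := by rw [hqc]; exact hw
    exact (hcol q hqK htq w hw (mem_col.1 hwc).2
      (by rintro rfl; exact hRm w (Y.col_subset hl hw) hq)).2 w hwc
  have hnorm : ∀ w ∈ col s v l, v w ⬝ᵥ v w = 2 + R.card := by
    intro w hw
    have hwT := Y.col_subset hl hw
    have S := hS w hwT
    have hlm : l ≠ m w := fun h => hl (h ▸ S.t_eq')
    have hlR : l ∉ R := fun h => hl (mem_filter.1 h).2.1
    have hsum : ∑ q ∈ insert l (insert (m w) R), v w q ^ 2 = ∑ q, v w q ^ 2 := by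
      refine sum_subset (subset_univ _) fun q _ hq => ?_
      rw [mem_insert, mem_insert] at hq
      push Not at hq
      by_contra hne
      have hne' : v w q ≠ 0 := fun h => hne (by rw [h]; norm_num)
      by_cases htq : t q = 0
      · have hqK := Y.mem_of_ne_zero (mem_col.1 hw).1 hne'
        exact hq.2.2 (mem_filter.2 ⟨hqK, htq, (hcol q hqK htq w hw hne' hq.2.1).1⟩)
      · exact hq.1 (Y.label_eq hwT htq hl hne' (mem_col.1 hw).2)
    rw [dot_self_eq, ← hsum, sum_insert, sum_insert (hRm w hwT), sum_congr rfl fun q hq =>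
      hRsq q hq w hw, S.sq w (by rw [S.col_eq']; simp), Y.eq_t hl hw, Y.t_sq hl]
    · simp; ring
    · rw [mem_insert]
      rintro (h | h)
      · exact hlm h
      · exact hlR h
  have hpos : (0 : ℚ) < R.card + 1 := by positivity
  rcases R.eq_empty_or_nonempty with hR0 | ⟨q, hq⟩
  · obtain ⟨φ, hφ⟩ := Y.full l (Y.mem_of_t_ne_zero hl)
    have h1 := hφ.sum_col
    have h2 : ∀ w ∈ col s v l, (v w l : ℚ) * φ w = 1 := by
      intro w hw
      have h3 := hpot l φ hφ (Y.col_subset hl) w (Y.col_subset hl hw)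
      rw [hnorm w hw, hR0] at h3
      have h4 : (v w l : ℚ) ^ 2 = 1 := by
        have := Y.t_sq hl
        rw [← Y.eq_t hl hw] at this
        exact_mod_cast this
      rw [← h4, ← h3]
      push_cast [card_empty]
      have h5 : φ w = v w l := by
        push_cast [card_empty] at h3
        linarith
      rw [h5]; ring
    rw [sum_congr rfl h2] at h1
    simp [hV l hl] at h1
  · obtain ⟨hqK, htq, hqc⟩ := mem_filter.1 hq
    obtain ⟨φ, hφ⟩ := Y.full q hqK
    have h1 := Y.sum_block hφ hl (by rintro rfl; exact hl htq)
    have h2 : ∑ w ∈ col s v l, (v w q : ℚ) = 0 := by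
      have : ∀ w ∈ col s v l, (v w q : ℚ) = (R.card + 1) * φ w := by
        intro w hw
        rw [← hpot q φ hφ (by rw [hqc]; exact Y.col_subset hl) w (Y.col_subset hl hw), hnorm w hw]
        push_cast
        ring
      rw [sum_congr rfl this, ← mul_sum, h1, mul_zero]
    have h3 : ∑ w ∈ col s v l, v w q = 0 := by exact_mod_cast h2
    obtain ⟨a, b, c, hab, hac, hbc, habc⟩ := card_eq_three.1 (hV l hl)
    have hone := hRsq q hq
    rw [habc] at h3 hone
    rw [sum_insert (by simp [hab, hac]), sum_pair hbc] at h3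
    rcases eq_one_or_of_sq_eq_one (hone a (by simp)) with ha | ha <;>
    rcases eq_one_or_of_sq_eq_one (hone b (by simp)) with hb | hb <;>
    rcases eq_one_or_of_sq_eq_one (hone c (by simp)) with hc | hc <;> omega

/-- A system has at most two components. -/
theorem Sys.card_le_two (Y : Sys s v pos K t T) : T.card ≤ 2 := by
  induction hn : s.card using Nat.strong_induction_on generalizing s v K t T with
  | _ n ih =>
    by_contra! h3
    exact MinSys.false ⟨Y, h3, fun s' v' K' t' T' hlt Y' => ih _ (hn ▸ hlt) Y' rfl⟩

end

/-! ### Laying out a linear graph on the integer line. -/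

section

open SimpleGraph

variable {V : Type*} {G : SimpleGraph V}

/-- The end of a longest path: a neighbour off the path would prolong it, and one on the path can
only be the previous vertex. -/
theorem exists_leaf_of_isAcyclic [Finite V] [Nonempty V] (h : G.IsAcyclic) :
    ∃ a u, ∀ w, G.Adj a w → w = u := by
  obtain ⟨u, v, p, hp, hmax⟩ := Walk.exists_isPath_forall_isPath_length_le_length G
  refine ⟨v, p.penultimate, fun w hw => h.eq_penultimate_of_adj_end hp hw ?_⟩
  by_contra hns
  have := hmax _ _ _ (hp.concat hns hw)
  rw [Walk.length_concat] at this
  omega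

/-- Positions of the vertices on a line, in which adjacent vertices are neighbours. -/
def IsLayout (G : SimpleGraph V) (A : Finset V) (pos : V → ℤ) : Prop :=
  Set.InjOn pos A ∧ ∀ x ∈ A, ∀ y ∈ A, G.Adj x y → pos y = pos x + 1 ∨ pos y = pos x - 1

/-- Shifting everything left of `u` by one frees the position `pos u - 1` for `a`. No edge is torn,
as `u` has no neighbour just left of it. -/
theorem IsLayout.insert_left {A : Finset V} {pos : V → ℤ} {a u : V} (h : IsLayout G A pos)
    (ha : a ∉ A) (hu : u ∈ A) (hau : ∀ w ∈ A, G.Adj a w → w = u)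
    (hfree : ∀ x ∈ A, G.Adj u x → pos x ≠ pos u - 1) : ∃ pos', IsLayout G (insert a A) pos' := by
  set p : V → ℤ := fun y => if y = a then pos u - 1 else if pos y < pos u then pos y - 1 else pos y
    with hp
  have hpa : p a = pos u - 1 := if_pos rfl
  have hpA : ∀ y ∈ A, p y = if pos y < pos u then pos y - 1 else pos y := fun y hy =>
    if_neg (ne_of_mem_of_not_mem hy ha)
  have hpu : p u = pos u := by rw [hpA u hu, if_neg (lt_irrefl _)]
  have hne : ∀ y ∈ A, p y ≠ p a := by
    intro y hy
    rw [hpA y hy, hpa]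
    split_ifs <;> omega
  refine ⟨p, fun x hx y hy hxy => ?_, fun x hx y hy hadj => ?_⟩
  · rw [mem_coe, mem_insert] at hx hy
    rcases hx with rfl | hx <;> rcases hy with rfl | hy
    · rfl
    · exact absurd hxy.symm (hne y hy)
    · exact absurd hxy (hne x hx)
    · rw [hpA x hx, hpA y hy] at hxy
      refine h.1 hx hy ?_
      split_ifs at hxy <;> omega
  · rw [mem_insert] at hx hy
    rcases hx with rfl | hx <;> rcases hy with rfl | hy
    · exact absurd hadj (G.loopless.irrefl _)
    · rw [hau y hy hadj, hpu, hpa]; omega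
    · rw [hau x hx hadj.symm, hpu, hpa]; omega
    · have h1 := h.2 x hx y hy hadj
      rw [hpA x hx, hpA y hy]
      have h2 : pos x = pos u → pos y ≠ pos u - 1 := fun e => by
        have : x = u := h.1 hx hu e
        subst this
        exact hfree y hy hadj
      have h3 : pos y = pos u → pos x ≠ pos u - 1 := fun e => by
        have : y = u := h.1 hy hu e
        subst this
        exact hfree x hx hadj.symm
      split_ifs <;> omega

theorem IsLayout.neg {A : Finset V} {pos : V → ℤ} (h : IsLayout G A pos) :
    IsLayout G A fun x => -pos x := by
  refine ⟨fun x hx y hy hxy => h.1 hx hy (neg_injective hxy), fun x hx y hy hadj => ?_⟩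
  have := h.2 x hx y hy hadj
  dsimp only
  omega

theorem IsLinearGraph.exists_isLayout [Finite V] (h : IsLinearGraph G) (A : Finset V) :
    ∃ pos, IsLayout G A pos := by
  induction hn : A.card generalizing A with
  | zero => exact ⟨0, by rw [card_eq_zero.1 hn]; simp [IsLayout]⟩
  | succ n ih =>
    have hne : A.Nonempty := card_pos.1 (by omega)
    have : Nonempty (A : Set V) := hne.to_subtype
    obtain ⟨⟨a, ha⟩, ⟨u, hu⟩, hleaf⟩ := exists_leaf_of_isAcyclic (h.1.induce (A : Set V))
    have hau : ∀ w ∈ A.erase a, G.Adj a w → w = u := fun w hw hadj =>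
      congrArg Subtype.val (hleaf ⟨w, mem_of_mem_erase hw⟩ hadj)
    obtain ⟨pos, hpos⟩ := ih (A.erase a) (by rw [card_erase_of_mem ha, hn]; rfl)
    rw [← insert_erase (mem_coe.1 ha)]
    by_cases hadj : G.Adj a u
    · have hu' : u ∈ A.erase a := mem_erase.2 ⟨hadj.ne', hu⟩
      -- If the left side of `u` is taken by a neighbour, the line is reflected; neighbours on both
      -- sides together with `a` would give `u` degree `3`.
      by_cases hfree : ∃ x ∈ A.erase a, G.Adj u x ∧ pos x = pos u - 1
      · obtain ⟨x, hx, hux, hxpos⟩ := hfree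
        refine hpos.neg.insert_left (notMem_erase _ _) hu' hau fun y hy huy hypos => ?_
        have hxa := ne_of_mem_erase hx
        have hya := ne_of_mem_erase hy
        have hxy : x ≠ y := by
          rintro rfl
          omega
        have h3 : ({a, x, y} : Set V) ⊆ G.neighborSet u := by
          rintro z (rfl | rfl | rfl)
          · exact hadj.symm
          · exact hux
          · exact huy
        have h4 := Set.ncard_le_ncard h3 (Set.toFinite _)
        rw [Set.ncard_eq_three.2 ⟨a, x, y, hxa.symm, hya.symm, hxy, rfl⟩] at h4
        have := h.2 u
        omega
      · push Not at hfree
        exact hpos.insert_left (notMem_erase _ _) hu' hau hfree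
    · have hno : ∀ w ∈ A.erase a, ¬ G.Adj a w := fun w hw h' => hadj (hau w hw h' ▸ h')
      obtain ⟨z, hz⟩ := Infinite.exists_notMem_finset ((A.erase a).image pos)
      have hz' : ∀ y ∈ A.erase a, pos y ≠ z := fun y hy h => hz (mem_image.2 ⟨y, hy, h⟩)
      have hup : ∀ y ∈ A.erase a, Function.update pos a z y = pos y := fun y hy =>
        Function.update_of_ne (ne_of_mem_erase hy) _ _
      refine ⟨Function.update pos a z, fun x hx y hy hxy => ?_, fun x hx y hy hadj' => ?_⟩
      · rw [mem_coe, mem_insert] at hx hy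
        rcases hx with rfl | hx <;> rcases hy with rfl | hy
        · rfl
        · rw [hup y hy, Function.update_self] at hxy
          exact absurd hxy.symm (hz' y hy)
        · rw [hup x hx, Function.update_self] at hxy
          exact absurd hxy (hz' x hx)
        · rw [hup x hx, hup y hy] at hxy
          exact hpos.1 hx hy hxy
      · rw [mem_insert] at hx hy
        rcases hx with rfl | hx <;> rcases hy with rfl | hy
        · exact absurd hadj' (G.loopless.irrefl _)
        · exact absurd hadj' (hno y hy)
        · exact absurd hadj'.symm (hno x hx)
        · rw [hup x hx, hup y hy]
          exact hpos.2 x hx y hy hadj'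

end

/-! ### From good subsets to systems. -/

section

variable [Fintype ι] {S : ι → κ → ℤ} {pos : ι → ℤ}

theorem form_eq (x y : κ → ℤ) : form x y = -(x ⬝ᵥ y) := rfl

/-- Potentials without source vanish, so the vectors are independent, and there are as many as the
rank. -/
theorem Fam.exists_inSpan (F : Fam (univ : Finset ι) S pos)
    (hcard : Fintype.card ι = Fintype.card κ) (q : κ) :
    ∃ φ, InSpan (univ : Finset ι) S q φ := by
  set b : ι → κ → ℚ := fun y p => S y p with hb
  have hli : LinearIndependent ℚ b := by
    rw [Fintype.linearIndependent_iff]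
    intro g hg
    have hp : ∀ p, ∑ y ∈ (univ : Finset ι), g y * (S y p : ℚ) = ((0 : κ → ℤ) p : ℤ) := by
      intro p
      have := congrFun hg p
      simpa [hb] using this
    have := F.eq_zero_of_source_eq_zero (isPot_of_comb hp) (subset_univ _) (fun _ _ => subset_univ _)
      (fun y _ => by simp)
    exact fun i => this i (mem_univ i)
  have htop := hli.span_eq_top_of_card_eq_finrank' (by rw [hcard, Module.finrank_fintype_fun_eq_card])
  have hmem : (Pi.single q 1 : κ → ℚ) ∈ Submodule.span ℚ (Set.range b) := by
    rw [htop]; trivial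
  obtain ⟨φ, hφ⟩ := (Submodule.mem_span_range_iff_exists_fun ℚ).1 hmem
  refine ⟨φ, fun p => ?_⟩
  have := congrFun hφ p
  simp only [hb, Finset.sum_apply, Pi.smul_apply, smul_eq_mul, Pi.single_apply] at this
  exact this

theorem IsLinear.exists_fam (h : IsLinear S) :
    ∃ pos, Fam (univ : Finset ι) S pos := by
  obtain ⟨pos, hinj, hadj⟩ := h.linear.exists_isLayout univ
  refine ⟨pos, ⟨fun x y hxy => hinj (by simp) (by simp) hxy, fun i _ => ?_, fun i _ j _ hij => ?_,
    fun i _ j _ hd => hadj i (mem_univ _) j (mem_univ _) ⟨?_, ?_⟩⟩⟩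
  · have := h.self_le i
    rw [form_eq] at this
    linarith
  · have := h.form_mem i j hij
    rw [form_eq] at this
    omega
  · rintro rfl
    have := h.self_le i
    rw [form_eq] at this
    linarith
  · rw [form_eq, hd]; norm_num

theorem conn_iff_reachable (F : Fam (univ : Finset ι) S pos) {x y : ι} :
    Conn univ S x y ↔ (intersectionGraph S).Reachable x y := by
  constructor
  · intro h
    induction h with
    | refl => exact SimpleGraph.Reachable.refl _
    | tail _ hb ih =>
      refine ih.trans (SimpleGraph.Adj.reachable ⟨(F.ne_of_mem_nb (mem_univ _) hb).symm, ?_⟩)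
      rw [form_eq, (mem_nb.1 hb).2]; norm_num
  · rintro ⟨p⟩
    induction p with
    | nil => exact Conn.refl
    | cons hadj _ ih =>
      refine (Conn.of_mem_nb (mem_nb.2 ⟨mem_univ _, ?_⟩)).trans ih
      have := hadj.2
      rw [form_eq] at this
      linarith

/-- With `t = -v` the products `t ⬝ᵥ S i` are the values `form v (S i)`. The linked vectors
represent the components, and `I S + c S ≤ 0` becomes the bound `3 * K.card` on the sum of the norms
plus `T.card`. -/
theorem IsGood.exists_sys [DecidableEq κ] (h : IsGood S) (hI : I S + (c S : ℤ) ≤ 0) {v : κ → ℤ}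
    (hv : LinkedOnceToEachComponent S v) :
    ∃ pos T, Sys univ S pos univ (-v) T ∧ T.card = c S := by
  obtain ⟨pos, F⟩ := h.isLinear.exists_fam
  set T := (univ : Finset ι).filter fun i => form v (S i) = 1 with hT
  have hTmem : ∀ i, i ∈ T ↔ form v (S i) = 1 := by simp [hT]
  have hdot : ∀ i, -v ⬝ᵥ S i = form v (S i) := fun i => by rw [form_eq, neg_dotProduct]
  have hcomp : ∀ x y, Conn univ S x y ↔ (intersectionGraph S).connectedComponentMk x =
      (intersectionGraph S).connectedComponentMk y := fun x y => by
    rw [conn_iff_reachable F, SimpleGraph.ConnectedComponent.eq]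
  have hsep : ∀ w ∈ T, ∀ w' ∈ T, Conn univ S w w' → w = w' := by
    intro w hw w' hw' hc
    obtain ⟨i, -, -, hi0⟩ := hv ((intersectionGraph S).connectedComponentMk w)
    rw [hTmem] at hw hw'
    have h1 : w = i := by
      by_contra hne
      have := hi0 w (by simp) hne
      omega
    have h2 : w' = i := by
      by_contra hne
      have := hi0 w' (by rw [SimpleGraph.ConnectedComponent.mem_supp_iff, ← hcomp]
                         exact hc.symm (mem_univ _)) hne
      omega
    rw [h1, h2]
  have hcover : ∀ x, ∃ w ∈ T, Conn univ S x w := by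
    intro x
    obtain ⟨i, hi, hi1, -⟩ := hv ((intersectionGraph S).connectedComponentMk x)
    refine ⟨i, (hTmem i).2 hi1, ?_⟩
    rw [hcomp]
    exact (SimpleGraph.ConnectedComponent.mem_supp_iff _ _).1 hi |>.symm
  have hcard : T.card = c S := by
    rw [c, ← Nat.card_eq_finsetCard]
    refine Nat.card_eq_of_bijective
      (fun w : T => (intersectionGraph S).connectedComponentMk w) ⟨fun w w' hww' => ?_, fun C => ?_⟩
    · exact Subtype.ext (hsep w w.2 w' w'.2 ((hcomp _ _).2 hww'))
    · induction C using SimpleGraph.ConnectedComponent.ind with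
      | h x =>
        obtain ⟨w, hw, hc⟩ := hcover x
        exact ⟨⟨w, hw⟩, ((hcomp _ _).1 hc).symm⟩
  refine ⟨pos, T, ⟨F, subset_univ _, fun q _ => F.exists_inSpan h.isLinear.card_eq q,
    fun _ _ q hq => absurd (mem_univ q) hq, fun q hq => absurd (mem_univ q) hq,
    fun y hy => by rw [hdot, (hTmem y).1 hy], fun y _ hy => ?_, hsep, fun x _ => hcover x,
    fun B _ hne hcl => ?_, ?_⟩, hcard⟩
  · rw [hdot]
    rw [hTmem] at hy
    obtain ⟨i, -, hi1, hi0⟩ := hv ((intersectionGraph S).connectedComponentMk y)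
    refine hi0 y (by simp) ?_
    rintro rfl
    exact hy hi1
  · obtain ⟨b, hb⟩ := hne
    refine eq_univ_of_forall fun x => ?_
    have hr := h.irreducible b x
    induction hr with
    | refl => exact hb
    | @tail a d _ hd ih =>
      obtain ⟨k, hk, hk'⟩ := hd
      refine hcl a ih d (mem_univ _) ⟨k, ?_, ?_⟩
      · intro h0
        apply hk
        rw [form_eq, single_dotProduct, h0]; simp
      · intro h0
        apply hk'
        rw [form_eq, single_dotProduct, h0]; simp
  · rw [hcard]
    rw [I, sum_congr rfl fun i _ => by rw [form_eq], sum_sub_distrib, sum_neg_distrib,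
      sum_const, card_univ, h.isLinear.card_eq] at hI
    rw [card_univ]
    simp only [nsmul_eq_mul, sum_neg_distrib] at hI
    linarith

end

end LinearSubset

theorem mainTheorem5 (N : ℕ) (S : Fin N → Fin N → ℤ) (hS : LinearSubset.IsGood S)
    (hI : LinearSubset.I S + (LinearSubset.c S : ℤ) ≤ 0)
    (hv : ∃ v : Fin N → ℤ, LinearSubset.LinkedOnceToEachComponent S v) :
    LinearSubset.c S ≤ 2 := by
  obtain ⟨v, hv⟩ := hv
  obtain ⟨pos, T, Y, hT⟩ := hS.exists_sys hI hv
  rw [← hT]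
  exact Y.card_le_two
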